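/- Notation. All spaces are on $\mathbb R^3$; $\widehat f$ is the Fourier transform, and $m(D)f$ denotes the Fourier multiplier $\widehat{m(D)f}(\xi)=m(\xi)\widehat f(\xi)$, $D=\nabla/i$. Let $\mathcal Z=\{f\in\mathcal S:\ \partial^\alpha\widehat f(0)=0\ \text{for all }\alpha\}$ and let $\mathcal Z'$ be its dual. Fix a radial $\varphi\in\mathcal S(\mathbb R^3)$ supported in $\{3/4\le|\xi|\le 8/3\}$ with $\sum_{j\in\mathbb Z}\varphi(2^{-j}\xi)=1$ for $\xi\ne0$, and put $\Delta_k=\varphi(2^{-k}D)$. For $\Omega\in\mathbb R$, $T>0$, $r\in[1,\infty]$, $s,\sigma\in\mathbb R$ and $u:(0,T)\to\mathcal Z'$ put $$\|u\|_{\widetilde L^r_T\dot{\mathcal B}^{s,\sigma}_{2,p}}=\sup_{2^k\le\Omega}2^{ks}\|\Delta_k u\|_{L^r(0,T;L^2)}+\sup_{2^k>\Omega}2^{k\sigma}\|\Delta_k u\|_{L^r(0,T;L^p)},$$ $$\|u\|_{E_{p,T}}=\|u\|_{\widetilde L^\infty_T\dot{\mathcal B}^{1/2,\,3/p-1}_{2,p}}+\|u\|_{\widetilde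 L^1_T\dot{\mathcal B}^{5/2,\,3/p+1}_{2,p}},$$ and let $E_{p,T}$ be the set of the ($\mathbb C^3$-valued, in particular real) vector fields $u:(0,T)\to(\mathcal Z')^3$ such that every $\Delta_ku$ is measurable on $(0,T)\times\mathbb R^3$ and $\|u\|_{E_{p,T}}<\infty$. For viscosity $\nu>0$ let $\mathcal G(t)$ be the Stokes–Coriolis semigroup, i.e. the Fourier multiplier with symbol $$\widehat{\mathcal G}(t,\xi)=e^{-\nu|\xi|^2t}\Big[\cos\big(\Omega\tfrac{\xi_3}{|\xi|}t\big)I+\sin\big(\Omega\tfrac{\xi_3}{|\xi|}t\big)R(\xi)\Big],\qquad R(\xi)=\frac1{|\xi|}\begin{pmatrix}0&\xi_3&-\xi_2\\-\xi_3&0&\xi_1\\ \xi_2&-\xi_1&0\end{pmatrix},$$ let $\mathbb P$ be the Helmholtz projection, with symbol $\delta_{lm}-\xi_l\xi_m/|\xi|^2$, and $(\nabla\cdot(u\otimes v))_m=\sum_n\partial_n(u_nv_m)$, where for a.e. $\tau$ the product is the pointwise product of the functions $\sum_{k}\Delta_ku(\tau)$ and $\sum_k\Delta_kv(\tau)$.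 Define $$B(u,v)(t)=\int_0^t\mathcal G(t-\tau)\,\mathbb P\,\nabla\cdot(u\otimes v)(\tau)\,d\tau,\qquad 0<t<T,$$ as an element of $(\mathcal Z')^3$, that is, by testing against the functions $\psi\in\mathcal S$ whose Fourier transform has compact support in $\mathbb R^3\setminus\{0\}$ (these are dense in $\mathcal Z$). Proposition. Let $p\in[2,4]$ and $\nu>0$. There is a constant $C$ (depending only on $\nu$, $p$ and $\varphi$, and in particular independent of $\Omega$ and $T$) such that for every $\Omega\in\mathbb R$, every $T>0$ and all $u,v\in E_{p,T}$, the series $\sum_k\Delta_ku(\tau)$ and $\sum_k\Delta_kv(\tau)$ converge absolutely at every point for a.e. $\tau\in(0,T)$, the integral defining $B(u,v)(t)$ converges absolutely against each such $\psi$ and defines an element of $(\mathcal Z')^3$ for every $t\in(0,T)$, $B(u,v)$ belongs to $E_{p,T}$, and $$\|B(u,v)\|_{E_{p,T}}\le C\,\|u\|_{E_{p,T}}\,\|v\|_{E_{p,T}}.$$ -/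

import Mathlib

open MeasureTheory Set
open scoped SchwartzMap FourierTransform ENNReal NNReal

namespace RotatingNS

/-- The space `ℝ³` with its Euclidean norm. -/
abbrev R3 : Type := EuclideanSpace ℝ (Fin 3)

/-- The space `ℂ³`, in which the vector fields take their values. -/
abbrev C3 : Type := EuclideanSpace ℂ (Fin 3)

/-- The space `𝒵(ℝ³)` of the Schwartz functions whose Fourier transform vanishes at the origin
together with all its derivatives. -/
def ZSpace : Submodule ℂ 𝓢(R3, ℂ) where
  carrier := {f | ∀ n : ℕ, iteratedFDeriv ℝ n (fun η : R3 => (𝓕 f) η) 0 = 0}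
  zero_mem' := by
    intro n
    have h : (fun η : R3 => (𝓕 (0 : 𝓢(R3, ℂ))) η) = 0 := by
      have h0 : 𝓕 (0 : 𝓢(R3, ℂ)) = 0 := map_zero (FourierTransform.fourierCLM ℂ 𝓢(R3, ℂ))
      funext η
      rw [h0]
      rfl
    rw [h]
    simp
  add_mem' := by
    intro f g hf hg n
    have h : (fun η : R3 => (𝓕 (f + g)) η)
        = (fun η : R3 => (𝓕 f) η) + (fun η : R3 => (𝓕 g) η) := by
      funext η
      rw [FourierTransform.fourier_add]
      rfl
    rw [h, iteratedFDeriv_add_apply ((𝓕 f).smooth n).contDiffAt ((𝓕 g).smooth n).contDiffAt,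
      hf n, hg n, add_zero]
  smul_mem' := by
    intro c f hf n
    have h : (fun η : R3 => (𝓕 (c • f)) η) = c • (fun η : R3 => (𝓕 f) η) := by
      funext η
      rw [FourierTransform.fourier_smul]
      rfl
    rw [h, iteratedFDeriv_const_smul_apply ((𝓕 f).smooth n).contDiffAt, hf n, smul_zero]

/-- The space `𝒵'(ℝ³)³`: continuous linear functionals on `𝒵(ℝ³)`, with values in `ℂ³`
(that is, triples of scalar elements of `𝒵'(ℝ³)`). -/
abbrev ZDual : Type := ZSpace →L[ℂ] C3

/-- A Littlewood-Paley cut-off: a radial Schwartz function supported in the annulus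
`3/4 ≤ |ξ| ≤ 8/3` whose dyadic dilates sum up to `1` away from the origin. -/
structure LPCutoff where
  /-- the function itself -/
  toFun : 𝓢(R3, ℂ)
  radial : ∀ ξ η : R3, ‖ξ‖ = ‖η‖ → toFun ξ = toFun η
  support : ∀ ξ : R3, toFun ξ ≠ 0 → 3 / 4 ≤ ‖ξ‖ ∧ ‖ξ‖ ≤ 8 / 3
  sum_eq_one : ∀ ξ : R3, ξ ≠ 0 → HasSum (fun j : ℤ => toFun ((2 : ℝ) ^ (-j) • ξ)) 1

/-- The nonzero number `2 ^ (-k) * 2π`. The frequency variable `ξ` of the symbols below is the one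
of `e^{i x·ξ}` (so that `D = ∇ / i`), whereas `𝓕` is normalised with `e^{-2π i x·η}`; hence
`ξ = 2π η` throughout. -/
noncomputable def dyadicUnit (k : ℤ) : ℝˣ :=
  Units.mk0 ((2 : ℝ) ^ (-k) * (2 * Real.pi)) (by positivity)

/-- The Schwartz function `η ↦ φ(2^{-k} 2π η)`, the symbol of `Δ_k`. -/
noncomputable def blockSymbol (φ : LPCutoff) (k : ℤ) : 𝓢(R3, ℂ) :=
  SchwartzMap.compCLMOfContinuousLinearEquiv ℂ
    (ContinuousLinearEquiv.smulLeft (R₁ := ℝ) (M₁ := R3) (dyadicUnit k)) φ.toFun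

theorem blockSymbol_apply (φ : LPCutoff) (k : ℤ) (η : R3) :
    blockSymbol φ k η = φ.toFun (((2 : ℝ) ^ (-k) * (2 * Real.pi)) • η) := rfl

/-- The convolution kernel `h_k` of `Δ_k = φ(2^{-k} D)`. -/
noncomputable def blockKernel (φ : LPCutoff) (k : ℤ) : 𝓢(R3, ℂ) := 𝓕⁻ (blockSymbol φ k)

/-- The Schwartz function `y ↦ h_k(x - y)`. -/
noncomputable def blockTestFun (φ : LPCutoff) (k : ℤ) (x : R3) : 𝓢(R3, ℂ) :=
  SchwartzMap.compCLMOfAntilipschitz (K := 1) (g := fun y : R3 => x - y) ℂ (by fun_prop)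
    (fun _ _ => by simp [edist_dist, dist_eq_norm, norm_sub_rev]) (blockKernel φ k)

theorem blockTestFun_apply (φ : LPCutoff) (k : ℤ) (x y : R3) :
    blockTestFun φ k x y = blockKernel φ k (x - y) := rfl

theorem fourier_blockTestFun (φ : LPCutoff) (k : ℤ) (x η : R3) :
    (𝓕 (blockTestFun φ k x)) η = Real.fourierChar (-inner ℝ x η) • blockSymbol φ k (-η) := by
  have h1 : 𝓕 (blockKernel φ k) = blockSymbol φ k := by simp [blockKernel]
  rw [← h1, SchwartzMap.fourier_coe, SchwartzMap.fourier_coe, Real.fourier_eq, Real.fourier_eq,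
    ← integral_sub_left_eq_self
      (fun y : R3 => Real.fourierChar (-inner ℝ y η) • blockTestFun φ k x y) volume x,
    Circle.smul_def, ← integral_smul]
  refine integral_congr_ae (Filter.Eventually.of_forall fun z => ?_)
  simp only [blockTestFun_apply, sub_sub_cancel, inner_sub_left, inner_neg_right, neg_neg,
    Circle.smul_def, smul_smul]
  congr 1
  rw [← Circle.coe_mul, ← AddChar.map_add_eq_mul]
  congr 2
  ring

theorem blockTestFun_mem (φ : LPCutoff) (k : ℤ) (x : R3) : blockTestFun φ k x ∈ ZSpace := by
  intro n
  have h : (fun η : R3 => (𝓕 (blockTestFun φ k x)) η) =ᶠ[nhds 0] fun _ => (0 : ℂ) := by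
    have hc : Filter.Tendsto (fun η : R3 => ‖((2 : ℝ) ^ (-k) * (2 * Real.pi)) • (-η)‖) (nhds 0)
        (nhds 0) := by
      have : Continuous (fun η : R3 => ‖((2 : ℝ) ^ (-k) * (2 * Real.pi)) • (-η)‖) := by fun_prop
      simpa using this.tendsto 0
    filter_upwards [hc.eventually (gt_mem_nhds (by norm_num : (0 : ℝ) < 3 / 4))] with η hη
    rw [fourier_blockTestFun, blockSymbol_apply]
    have h0 : φ.toFun (((2 : ℝ) ^ (-k) * (2 * Real.pi)) • (-η)) = 0 := by
      by_contra hne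
      exact absurd hη (not_lt.mpr (φ.support _ hne).1)
    rw [h0, smul_zero]
  have h2 := h.iteratedFDeriv ℝ n
  rw [h2.eq_of_nhds]
  exact congrFun (iteratedFDeriv_fun_zero (𝕜 := ℝ) (E := R3) (F := ℂ) (n := n)) 0

/-- The element `y ↦ h_k(x - y)` of `𝒵(ℝ³)`. -/
noncomputable def blockTest (φ : LPCutoff) (k : ℤ) (x : R3) : ZSpace :=
  ⟨blockTestFun φ k x, blockTestFun_mem φ k x⟩

/-- The frequency localisation `Δ_k f = φ(2^{-k} D) f = h_k * f` of `f ∈ 𝒵'(ℝ³)³`, which is a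
function on `ℝ³`. -/
noncomputable def block (φ : LPCutoff) (k : ℤ) (f : ZDual) (x : R3) : C3 := f (blockTest φ k x)

/-- The norm `‖Δ_k u‖_{L^r(0,T; L^q)}`. -/
noncomputable def blockNorm (φ : LPCutoff) (T : ℝ) (r q : ℝ≥0∞) (k : ℤ) (u : ℝ → ZDual) : ℝ≥0∞ :=
  eLpNorm (fun t : ℝ => eLpNorm (fun x : R3 => block φ k (u t) x) q volume) r
    (volume.restrict (Ioo 0 T))

/-- The norm of `L̃^r(0,T; Ḃ^{s,σ}_{2,p})`, the time-space hybrid-Besov space with frequency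
threshold `Ω`. -/
noncomputable def hybridNorm (φ : LPCutoff) (Ω T : ℝ) (r : ℝ≥0∞) (s σ p : ℝ) (u : ℝ → ZDual) :
    ℝ≥0∞ :=
  (⨆ (k : ℤ) (_ : (2 : ℝ) ^ k ≤ Ω),
      ENNReal.ofReal ((2 : ℝ) ^ ((k : ℝ) * s)) * blockNorm φ T r 2 k u)
    + ⨆ (k : ℤ) (_ : Ω < (2 : ℝ) ^ k),
      ENNReal.ofReal ((2 : ℝ) ^ ((k : ℝ) * σ)) * blockNorm φ T r (ENNReal.ofReal p) k u

/-- The norm of `E_{p,T}`. -/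
noncomputable def normE (φ : LPCutoff) (Ω p T : ℝ) (u : ℝ → ZDual) : ℝ≥0∞ :=
  hybridNorm φ Ω T ∞ (1 / 2) (3 / p - 1) p u + hybridNorm φ Ω T 1 (5 / 2) (3 / p + 1) p u

/-- `u ∈ E_{p,T}`: all the localisations `Δ_k u` are measurable on `(0,T) × ℝ³`, and the norm is
finite. -/
structure MemE (φ : LPCutoff) (Ω p T : ℝ) (u : ℝ → ZDual) : Prop where
  measurable : ∀ k : ℤ, AEStronglyMeasurable (fun z : ℝ × R3 => block φ k (u z.1) z.2)
    ((volume.restrict (Ioo 0 T)).prod volume)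
  norm_lt_top : normE φ Ω p T u < ∞

/-- The function `∑_k Δ_k f` represented by `f ∈ 𝒵'(ℝ³)³` (meaningful when the series converges
absolutely). -/
noncomputable def realization (φ : LPCutoff) (f : ZDual) (x : R3) : C3 := ∑' k : ℤ, block φ k f x

/-- The matrix `R(ξ)`. -/
noncomputable def coriolisMatrix (ξ : R3) : Matrix (Fin 3) (Fin 3) ℝ :=
  !![0, ξ 2 / ‖ξ‖, -(ξ 1 / ‖ξ‖);
     -(ξ 2 / ‖ξ‖), 0, ξ 0 / ‖ξ‖;
     ξ 1 / ‖ξ‖, -(ξ 0 / ‖ξ‖), 0]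

/-- The symbol of the Stokes-Coriolis semigroup `𝒢(t)`. -/
noncomputable def semigroupSymbol (ν Ω t : ℝ) (ξ : R3) : Matrix (Fin 3) (Fin 3) ℝ :=
  (Real.cos (Ω * (ξ 2 / ‖ξ‖) * t) * Real.exp (-ν * ‖ξ‖ ^ 2 * t)) • (1 : Matrix (Fin 3) (Fin 3) ℝ)
    + (Real.sin (Ω * (ξ 2 / ‖ξ‖) * t) * Real.exp (-ν * ‖ξ‖ ^ 2 * t)) • coriolisMatrix ξ

/-- The symbol `δ_{lm} - ξ_l ξ_m / |ξ|²` of the Helmholtz projection `ℙ`. -/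
noncomputable def helmholtzSymbol (ξ : R3) : Matrix (Fin 3) (Fin 3) ℝ :=
  Matrix.of fun l m => (if l = m then 1 else 0) - ξ l * ξ m / ‖ξ‖ ^ 2

/-- The symbol of `F ↦ (𝒢(t) ℙ ∇·F)_i` in the entry `F_{nm}`, where
`(∇·F)_m = ∑_n ∂_n F_{nm}`. -/
noncomputable def duhamelSymbol (ν Ω t : ℝ) (i n m : Fin 3) (ξ : R3) : ℂ :=
  (((semigroupSymbol ν Ω t ξ * helmholtzSymbol ξ) i m : ℝ) : ℂ) * (Complex.I * (ξ n : ℂ))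

/-- The function `a(-D) ψ`. The operator `a(-D)` is the transpose of `a(D)`, that is,
`⟨a(D) f, ψ⟩ = ⟨f, a(-D) ψ⟩` for the bilinear pairing. -/
noncomputable def transposeMultiplier (a : R3 → ℂ) (ψ : 𝓢(R3, ℂ)) : R3 → ℂ :=
  𝓕⁻ (fun η : R3 => a (-((2 * Real.pi) • η)) * (𝓕 ψ) η)

/-- For `F = f ⊗ g`, that is `F_{nm} = f_n g_m`, the function of `x` whose integral is the pairing
`⟨(𝒢(t) ℙ ∇·(f ⊗ g))_i, ψ⟩ = ∑_{n,m} ∫ f_n(x) g_m(x) [a_{inm}(-D) ψ](x) dx`. -/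
noncomputable def pairingDensity (ν Ω t : ℝ) (f g : R3 → C3) (i : Fin 3) (ψ : 𝓢(R3, ℂ)) (x : R3) :
    ℂ :=
  ∑ n : Fin 3, ∑ m : Fin 3,
    f x n * g x m * transposeMultiplier (duhamelSymbol ν Ω t i n m) ψ x

/-- `w = B(u,v)` on `(0,T)`, that is, `w(t) = ∫_0^t 𝒢(t-τ) ℙ ∇·(u ⊗ v)(τ) dτ` in `𝒵'(ℝ³)³` for
all `t ∈ (0,T)`. For almost every time `τ`, the product `u ⊗ v` is the pointwise product of the
functions represented by `u(τ)` and `v(τ)`. The identity is tested on the `ψ` whose Fourier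
transform is compactly supported in `ℝ³ \ {0}`; these are dense in `𝒵(ℝ³)`, so they determine
`w(t)`. All the series and integrals which occur are required to converge absolutely. -/
structure IsDuhamelTerm (φ : LPCutoff) (ν Ω T : ℝ) (u v w : ℝ → ZDual) : Prop where
  summable_left : ∀ᵐ τ ∂(volume.restrict (Ioo 0 T)), ∀ x, Summable fun k : ℤ => block φ k (u τ) x
  summable_right : ∀ᵐ τ ∂(volume.restrict (Ioo 0 T)), ∀ x, Summable fun k : ℤ => block φ k (v τ) x
  integrable_space : ∀ t ∈ Ioo 0 T, ∀ ψ : ZSpace, HasCompactSupport (𝓕 ψ.1 : 𝓢(R3, ℂ)) →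
    (0 : R3) ∉ tsupport (𝓕 ψ.1 : 𝓢(R3, ℂ)) → ∀ i : Fin 3,
    ∀ᵐ τ ∂(volume.restrict (Ioo 0 t)), Integrable (pairingDensity ν Ω (t - τ)
      (realization φ (u τ)) (realization φ (v τ)) i ψ.1)
  integrable_time : ∀ t ∈ Ioo 0 T, ∀ ψ : ZSpace, HasCompactSupport (𝓕 ψ.1 : 𝓢(R3, ℂ)) →
    (0 : R3) ∉ tsupport (𝓕 ψ.1 : 𝓢(R3, ℂ)) → ∀ i : Fin 3,
    IntegrableOn (fun τ => ∫ x, pairingDensity ν Ω (t - τ)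
      (realization φ (u τ)) (realization φ (v τ)) i ψ.1 x) (Ioo 0 t)
  eq_integral : ∀ t ∈ Ioo 0 T, ∀ ψ : ZSpace, HasCompactSupport (𝓕 ψ.1 : 𝓢(R3, ℂ)) →
    (0 : R3) ∉ tsupport (𝓕 ψ.1 : 𝓢(R3, ℂ)) → ∀ i : Fin 3,
    w t ψ i = ∫ τ in Ioo 0 t, ∫ x, pairingDensity ν Ω (t - τ)
      (realization φ (u τ)) (realization φ (v τ)) i ψ.1 x

end RotatingNS

/-! Rotation enters only through |cos|, |sin| ≤ 1: the entries of the symbol of 𝒢(t) are at most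
2e^{-ν|ξ|²t} whatever Ω is. By Plancherel, on frequencies of size 2^k the operator 𝒢(t)ℙ∇· therefore
costs C 2^k e^{-cν4^k t} on L². No dispersion is needed as long as the product u ⊗ v is measured in
L², and p ≤ 4 makes this possible, because a product of two L⁴ functions lies in L².

Bernstein's inequality merges the two regimes (L² below the threshold Ω, L^p above it) into bounds
that do not see Ω: with N(u) the norm of u in E_{p,T}, the L⁴ norm of Δ_k u is at most C N(u)
2^{k/4} in L^∞ of time, and C N(u) 2^{-7k/4} in L¹ of time (`exists_decayBound`).

If all indices in both factors are below k - 3, the product has no frequency in the annulus of index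
k (`Admissible.integral_lowProd_mul_eq_zero`), so Δ_k only sees pairs of indices (j, l) with max(j,
l) ≥ k - 3. In each pair, L¹ in time is put on the block of larger index and L^∞ on the other. This
gains 2^{-|j-l|/4}, so the double series converges although the norms are only suprema over k, and
the relevant part of the product has L¹_t L² norm at most C N(u) N(v) 2^{-3k/2}
(`DecayBound.lintegral_high_le`). No finer paraproduct decomposition is required.

In the Duhamel integral, bounding the heat factor by 1 gives 2^k 2^{-3k/2} = 2^{-k/2} in L^∞_t L²;
integrating it in time gains 1/(ν4^k), hence 2^{-5k/2} in L¹_t L². These are the weights of E_{2,T},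
and Bernstein from L² to L^p, with p ≥ 2, returns to E_{p,T} (`exists_normE_le`).

The remaining work gives meaning to the objects. Elements of 𝒵' are abstract functionals, and the
reproducing formula for their blocks rests on exchanging a functional with an integral of translates
(`apply_conv`). -/

namespace RotatingNS
open scoped BoundedContinuousFunction LineDeriv

/-! ### Translations, convolutions and continuous functionals on the Schwartz space -/

theorem norm_pow_le_two_pow_mul {E : Type*} [SeminormedAddCommGroup E] (z w : E) (r : ℝ) (k : ℕ)
    (h : ‖z‖ ≤ ‖w‖ + r) (hr : 0 ≤ r) : ‖z‖ ^ k ≤ 2 ^ k * (‖w‖ ^ k + r ^ k) := by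
  have h1 : ‖z‖ ≤ 2 * max ‖w‖ r := by
    rcases le_total ‖w‖ r with h' | h'
    · rw [max_eq_right h']; linarith
    · rw [max_eq_left h']; linarith
  calc ‖z‖ ^ k ≤ (2 * max ‖w‖ r) ^ k := pow_le_pow_left₀ (norm_nonneg _) h1 k
    _ = 2 ^ k * (max ‖w‖ r) ^ k := mul_pow _ _ _
    _ ≤ 2 ^ k * (‖w‖ ^ k + r ^ k) := by
      gcongr
      rcases le_total ‖w‖ r with h' | h'
      · rw [max_eq_right h']; linarith [pow_nonneg (norm_nonneg w) k]
      · rw [max_eq_left h']; linarith [pow_nonneg hr k]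

/-- Translation of Schwartz functions. -/
noncomputable abbrev translate (y : R3) (b : 𝓢(R3, ℂ)) : 𝓢(R3, ℂ) := b.compSubConstCLM ℂ y

theorem iteratedFDeriv_translate (b : 𝓢(R3, ℂ)) (y z : R3) (n : ℕ) :
    iteratedFDeriv ℝ n (translate y b) z = iteratedFDeriv ℝ n b (z - y) := by
  have : (translate y b : R3 → ℂ) = fun x => b (x - y) := rfl
  rw [this, iteratedFDeriv_comp_sub]

/-- Translation costs only polynomial growth in y, which a Schwartz weight a(y) absorbs; this is
what makes y ↦ a(y) · (translate of b) integrable in every seminorm. -/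
theorem seminorm_translate_le (b : 𝓢(R3, ℂ)) (y : R3) (k n : ℕ) :
    SchwartzMap.seminorm ℂ k n (translate y b) ≤
      2 ^ k * (SchwartzMap.seminorm ℂ k n b + ‖y‖ ^ k * SchwartzMap.seminorm ℂ 0 n b) := by
  refine SchwartzMap.seminorm_le_bound ℂ k n _ (by positivity) fun z => ?_
  rw [iteratedFDeriv_translate]
  have h1 := SchwartzMap.le_seminorm ℂ k n b (z - y)
  have h2 := SchwartzMap.le_seminorm ℂ 0 n b (z - y)
  rw [pow_zero, one_mul] at h2
  have h3 := norm_pow_le_two_pow_mul z (z - y) ‖y‖ k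
    (by simpa using norm_add_le (z - y) y) (norm_nonneg _)
  calc ‖z‖ ^ k * ‖iteratedFDeriv ℝ n b (z - y)‖
      ≤ (2 ^ k * (‖z - y‖ ^ k + ‖y‖ ^ k)) * ‖iteratedFDeriv ℝ n b (z - y)‖ := by gcongr
    _ = 2 ^ k * (‖z - y‖ ^ k * ‖iteratedFDeriv ℝ n b (z - y)‖
        + ‖y‖ ^ k * ‖iteratedFDeriv ℝ n b (z - y)‖) := by ring
    _ ≤ _ := by gcongr

theorem seminorm_translate_sub_le (b : 𝓢(R3, ℂ)) (y y₀ : R3) (h : ‖y - y₀‖ ≤ 1) (k n : ℕ) :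
    SchwartzMap.seminorm ℂ k n (translate y b - translate y₀ b) ≤
      (2 ^ k * (SchwartzMap.seminorm ℂ k (n + 1) b
        + (‖y₀‖ + 1) ^ k * SchwartzMap.seminorm ℂ 0 (n + 1) b)) * ‖y - y₀‖ := by
  refine SchwartzMap.seminorm_le_bound ℂ k n _ (by positivity) fun z => ?_
  have e : iteratedFDeriv ℝ n (translate y b - translate y₀ b : 𝓢(R3, ℂ)) z
      = iteratedFDeriv ℝ n b (z - y) - iteratedFDeriv ℝ n b (z - y₀) := by
    have : ((translate y b - translate y₀ b : 𝓢(R3, ℂ)) : R3 → ℂ)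
      = (translate y b : R3 → ℂ) - (translate y₀ b : R3 → ℂ) := rfl
    rw [this, iteratedFDeriv_sub_apply ((translate y b).smooth n).contDiffAt
      ((translate y₀ b).smooth n).contDiffAt, iteratedFDeriv_translate, iteratedFDeriv_translate]
  rw [e]
  have hd : Differentiable ℝ (iteratedFDeriv ℝ n b) :=
    (b.smooth ⊤).differentiable_iteratedFDeriv (mod_cast ENat.natCast_lt_top n)
  -- Mean value inequality on the segment, with the weight ‖z‖^k frozen at the end point z; it is
  -- compared with the running point w through ‖z‖ ≤ ‖w‖ + ‖y₀‖ + 1.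
  have key := (convex_segment (𝕜 := ℝ) (z - y₀) (z - y)).norm_image_sub_le_of_norm_fderiv_le
    (f := (‖z‖ ^ k : ℝ) • iteratedFDeriv ℝ n b)
    (C := 2 ^ k * (SchwartzMap.seminorm ℂ k (n + 1) b
        + (‖y₀‖ + 1) ^ k * SchwartzMap.seminorm ℂ 0 (n + 1) b))
    (fun w _ => (hd w).const_smul _) (fun w hw => ?_) (left_mem_segment ℝ _ _)
    (right_mem_segment ℝ _ _)
  · have e2 : (z - y) - (z - y₀) = -(y - y₀) := by abel
    rw [Pi.smul_apply, Pi.smul_apply, ← smul_sub, norm_smul, e2, norm_neg] at key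
    simpa using key
  · rw [fderiv_const_smul (hd w), norm_smul, norm_fderiv_iteratedFDeriv]
    have h1 := SchwartzMap.le_seminorm ℂ k (n + 1) b w
    have h2 := SchwartzMap.le_seminorm ℂ 0 (n + 1) b w
    rw [pow_zero, one_mul] at h2
    have h4 : ‖z‖ ≤ ‖w‖ + (‖y₀‖ + 1) := by
      obtain ⟨s, t, hs, ht, hst, rfl⟩ := hw
      have e3 : z = (s • (z - y₀) + t • (z - y)) + (y₀ + t • (y - y₀)) := by
        have : t = 1 - s := by linarith
        subst this
        module
      calc ‖z‖ ≤ ‖s • (z - y₀) + t • (z - y)‖ + ‖y₀ + t • (y - y₀)‖ := by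
            conv_lhs => rw [e3]
            exact norm_add_le _ _
        _ ≤ _ := by
            gcongr
            refine (norm_add_le _ _).trans ?_
            gcongr
            rw [norm_smul, Real.norm_of_nonneg ht]
            nlinarith [norm_nonneg (y - y₀)]
    have h3 := norm_pow_le_two_pow_mul z w (‖y₀‖ + 1) k h4 (by positivity)
    calc ‖(‖z‖ ^ k : ℝ)‖ * ‖iteratedFDeriv ℝ (n + 1) b w‖
        ≤ (2 ^ k * (‖w‖ ^ k + (‖y₀‖ + 1) ^ k)) * ‖iteratedFDeriv ℝ (n + 1) b w‖ := by
          rw [Real.norm_of_nonneg (by positivity)]; gcongr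
      _ = 2 ^ k * (‖w‖ ^ k * ‖iteratedFDeriv ℝ (n + 1) b w‖
          + (‖y₀‖ + 1) ^ k * ‖iteratedFDeriv ℝ (n + 1) b w‖) := by ring
      _ ≤ _ := by gcongr

theorem continuous_translate (b : 𝓢(R3, ℂ)) : Continuous fun y : R3 => translate y b := by
  rw [continuous_iff_continuousAt]
  intro y₀
  rw [ContinuousAt, (schwartz_withSeminorms ℂ R3 ℂ).tendsto_nhds]
  rintro ⟨k, n⟩ ε hε
  set K := (2 ^ k * (SchwartzMap.seminorm ℂ k (n + 1) b
        + (‖y₀‖ + 1) ^ k * SchwartzMap.seminorm ℂ 0 (n + 1) b)) with hK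
  have hc : Filter.Tendsto (fun y : R3 => K * ‖y - y₀‖) (nhds y₀) (nhds 0) := by
    have : Continuous (fun y : R3 => K * ‖y - y₀‖) := by fun_prop
    simpa using this.tendsto y₀
  have hc1 : Filter.Tendsto (fun y : R3 => ‖y - y₀‖) (nhds y₀) (nhds 0) := by
    have : Continuous (fun y : R3 => ‖y - y₀‖) := by fun_prop
    simpa using this.tendsto y₀
  filter_upwards [hc.eventually (gt_mem_nhds hε), hc1.eventually (gt_mem_nhds one_pos)] with y h1 h2
  exact (seminorm_translate_sub_le b y y₀ h2.le k n).trans_lt h1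

/-- The convolution of Schwartz functions. -/
noncomputable abbrev conv (a b : 𝓢(R3, ℂ)) : 𝓢(R3, ℂ) :=
  SchwartzMap.convolution (ContinuousLinearMap.mul ℂ ℂ) a b

theorem conv_apply (a b : 𝓢(R3, ℂ)) (x : R3) : conv a b x = ∫ y, a y * b (x - y) := by
  rw [conv, SchwartzMap.convolution_apply]
  rfl

theorem fourier_conv_apply (a b : 𝓢(R3, ℂ)) (η : R3) : 𝓕 (conv a b) η = 𝓕 a η * 𝓕 b η := by
  rw [conv, SchwartzMap.fourier_convolution]
  rfl

theorem fourier_injective {a b : 𝓢(R3, ℂ)} (h : ∀ η, 𝓕 a η = 𝓕 b η) : a = b := by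
  have h1 : 𝓕 a = 𝓕 b := SchwartzMap.ext h
  have h2 := congrArg (fun c : 𝓢(R3, ℂ) => (𝓕⁻ c : 𝓢(R3, ℂ))) h1
  simpa using h2

/-- On the Fourier side a derivative is a factor, which may be attached to b alone. This identifies
all the derivatives of a convolution with integrals of derivatives of translates of b. -/
theorem lineDeriv_conv (a b : 𝓢(R3, ℂ)) (m : R3) : ∂_{m} (conv a b) = conv a (∂_{m} b) := by
  have hg : (fun x : R3 => inner ℝ x m).HasTemperateGrowth := by fun_prop
  refine fourier_injective fun η => ?_
  rw [fourier_conv_apply, SchwartzMap.fourier_lineDerivOp_eq, SchwartzMap.fourier_lineDerivOp_eq]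
  simp only [_root_.smul_apply, SchwartzMap.smulLeftCLM_apply_apply hg, fourier_conv_apply,
    smul_eq_mul, Complex.real_smul]
  ring

theorem iteratedLineDeriv_conv (a b : 𝓢(R3, ℂ)) (n : ℕ) (m : Fin n → R3) :
    ∂^{m} (conv a b) = conv a (∂^{m} b) := by
  induction n with
  | zero => simp
  | succ n ih => rw [LineDeriv.iteratedLineDerivOp_succ_left, LineDeriv.iteratedLineDerivOp_succ_left, ih, lineDeriv_conv]

/-- Hahn-Banach: a linear functional controlled by the norm of an embedding into a normed space
extends to that space. -/
theorem exists_extension_of_injective {V W : Type*} [AddCommGroup V] [Module ℂ V]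
    [NormedAddCommGroup W] [NormedSpace ℂ W] (ι : V →ₗ[ℂ] W) (hι : Function.Injective ι)
    (T : V →ₗ[ℂ] ℂ) (C : ℝ) (hC : ∀ v, ‖T v‖ ≤ C * ‖ι v‖) :
    ∃ L : W →L[ℂ] ℂ, ∀ v, L (ι v) = T v := by
  let e := LinearEquiv.ofInjective ι hι
  let f : StrongDual ℂ (LinearMap.range ι) := LinearMap.mkContinuous
    (T ∘ₗ e.symm.toLinearMap) C (fun w => by
      have := hC (e.symm w)
      have h2 : ι (e.symm w) = w := by
        have := e.apply_symm_apply w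
        conv_rhs => rw [← this]
        rfl
      rw [h2] at this
      simpa using this)
  obtain ⟨L, hL, -⟩ := exists_extension_norm_eq (LinearMap.range ι) f
  refine ⟨L, fun v => ?_⟩
  have := hL (e v)
  have h3 : ((e v : LinearMap.range ι) : W) = ι v := rfl
  rw [h3] at this
  rw [this]
  simp [f]

/-- The bounded function `z ↦ |z|^k D^n ψ(z)`. -/
noncomputable def weightedDeriv (k n : ℕ) :
    𝓢(R3, ℂ) →L[ℂ] (R3 →ᵇ (R3 [×n]→L[ℝ] ℂ)) :=
  SchwartzMap.mkCLMtoNormedSpace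
    (fun ψ => BoundedContinuousFunction.ofNormedAddCommGroup
      (fun z => (‖z‖ ^ k : ℝ) • iteratedFDeriv ℝ n ψ z)
      (by
        have := (ψ.smooth ⊤).continuous_iteratedFDeriv (m := n) (mod_cast le_top)
        fun_prop)
      (SchwartzMap.seminorm ℂ k n ψ) (fun z => by
        rw [norm_smul, Real.norm_of_nonneg (by positivity)]
        exact SchwartzMap.le_seminorm ℂ k n ψ z))
    (fun f g => by
      ext1 z
      have : ((f + g : 𝓢(R3, ℂ)) : R3 → ℂ) = (f : R3 → ℂ) + g := rfl
      simp [this, iteratedFDeriv_add_apply (f.smooth n).contDiffAt (g.smooth n).contDiffAt])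
    (fun c f => by
      ext1 z
      have : ((c • f : 𝓢(R3, ℂ)) : R3 → ℂ) = c • (f : R3 → ℂ) := rfl
      change (‖z‖ ^ k : ℝ) • iteratedFDeriv ℝ n (c • f : 𝓢(R3, ℂ)) z
        = c • ((‖z‖ ^ k : ℝ) • iteratedFDeriv ℝ n f z)
      rw [this, iteratedFDeriv_const_smul_apply (f.smooth n).contDiffAt, smul_comm])
    ⟨{(k, n)}, 1, zero_le_one, fun f => by
      rw [one_mul, Finset.sup_singleton]
      exact BoundedContinuousFunction.norm_ofNormedAddCommGroup_le _ (apply_nonneg _ _) _⟩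

theorem weightedDeriv_apply (k n : ℕ) (ψ : 𝓢(R3, ℂ)) (z : R3) :
    weightedDeriv k n ψ z = (‖z‖ ^ k : ℝ) • iteratedFDeriv ℝ n ψ z := rfl

theorem norm_weightedDeriv (k n : ℕ) (ψ : 𝓢(R3, ℂ)) :
    ‖weightedDeriv k n ψ‖ = SchwartzMap.seminorm ℂ k n ψ := by
  apply le_antisymm
  · refine (BoundedContinuousFunction.norm_le (apply_nonneg _ _)).2 fun z => ?_
    rw [weightedDeriv_apply, norm_smul, Real.norm_of_nonneg (by positivity)]
    exact SchwartzMap.le_seminorm ℂ k n ψ z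
  · refine SchwartzMap.seminorm_le_bound ℂ k n _ (norm_nonneg (weightedDeriv k n ψ)) fun z => ?_
    have := (weightedDeriv k n ψ).norm_coe_le_norm z
    rwa [weightedDeriv_apply, norm_smul, Real.norm_of_nonneg (by positivity)] at this

/-- A Banach space whose norm induces finitely many of the Schwartz seminorms. -/
def JetSpace (S : Finset (ℕ × ℕ)) : Type := ∀ i : S, (R3 →ᵇ (R3 [×i.1.2]→L[ℝ] ℂ))

noncomputable instance (S : Finset (ℕ × ℕ)) : NormedAddCommGroup (JetSpace S) :=
  inferInstanceAs (NormedAddCommGroup (∀ i : S, (R3 →ᵇ (R3 [×i.1.2]→L[ℝ] ℂ))))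

noncomputable instance (S : Finset (ℕ × ℕ)) : NormedSpace ℂ (JetSpace S) :=
  inferInstanceAs (NormedSpace ℂ (∀ i : S, (R3 →ᵇ (R3 [×i.1.2]→L[ℝ] ℂ))))

instance (S : Finset (ℕ × ℕ)) : CompleteSpace (JetSpace S) :=
  inferInstanceAs (CompleteSpace (∀ i : S, (R3 →ᵇ (R3 [×i.1.2]→L[ℝ] ℂ))))

namespace JetSpace

/-- The component of index `i`. -/
noncomputable def proj {S : Finset (ℕ × ℕ)} (i : S) :
    JetSpace S →L[ℂ] (R3 →ᵇ (R3 [×i.1.2]→L[ℝ] ℂ)) :=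
  ContinuousLinearMap.proj (R := ℂ) (φ := fun i : S => (R3 →ᵇ (R3 [×i.1.2]→L[ℝ] ℂ))) i

theorem norm_le_iff {S : Finset (ℕ × ℕ)} (w : JetSpace S) {r : ℝ} (hr : 0 ≤ r) :
    ‖w‖ ≤ r ↔ ∀ i, ‖proj i w‖ ≤ r :=
  pi_norm_le_iff_of_nonneg (G := fun i : S => (R3 →ᵇ (R3 [×i.1.2]→L[ℝ] ℂ))) hr

theorem ext {S : Finset (ℕ × ℕ)} {w w' : JetSpace S} (h : ∀ i, proj i w = proj i w') : w = w' :=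
  funext h

/-- The jet of a Schwartz function. -/
noncomputable def ofSchwartz (S : Finset (ℕ × ℕ)) : 𝓢(R3, ℂ) →L[ℂ] JetSpace S :=
  ContinuousLinearMap.pi (φ := fun i : S => (R3 →ᵇ (R3 [×i.1.2]→L[ℝ] ℂ)))
    fun i => weightedDeriv i.1.1 i.1.2

theorem proj_ofSchwartz {S : Finset (ℕ × ℕ)} (i : S) (ψ : 𝓢(R3, ℂ)) :
    proj i (ofSchwartz S ψ) = weightedDeriv i.1.1 i.1.2 ψ := rfl

theorem ofSchwartz_injective {S : Finset (ℕ × ℕ)} (hS : (0, 0) ∈ S) :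
    Function.Injective (ofSchwartz S) := by
  intro f g h
  have := congrArg (proj ⟨(0, 0), hS⟩) h
  rw [proj_ofSchwartz, proj_ofSchwartz] at this
  ext z
  have h2 := DFunLike.congr_fun this z
  rw [weightedDeriv_apply, weightedDeriv_apply] at h2
  have h3 := DFunLike.congr_fun h2 0
  simpa using h3

theorem seminorm_le_norm_ofSchwartz {S : Finset (ℕ × ℕ)} (i : S) (ψ : 𝓢(R3, ℂ)) :
    SchwartzMap.seminorm ℂ i.1.1 i.1.2 ψ ≤ ‖ofSchwartz S ψ‖ := by
  rw [← norm_weightedDeriv, ← proj_ofSchwartz]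
  exact (norm_le_iff _ (norm_nonneg _)).1 le_rfl i

/-- The Schwartz space is not normed, so the integral of translates is taken in a Banach space
recording finitely many seminorms: continuity in y gives measurability, and the polynomial growth of
the seminorms is beaten by a. -/
theorem integrable_smul_translate (S : Finset (ℕ × ℕ)) (a b : 𝓢(R3, ℂ)) :
    Integrable fun y => a y • ofSchwartz S (translate y b) := by
  have hcont : Continuous fun y => ofSchwartz S (translate y b) :=
    (ofSchwartz S).continuous.comp (continuous_translate b)
  have hpow : ∀ k : ℕ, Integrable fun y => ‖a y‖ * (1 + ‖y‖ ^ k) := by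
    intro k
    have h1 := a.integrable_pow_mul volume k
    have h2 := a.integrable.norm (μ := volume)
    refine (h2.add h1).congr (Filter.Eventually.of_forall fun y => ?_)
    simp only [Pi.add_apply]
    ring
  have hsum : Integrable fun y => ∑ i : S, (2 ^ i.1.1 * (SchwartzMap.seminorm ℂ i.1.1 i.1.2 b
      + SchwartzMap.seminorm ℂ 0 i.1.2 b)) * (‖a y‖ * (1 + ‖y‖ ^ i.1.1)) :=
    integrable_finsetSum _ fun i _ => (hpow i.1.1).const_mul _
  refine hsum.mono' ?_ (Filter.Eventually.of_forall fun y => ?_)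
  · exact (a.continuous.smul hcont).aestronglyMeasurable
  · have hp : ∀ i : S, 0 ≤ (2 ^ i.1.1 * (SchwartzMap.seminorm ℂ i.1.1 i.1.2 b
      + SchwartzMap.seminorm ℂ 0 i.1.2 b)) * (‖a y‖ * (1 + ‖y‖ ^ i.1.1)) :=
      fun i => by positivity
    rw [norm_le_iff _ (Finset.sum_nonneg fun i _ => hp i)]
    intro i
    refine le_trans ?_ (Finset.single_le_sum (fun i _ => hp i) (Finset.mem_univ i))
    rw [← map_smul, proj_ofSchwartz, norm_weightedDeriv, map_smul_eq_mul]
    have := seminorm_translate_le b y i.1.1 i.1.2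
    have h0 : 0 ≤ SchwartzMap.seminorm ℂ i.1.1 i.1.2 b := apply_nonneg _ _
    have h1 : 0 ≤ SchwartzMap.seminorm ℂ 0 i.1.2 b := apply_nonneg _ _
    have h2 : 0 ≤ ‖y‖ ^ i.1.1 := by positivity
    calc ‖a y‖ * SchwartzMap.seminorm ℂ i.1.1 i.1.2 (translate y b)
        ≤ ‖a y‖ * (2 ^ i.1.1 * (SchwartzMap.seminorm ℂ i.1.1 i.1.2 b
          + ‖y‖ ^ i.1.1 * SchwartzMap.seminorm ℂ 0 i.1.2 b)) := by gcongr
      _ ≤ ‖a y‖ * (2 ^ i.1.1 * ((SchwartzMap.seminorm ℂ i.1.1 i.1.2 b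
          + SchwartzMap.seminorm ℂ 0 i.1.2 b) * (1 + ‖y‖ ^ i.1.1))) := by
          gcongr
          nlinarith
      _ = _ := by ring

/-- Point evaluations and multilinear evaluations are continuous and separate points, so the Bochner
integral is computed scalar by scalar; each scalar is a convolution with a line derivative of b. -/
theorem integral_smul_translate (S : Finset (ℕ × ℕ)) (a b : 𝓢(R3, ℂ)) :
    ∫ y, a y • ofSchwartz S (translate y b) = ofSchwartz S (conv a b) := by
  have hint := integrable_smul_translate S a b
  refine ext fun i => ?_
  ext1 z
  let E : JetSpace S →L[ℂ] (R3 [×i.1.2]→L[ℝ] ℂ) :=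
    (BoundedContinuousFunction.evalCLM ℂ z).comp (proj i)
  have hE : ∀ w : JetSpace S, E w = proj i w z := fun w => rfl
  rw [← hE, ← hE, ← E.integral_comp_comm hint]
  ext m
  let E2 : (R3 [×i.1.2]→L[ℝ] ℂ) →L[ℝ] ℂ := ContinuousMultilinearMap.apply ℝ (fun _ => R3) ℂ m
  have hE2 : ∀ w, E2 w = w m := fun w => rfl
  rw [← hE2, ← hE2, ← E2.integral_comp_comm (E.integrable_comp hint)]
  have e1 : ∀ y, E2 (E (a y • ofSchwartz S (translate y b)))
      = (‖z‖ ^ i.1.1 : ℝ) • (a y * (∂^{m} b) (z - y)) := by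
    intro y
    rw [hE2, hE, SchwartzMap.iteratedLineDerivOp_eq_iteratedFDeriv, ← iteratedFDeriv_translate,
      map_smul, proj_ofSchwartz, BoundedContinuousFunction.smul_apply, weightedDeriv_apply]
    simp only [_root_.smul_apply, smul_eq_mul, Complex.real_smul]
    ring
  simp_rw [e1]
  rw [integral_smul, ← conv_apply, ← iteratedLineDeriv_conv,
    SchwartzMap.iteratedLineDerivOp_eq_iteratedFDeriv, hE2, hE, proj_ofSchwartz,
    weightedDeriv_apply]
  rfl

end JetSpace

/-- A continuous functional commutes with the superposition of translates: the convolution of a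
tempered distribution with a Schwartz function is a function. -/
theorem apply_conv (T : 𝓢(R3, ℂ) →L[ℂ] ℂ) (a b : 𝓢(R3, ℂ)) :
    Integrable (fun y => a y * T (translate y b)) ∧
      T (conv a b) = ∫ y, a y * T (translate y b) := by
  obtain ⟨s, C, hC⟩ : ∃ (s : Finset (ℕ × ℕ)) (C : ℝ≥0), ∀ ψ,
      ‖T ψ‖ ≤ C * s.sup (schwartzSeminormFamily ℂ R3 ℂ) ψ := by
    obtain ⟨s, C, -, h⟩ := Seminorm.bound_of_continuous (schwartz_withSeminorms ℂ R3 ℂ)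
      ((normSeminorm ℂ ℂ).comp T.toLinearMap) (by
        change Continuous fun ψ => ‖T ψ‖
        fun_prop)
    exact ⟨s, C, fun ψ => h ψ⟩
  -- The index (0, 0) is added so that the jet determines the function.
  set S := insert (0, 0) s with hS
  have hbound : ∀ ψ, ‖T ψ‖ ≤ C * ‖JetSpace.ofSchwartz S ψ‖ := by
    intro ψ
    refine (hC ψ).trans ?_
    gcongr
    exact Seminorm.finset_sup_apply_le (norm_nonneg _) fun i hi =>
      JetSpace.seminorm_le_norm_ofSchwartz (S := S) ⟨i, by simp [hS, hi]⟩ ψ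
  -- The extension L is a bounded functional on a Banach space, hence commutes with the Bochner
  -- integral of the translates.
  obtain ⟨L, hL⟩ := exists_extension_of_injective (JetSpace.ofSchwartz S).toLinearMap
    (JetSpace.ofSchwartz_injective (by simp [hS])) T.toLinearMap C hbound
  have hL' : ∀ ψ, L (JetSpace.ofSchwartz S ψ) = T ψ := hL
  have hint := JetSpace.integrable_smul_translate S a b
  have e : ∀ y, L (a y • JetSpace.ofSchwartz S (translate y b)) = a y * T (translate y b) := by
    intro y
    rw [map_smul, hL', smul_eq_mul]
  constructor
  · simpa only [e] using L.integrable_comp hint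
  · rw [← hL', ← JetSpace.integral_smul_translate, ← L.integral_comp_comm hint]
    simp_rw [e]

end RotatingNS

/-! ### Littlewood-Paley blocks: reproducing formula and spectral support of products -/

namespace RotatingNS

theorem mem_ZSpace_of_eventuallyEq {a : 𝓢(R3, ℂ)}
    (h : (fun η : R3 => (𝓕 a) η) =ᶠ[nhds 0] fun _ => (0 : ℂ)) : a ∈ ZSpace := by
  intro n
  rw [(h.iteratedFDeriv ℝ n).eq_of_nhds]
  exact congrFun (iteratedFDeriv_fun_zero (𝕜 := ℝ) (E := R3) (F := ℂ) (n := n)) 0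

theorem fourier_translate (b : 𝓢(R3, ℂ)) (x η : R3) :
    𝓕 (translate x b) η = Real.fourierChar (-inner ℝ x η) • 𝓕 b η := by
  rw [SchwartzMap.fourier_coe, SchwartzMap.fourier_coe, Real.fourier_eq, Real.fourier_eq,
    ← integral_add_right_eq_self
      (fun y : R3 => Real.fourierChar (-inner ℝ y η) • translate x b y) x,
    Circle.smul_def, ← integral_smul]
  refine integral_congr_ae (Filter.Eventually.of_forall fun z => ?_)
  simp only [SchwartzMap.compSubConstCLM_apply, add_sub_cancel_right, inner_add_left,
    Circle.smul_def, smul_smul]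
  congr 1
  rw [← Circle.coe_mul, ← AddChar.map_add_eq_mul]
  congr 2
  ring

theorem fourier_fourier_neg (a : 𝓢(R3, ℂ)) (x : R3) : 𝓕 (𝓕 a) (-x) = a x := by
  have h : (𝓕⁻ (𝓕 a) : 𝓢(R3, ℂ)) x = a x := by simp
  rw [← h, SchwartzMap.fourierInv_coe, Real.fourierInv_eq_fourier_neg]
  rfl

/-- The product of Schwartz functions. -/
noncomputable abbrev prod (a b : 𝓢(R3, ℂ)) : 𝓢(R3, ℂ) :=
  SchwartzMap.pairing (ContinuousLinearMap.mul ℂ ℂ) a b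

theorem prod_apply (a b : 𝓢(R3, ℂ)) (x : R3) : prod a b x = a x * b x := rfl

/-- The convolution theorem applied to the transforms of a and b, combined with 𝓕𝓕a(-x) = a(x). -/
theorem fourier_prod (a b : 𝓢(R3, ℂ)) : 𝓕 (prod a b) = conv (𝓕 a) (𝓕 b) := by
  refine fourier_injective fun η => ?_
  rw [fourier_conv_apply]
  have h := fourier_fourier_neg (prod a b) (-η)
  rw [neg_neg] at h
  rw [h, prod_apply, ← fourier_fourier_neg a, ← fourier_fourier_neg b, neg_neg]

section Cutoff

variable (φ : LPCutoff)

theorem blockSymbol_neg (k : ℤ) (η : R3) : blockSymbol φ k (-η) = blockSymbol φ k η := by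
  rw [blockSymbol_apply, blockSymbol_apply]
  exact φ.radial _ _ (by simp)

theorem fourier_blockKernel (k : ℤ) : 𝓕 (blockKernel φ k) = blockSymbol φ k := by
  simp [blockKernel]

/-- Radiality of φ is used here: the kernel h_k is even. -/
theorem blockTestFun_eq_translate (k : ℤ) (x : R3) :
    blockTestFun φ k x = translate x (blockKernel φ k) := by
  refine fourier_injective fun η => ?_
  rw [fourier_blockTestFun, fourier_translate, blockSymbol_neg, fourier_blockKernel]

theorem norm_dyadic_smul (k : ℤ) (η : R3) :
    ‖((2 : ℝ) ^ (-k) * (2 * Real.pi)) • η‖ = 2 ^ (-k) * (2 * Real.pi) * ‖η‖ := by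
  rw [norm_smul, Real.norm_of_nonneg (by positivity)]

theorem blockSymbol_support (k : ℤ) (η : R3) (h : blockSymbol φ k η ≠ 0) :
    3 / 4 * 2 ^ k ≤ 2 * Real.pi * ‖η‖ ∧ 2 * Real.pi * ‖η‖ ≤ 8 / 3 * 2 ^ k := by
  have := φ.support (((2 : ℝ) ^ (-k) * (2 * Real.pi)) • η) h
  rw [norm_dyadic_smul, zpow_neg] at this
  have h2 : (0 : ℝ) < 2 ^ k := by positivity
  have e : ((2 : ℝ) ^ k)⁻¹ * (2 * Real.pi) * ‖η‖ = (2 * Real.pi * ‖η‖) / 2 ^ k := by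
    field_simp
  rw [e, le_div_iff₀ h2, div_le_iff₀ h2] at this
  exact this

/-- The Schwartz function `φ_{k-1} + φ_k + φ_{k+1}`, equal to `1` on the support of `φ_k`. -/
noncomputable def wideSymbol (k : ℤ) : 𝓢(R3, ℂ) :=
  blockSymbol φ (k - 1) + blockSymbol φ k + blockSymbol φ (k + 1)

/-- The kernel of `Δ_{k-1} + Δ_k + Δ_{k+1}`. -/
noncomputable def wideKernel (k : ℤ) : 𝓢(R3, ℂ) := 𝓕⁻ (wideSymbol φ k)

theorem fourier_wideKernel (k : ℤ) : 𝓕 (wideKernel φ k) = wideSymbol φ k := by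
  simp [wideKernel]

theorem wideSymbol_apply (k : ℤ) (η : R3) : wideSymbol φ k η =
    blockSymbol φ (k - 1) η + blockSymbol φ k η + blockSymbol φ (k + 1) η := rfl

theorem wideSymbol_support (k : ℤ) (η : R3) (h : wideSymbol φ k η ≠ 0) :
    3 / 4 * 2 ^ (k - 1) ≤ 2 * Real.pi * ‖η‖ ∧ 2 * Real.pi * ‖η‖ ≤ 8 / 3 * 2 ^ (k + 1) := by
  have e1 : (2 : ℝ) ^ (k - 1) = 2 ^ k / 2 := by rw [zpow_sub_one₀ two_ne_zero]; ring
  have e2 : (2 : ℝ) ^ (k + 1) = 2 ^ k * 2 := by rw [zpow_add_one₀ two_ne_zero]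
  have h2 : (0 : ℝ) < 2 ^ k := by positivity
  rw [e1, e2]
  by_cases h1 : blockSymbol φ (k - 1) η = 0
  · by_cases h3 : blockSymbol φ k η = 0
    · have h4 : blockSymbol φ (k + 1) η ≠ 0 := fun h4 => h (by rw [wideSymbol_apply, h1, h3, h4]; simp)
      have := blockSymbol_support φ _ _ h4
      rw [e2] at this
      constructor <;> linarith
    · have := blockSymbol_support φ _ _ h3
      constructor <;> linarith
  · have := blockSymbol_support φ _ _ h1
    rw [e1] at this
    constructor <;> linarith

theorem wideSymbol_mul_blockSymbol (k : ℤ) (η : R3) :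
    wideSymbol φ k η * blockSymbol φ k η = blockSymbol φ k η := by
  by_cases h : blockSymbol φ k η = 0
  · rw [h, mul_zero]
  suffices wideSymbol φ k η = 1 by rw [this, one_mul]
  have hs := blockSymbol_support φ k η h
  have h2 : (0 : ℝ) < 2 ^ k := by positivity
  have hη : η ≠ 0 := by
    rintro rfl
    rw [norm_zero, mul_zero] at hs
    linarith [hs.1]
  have hpi : (2 * Real.pi) • η ≠ 0 := by simp [hη, Real.pi_ne_zero]
  have hsum := φ.sum_eq_one _ hpi
  have e : ∀ j : ℤ, φ.toFun ((2 : ℝ) ^ (-j) • (2 * Real.pi) • η) = blockSymbol φ j η := by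
    intro j
    rw [blockSymbol_apply, smul_smul]
  simp_rw [e] at hsum
  have hf : HasSum (fun j : ℤ => blockSymbol φ j η)
      (∑ j ∈ ({k - 1, k, k + 1} : Finset ℤ), blockSymbol φ j η) := by
    apply hasSum_sum_of_ne_finset_zero
    intro j hj
    by_contra hne
    have h3 := blockSymbol_support φ j η hne
    simp only [Finset.mem_insert, Finset.mem_singleton, not_or] at hj
    -- Annuli two indices apart are disjoint: 8/3 · 2^{k-2} = 2/3 · 2^k < 3/4 · 2^k, and 3/4 ·
    -- 2^{k+2} = 3 · 2^k > 8/3 · 2^k.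
    obtain hlt | hgt : j ≤ k - 2 ∨ k + 2 ≤ j := by omega
    · have h4 : (2 : ℝ) ^ j ≤ 2 ^ (k - 2) := zpow_le_zpow_right₀ one_le_two hlt
      rw [zpow_sub₀ two_ne_zero] at h4
      norm_num at h4
      linarith [h3.2, hs.1]
    · have h4 : (2 : ℝ) ^ (k + 2) ≤ 2 ^ j := zpow_le_zpow_right₀ one_le_two hgt
      rw [zpow_add₀ two_ne_zero] at h4
      norm_num at h4
      linarith [h3.1, hs.2]
  have h5 := hsum.unique hf
  rw [Finset.sum_insert (by simp; omega), Finset.sum_insert (by simp), Finset.sum_singleton] at h5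
  rw [wideSymbol_apply, h5]
  ring

theorem conv_translate_wideKernel (k : ℤ) (x : R3) :
    conv (translate x (wideKernel φ k)) (blockKernel φ k) = translate x (blockKernel φ k) := by
  refine fourier_injective fun η => ?_
  rw [fourier_conv_apply, fourier_translate, fourier_translate, fourier_wideKernel,
    fourier_blockKernel, smul_mul_assoc, wideSymbol_mul_blockSymbol]

theorem conv_wideKernel_translate (k : ℤ) (x : R3) :
    conv (wideKernel φ k) (translate x (blockKernel φ k)) = translate x (blockKernel φ k) := by
  refine fourier_injective fun η => ?_
  rw [fourier_conv_apply, fourier_translate, fourier_wideKernel,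
    fourier_blockKernel, mul_smul_comm, wideSymbol_mul_blockSymbol]

theorem conv_wideKernel_mem (k : ℤ) (ψ : 𝓢(R3, ℂ)) : conv (wideKernel φ k) ψ ∈ ZSpace := by
  apply mem_ZSpace_of_eventuallyEq
  have hc : Filter.Tendsto (fun η : R3 => 2 * Real.pi * ‖η‖) (nhds 0) (nhds 0) := by
    have : Continuous (fun η : R3 => 2 * Real.pi * ‖η‖) := by fun_prop
    simpa using this.tendsto 0
  filter_upwards [hc.eventually (gt_mem_nhds (by positivity : (0 : ℝ) < 3 / 4 * 2 ^ (k - 1)))]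
    with η hη
  rw [fourier_conv_apply, fourier_wideKernel]
  have h0 : wideSymbol φ k η = 0 := by
    by_contra hne
    exact absurd hη (not_lt.mpr (wideSymbol_support φ k η hne).1)
  rw [h0, zero_mul]

/-- The projection `Δ_{k-1} + Δ_k + Δ_{k+1}` from the Schwartz space to `𝒵`. -/
noncomputable def wideProj (k : ℤ) : 𝓢(R3, ℂ) →L[ℂ] ZSpace :=
  (SchwartzMap.convolution (ContinuousLinearMap.mul ℂ ℂ) (wideKernel φ k)).codRestrict ZSpace
    (conv_wideKernel_mem φ k)

theorem wideProj_translate (k : ℤ) (x : R3) :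
    wideProj φ k (translate x (blockKernel φ k)) = blockTest φ k x := by
  apply Subtype.ext
  change conv (wideKernel φ k) (translate x (blockKernel φ k)) = blockTestFun φ k x
  rw [conv_wideKernel_translate, blockTestFun_eq_translate]

/-- The tempered distribution `(Δ_{k-1} + Δ_k + Δ_{k+1}) f_i`. -/
noncomputable def wideDistribution (k : ℤ) (f : ZDual) (i : Fin 3) : 𝓢(R3, ℂ) →L[ℂ] ℂ :=
  (EuclideanSpace.proj i : C3 →L[ℂ] ℂ) ∘L f ∘L wideProj φ k

/-- The functional f acts only on 𝒵, whereas convolution arguments need all Schwartz functions.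
Composing with a projection equal to the identity on the spectrum of h_k produces a tempered
distribution without changing the block of index k. -/
theorem wideDistribution_translate (k : ℤ) (f : ZDual) (i : Fin 3) (x : R3) :
    wideDistribution φ k f i (translate x (blockKernel φ k)) = block φ k f x i := by
  change f (wideProj φ k (translate x (blockKernel φ k))) i = _
  rw [wideProj_translate]
  rfl

theorem continuous_block_apply (k : ℤ) (f : ZDual) (i : Fin 3) :
    Continuous fun x => block φ k f x i := by
  simp_rw [← wideDistribution_translate]
  exact (wideDistribution φ k f i).continuous.comp (continuous_translate _)

theorem continuous_block (k : ℤ) (f : ZDual) : Continuous (block φ k f) := by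
  have : Continuous fun x => (EuclideanSpace.equiv (Fin 3) ℂ) (block φ k f x) :=
    continuous_pi fun i => continuous_block_apply φ k f i
  exact (EuclideanSpace.equiv (Fin 3) ℂ).symm.continuous.comp this

/-- The reproducing formula `Δ_k f = (Δ_{k-1} + Δ_k + Δ_{k+1}) Δ_k f`. -/
theorem block_reproducing (k : ℤ) (f : ZDual) (i : Fin 3) (x : R3) :
    block φ k f x i = ∫ y, wideKernel φ k (y - x) * block φ k f y i := by
  have h := (apply_conv (wideDistribution φ k f i) (translate x (wideKernel φ k))
    (blockKernel φ k)).2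
  rw [conv_translate_wideKernel] at h
  simp_rw [wideDistribution_translate] at h
  exact h

/-- The pairing is a functional evaluated at ψ * h_k, and this convolution vanishes because the two
spectra are disjoint. -/
theorem integral_mul_block_eq_zero (k : ℤ) (f : ZDual) (i : Fin 3) (ψ : 𝓢(R3, ℂ))
    (hψ : ∀ η, 2 * Real.pi * ‖η‖ ≤ 8 / 3 * 2 ^ k → 𝓕 ψ η = 0) :
    ∫ y, ψ y * block φ k f y i = 0 := by
  have h := (apply_conv (wideDistribution φ k f i) ψ (blockKernel φ k)).2
  have h0 : conv ψ (blockKernel φ k) = 0 := by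
    refine fourier_injective fun η => ?_
    rw [fourier_conv_apply, fourier_blockKernel]
    have h1 : (𝓕 (0 : 𝓢(R3, ℂ))) η = 0 := by
      have h0 : 𝓕 (0 : 𝓢(R3, ℂ)) = 0 := map_zero (FourierTransform.fourierCLM ℂ 𝓢(R3, ℂ))
      rw [h0]; rfl
    rw [h1]
    by_cases hη : 2 * Real.pi * ‖η‖ ≤ 8 / 3 * 2 ^ k
    · rw [hψ η hη, zero_mul]
    · have : blockSymbol φ k η = 0 := by
        by_contra hne
        exact hη (blockSymbol_support φ k η hne).2
      rw [this, mul_zero]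
  rw [h0, map_zero] at h
  simp_rw [wideDistribution_translate] at h
  exact h.symm

/-- The transform of the product is a convolution: a frequency of modulus at most r, written as ζ +
(η - ζ) with the second part of modulus at most s, forces ζ to have modulus at most r + s. -/
theorem fourier_prod_eq_zero (a b : 𝓢(R3, ℂ)) (r s : ℝ)
    (ha : ∀ η, 2 * Real.pi * ‖η‖ ≤ r + s → 𝓕 a η = 0)
    (hb : ∀ η, 𝓕 b η ≠ 0 → 2 * Real.pi * ‖η‖ ≤ s) (η : R3) (hη : 2 * Real.pi * ‖η‖ ≤ r) :
    𝓕 (prod a b) η = 0 := by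
  rw [fourier_prod, conv_apply]
  refine integral_eq_zero_of_ae (Filter.Eventually.of_forall fun ζ => ?_)
  by_cases h1 : 2 * Real.pi * ‖ζ‖ ≤ r + s
  · simp [ha ζ h1]
  by_cases h2 : 𝓕 b (η - ζ) = 0
  · simp [h2]
  exfalso
  have h3 := hb _ h2
  have h4 : ‖ζ‖ ≤ ‖η‖ + ‖η - ζ‖ := by
    have := norm_sub_le η (η - ζ)
    simpa using this
  have := mul_le_mul_of_nonneg_left h4 (by positivity : 0 ≤ 2 * Real.pi)
  apply h1
  linarith

end Cutoff

/-- The Schwartz function `y ↦ b (z - y)`. -/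
noncomputable def reflect (z : R3) (b : 𝓢(R3, ℂ)) : 𝓢(R3, ℂ) :=
  SchwartzMap.compCLMOfAntilipschitz (K := 1) (g := fun y : R3 => z - y) ℂ (by fun_prop)
    (fun _ _ => by simp [edist_dist, dist_eq_norm, norm_sub_rev]) b

theorem reflect_apply (z : R3) (b : 𝓢(R3, ℂ)) (y : R3) : reflect z b y = b (z - y) := rfl

theorem fourier_reflect (z : R3) (b : 𝓢(R3, ℂ)) (η : R3) :
    𝓕 (reflect z b) η = Real.fourierChar (-inner ℝ z η) • 𝓕 b (-η) := by
  rw [SchwartzMap.fourier_coe, SchwartzMap.fourier_coe, Real.fourier_eq,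
    Real.fourier_eq, ← integral_sub_left_eq_self
    (fun y : R3 => Real.fourierChar (-inner ℝ y η) • reflect z b y) volume z,
    Circle.smul_def, ← integral_smul]
  refine integral_congr_ae (Filter.Eventually.of_forall fun w => ?_)
  simp only [reflect_apply, sub_sub_cancel,
    inner_sub_left, inner_neg_right, neg_neg, Circle.smul_def, smul_smul]
  congr 1
  rw [← Circle.coe_mul, ← AddChar.map_add_eq_mul]
  congr 2
  ring

/-- The Fubini hypothesis for inserting the reproducing formula into a product: the blocks are
merely bounded, and all decay comes from ψ(x)w(z - x), integrable after a shear. -/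
theorem integrable_mul_kernel_mul (F G : R3 → ℂ) (hF : Continuous F) (hG : Continuous G) (A B : ℝ)
    (hA : ∀ x, ‖F x‖ ≤ A) (hB : ∀ x, ‖G x‖ ≤ B) (ψ w : 𝓢(R3, ℂ)) :
    Integrable (Function.uncurry fun x z : R3 => F x * ψ x * (w (z - x) * G z))
      ((volume : Measure R3).prod volume) := by
  have h1 : Integrable (fun p : R3 × R3 => ψ p.1 * w p.2)
    ((volume : Measure R3).prod volume) := ψ.integrable.mul_prod w.integrable
  have h2 := (measurePreserving_prod_sub (volume : Measure R3)
    (volume : Measure R3)).integrable_comp_of_integrable h1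
  refine ((h2.norm.const_mul (A * B))).mono' ?_ (Filter.Eventually.of_forall ?_)
  · have := ψ.continuous
    have := w.continuous
    refine Continuous.aestronglyMeasurable ?_
    simp only [Function.uncurry_def]
    fun_prop
  · rintro ⟨x, z⟩
    simp only [Function.uncurry_apply_pair, Function.comp_apply, norm_mul]
    have hA := hA x
    have hB := hB z
    have : 0 ≤ A := (norm_nonneg _).trans hA
    calc ‖F x‖ * ‖ψ x‖ * (‖w (z - x)‖ * ‖G z‖)
        ≤ A * ‖ψ x‖ * (‖w (z - x)‖ * B) := by gcongr
      _ = _ := by ring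

/-- The product of bounded frequency localised functions is frequency localised. -/
theorem integral_mul_block_mul_block_eq_zero (φ : LPCutoff) (k l : ℤ) (f g : ZDual) (n m : Fin 3)
    (A B : ℝ) (hf : ∀ x, ‖block φ k f x n‖ ≤ A) (hg : ∀ x, ‖block φ l g x m‖ ≤ B)
    (ψ : 𝓢(R3, ℂ))
    (hψ : ∀ η, 2 * Real.pi * ‖η‖ ≤ 8 / 3 * 2 ^ k + 8 / 3 * 2 ^ (l + 1) → 𝓕 ψ η = 0) :
    ∫ x, block φ k f x n * block φ l g x m * ψ x = 0 := by
  -- The reproducing formula replaces the second block by a superposition of kernels. For fixed z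
  -- the first block is then tested against the Schwartz function ψ · w(z - ·); the wide kernel
  -- reaches up to 8/3 · 2^{l+1}, whence the shift in `hψ`.
  have e1 : ∀ x, block φ k f x n * block φ l g x m * ψ x =
      ∫ z, block φ k f x n * ψ x * (wideKernel φ l (z - x) * block φ l g z m) := by
    intro x
    rw [integral_const_mul, ← block_reproducing]
    ring
  simp_rw [e1]
  rw [integral_integral_swap (integrable_mul_kernel_mul _ _ (continuous_block_apply φ k f n)
    (continuous_block_apply φ l g m) A B hf hg ψ (wideKernel φ l))]
  refine integral_eq_zero_of_ae (Filter.Eventually.of_forall fun z => ?_)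
  have h0 := integral_mul_block_eq_zero φ k f n (prod ψ (reflect z (wideKernel φ l)))
    (fun η hη => fourier_prod_eq_zero ψ _ _ _ hψ (fun ζ hζ => by
      rw [fourier_reflect, fourier_wideKernel] at hζ
      have : wideSymbol φ l (-ζ) ≠ 0 := fun h => hζ (by rw [h, smul_zero])
      simpa using (wideSymbol_support φ l _ this).2) η hη)
  calc ∫ x, block φ k f x n * ψ x * (wideKernel φ l (z - x) * block φ l g z m)
      = ∫ x, (prod ψ (reflect z (wideKernel φ l)) x * block φ k f x n) * block φ l g z m := by
        refine integral_congr_ae (Filter.Eventually.of_forall fun x => ?_)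
        simp only [prod_apply, reflect_apply]
        ring
    _ = 0 := by rw [integral_mul_const, h0, zero_mul]

end RotatingNS

/-! ### Dyadic scaling and Bernstein inequalities -/

namespace RotatingNS

/-- Real powers of two, in `[0, ∞]`. -/
noncomputable def pow2 (s : ℝ) : ℝ≥0∞ := (2 : ℝ≥0∞) ^ s

theorem pow2_add (s t : ℝ) : pow2 (s + t) = pow2 s * pow2 t :=
  ENNReal.rpow_add _ _ two_ne_zero (by simp)

theorem pow2_zero : pow2 0 = 1 := ENNReal.rpow_zero

theorem pow2_rpow (s t : ℝ) : pow2 s ^ t = pow2 (s * t) := (ENNReal.rpow_mul _ _ _).symm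

theorem pow2_ne_top (s : ℝ) : pow2 s ≠ ∞ := by
  simp [pow2, ENNReal.rpow_eq_top_iff]

theorem pow2_mono {s t : ℝ} (h : s ≤ t) : pow2 s ≤ pow2 t :=
  ENNReal.rpow_le_rpow_of_exponent_le (by norm_num) h

theorem ofReal_two_rpow (s : ℝ) : ENNReal.ofReal ((2 : ℝ) ^ s) = pow2 s := by
  rw [← ENNReal.ofReal_rpow_of_pos two_pos, pow2]
  simp

theorem ofReal_two_zpow (k : ℤ) : ENNReal.ofReal ((2 : ℝ) ^ k) = pow2 k := by
  rw [← ofReal_two_rpow, Real.rpow_intCast]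

theorem lintegral_comp_zpow_smul (k : ℤ) (f : R3 → ℝ≥0∞) (hf : Measurable f) :
    ∫⁻ x, f ((2 : ℝ) ^ k • x) = pow2 (-(3 * k)) * ∫⁻ x, f x := by
  have h2 : (2 : ℝ) ^ k ≠ 0 := by positivity
  rw [← lintegral_map (f := f) (g := fun x : R3 => (2 : ℝ) ^ k • x) hf (measurable_const_smul _),
    Measure.map_addHaar_smul _ h2, lintegral_smul_measure, smul_eq_mul]
  congr 1
  rw [finrank_euclideanSpace_fin, abs_of_pos (by positivity), ← ofReal_two_rpow]
  congr 1
  rw [Real.rpow_neg two_pos.le, mul_comm, Real.rpow_mul two_pos.le, Real.rpow_intCast]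
  norm_cast

section

variable (φ : LPCutoff)

theorem blockSymbol_scaling (j k : ℤ) (η : R3) :
    blockSymbol φ (j + k) η = blockSymbol φ j ((2 : ℝ) ^ (-k) • η) := by
  rw [blockSymbol_apply, blockSymbol_apply, smul_smul, neg_add, zpow_add₀ two_ne_zero]
  congr 2
  ring

theorem wideSymbol_scaling (k : ℤ) (η : R3) :
    wideSymbol φ k η = wideSymbol φ 0 ((2 : ℝ) ^ (-k) • η) := by
  simp only [wideSymbol_apply, ← blockSymbol_scaling]
  congr 3 <;> ring_nf

theorem wideKernel_scaling (k : ℤ) (z : R3) :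
    wideKernel φ k z = (((2 : ℝ) ^ k) ^ 3 : ℝ) • wideKernel φ 0 ((2 : ℝ) ^ k • z) := by
  rw [wideKernel, wideKernel, SchwartzMap.fourierInv_coe, SchwartzMap.fourierInv_coe,
    Real.fourierInv_eq, Real.fourierInv_eq]
  have h := Measure.integral_comp_smul (volume : Measure R3)
    (fun v : R3 => Real.fourierChar (inner ℝ v ((2 : ℝ) ^ k • z)) • wideSymbol φ 0 v)
    ((2 : ℝ) ^ (-k))
  rw [finrank_euclideanSpace_fin, abs_of_pos (by positivity), zpow_neg, inv_pow, inv_inv] at h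
  rw [← h]
  refine integral_congr_ae (Filter.Eventually.of_forall fun v => ?_)
  have h2 : ∀ c : ℝ, (2 : ℝ) ^ k * (((2 : ℝ) ^ k)⁻¹ * c) = c :=
    fun c => mul_inv_cancel_left₀ (by positivity) c
  simp only [wideSymbol_scaling φ k, zpow_neg, real_inner_smul_left, real_inner_smul_right,
    h2]

theorem lintegral_wideKernel_rpow (k : ℤ) (r : ℝ) (hr : 0 < r) :
    (∫⁻ z, ‖wideKernel φ k z‖ₑ ^ r) ^ (1 / r) =
      pow2 (3 * k * (1 - 1 / r)) * (∫⁻ z, ‖wideKernel φ 0 z‖ₑ ^ r) ^ (1 / r) := by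
  have e : ∀ z, ‖wideKernel φ k z‖ₑ ^ r
      = pow2 (3 * k * r) * ‖wideKernel φ 0 ((2 : ℝ) ^ k • z)‖ₑ ^ r := by
    intro z
    rw [wideKernel_scaling, enorm_smul, ENNReal.mul_rpow_of_nonneg _ _ hr.le, ← pow2_rpow]
    congr 2
    rw [Real.enorm_of_nonneg (by positivity), ← ofReal_two_rpow, mul_comm,
      Real.rpow_mul two_pos.le, Real.rpow_intCast]
    norm_cast
  have hm : Measurable fun z => ‖wideKernel φ 0 z‖ₑ ^ r := by
    have := (wideKernel φ 0).continuous.measurable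
    fun_prop
  simp_rw [e]
  rw [lintegral_const_mul _ (f := fun z => ‖wideKernel φ 0 ((2 : ℝ) ^ k • z)‖ₑ ^ r)
      (hm.comp (measurable_const_smul _)),
    lintegral_comp_zpow_smul k _ hm, ← mul_assoc, ← pow2_add,
    ENNReal.mul_rpow_of_nonneg _ _ (by positivity), pow2_rpow]
  congr 2
  field_simp
  ring

theorem enorm_apply_le (v : C3) (i : Fin 3) : ‖v i‖ₑ ≤ ‖v‖ₑ :=
  enorm_le_iff_norm_le.2 (PiLp.norm_apply_le v i)

theorem norm_le_sum (v : C3) : ‖v‖ ≤ ∑ i, ‖v i‖ := by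
  rw [EuclideanSpace.norm_eq, Real.sqrt_le_iff]
  refine ⟨Finset.sum_nonneg fun i _ => norm_nonneg _, ?_⟩
  simp only [Fin.sum_univ_three]
  have h0 := norm_nonneg (v 0)
  have h1 := norm_nonneg (v 1)
  have h2 := norm_nonneg (v 2)
  nlinarith [mul_nonneg h0 h1, mul_nonneg h0 h2, mul_nonneg h1 h2]

theorem enorm_le_sum (v : C3) : ‖v‖ₑ ≤ ∑ i, ‖v i‖ₑ := by
  have := ENNReal.ofReal_le_ofReal (norm_le_sum v)
  rw [ENNReal.ofReal_sum_of_nonneg fun i _ => norm_nonneg _] at this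
  simpa only [ofReal_norm] using this

/-- Bernstein's inequality, pointwise bound. -/
theorem exists_enorm_block_le (q : ℝ) (hq : 1 < q) : ∃ C : ℝ≥0, ∀ (k : ℤ) (f : ZDual) (x : R3),
    ‖block φ k f x‖ₑ ≤ C * pow2 (3 * k / q) * eLpNorm (block φ k f) (ENNReal.ofReal q) volume := by
  have hc : q.HolderConjugate q.conjExponent := Real.HolderConjugate.conjExponent hq
  set r := q.conjExponent with hr
  have hr0 : 0 < r := hc.symm.pos
  have hfin : (∫⁻ z, ‖wideKernel φ 0 z‖ₑ ^ r) ^ (1 / r) ≠ ∞ := by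
    have h1 := ((wideKernel φ 0).memLp (ENNReal.ofReal r) volume).2
    rw [eLpNorm_eq_lintegral_rpow_enorm_toReal (by simpa using hr0) (by simp),
      ENNReal.toReal_ofReal hr0.le] at h1
    exact h1.ne
  refine ⟨3 * ((∫⁻ z, ‖wideKernel φ 0 z‖ₑ ^ r) ^ (1 / r)).toNNReal, fun k f x => ?_⟩
  rw [ENNReal.coe_mul, ENNReal.coe_toNNReal hfin]
  have hcomp : ∀ i, ‖block φ k f x i‖ₑ ≤ (∫⁻ z, ‖wideKernel φ 0 z‖ₑ ^ r) ^ (1 / r)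
      * pow2 (3 * k / q) * eLpNorm (block φ k f) (ENNReal.ofReal q) volume := by
    intro i
    rw [block_reproducing]
    calc ‖∫ y, wideKernel φ k (y - x) * block φ k f y i‖ₑ
        ≤ ∫⁻ y, ‖wideKernel φ k (y - x) * block φ k f y i‖ₑ := enorm_integral_le_lintegral_enorm _
      _ ≤ ∫⁻ y, ‖wideKernel φ k (y - x)‖ₑ * ‖block φ k f y‖ₑ := by
          gcongr with y
          rw [enorm_mul]
          gcongr
          exact enorm_apply_le _ _
      _ ≤ (∫⁻ y, ‖wideKernel φ k (y - x)‖ₑ ^ r) ^ (1 / r)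
          * (∫⁻ y, ‖block φ k f y‖ₑ ^ q) ^ (1 / q) := by
          refine ENNReal.lintegral_mul_le_Lp_mul_Lq volume hc.symm ?_ ?_
          · have := (wideKernel φ k).continuous
            exact (by fun_prop : Continuous fun y => wideKernel φ k (y - x)).enorm.aemeasurable
          · exact (continuous_block φ k f).enorm.aemeasurable
      _ = (pow2 (3 * k / q) * (∫⁻ z, ‖wideKernel φ 0 z‖ₑ ^ r) ^ (1 / r)) *
          eLpNorm (block φ k f) (ENNReal.ofReal q) volume := by
          -- The L^r norm of the kernel scales as 2^{3k(1 - 1/r)} = 2^{3k/q}, since r is conjugate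
          -- to q.
          rw [lintegral_sub_right_eq_self (fun y => ‖wideKernel φ k y‖ₑ ^ r),
            lintegral_wideKernel_rpow φ k r hr0,
            eLpNorm_eq_lintegral_rpow_enorm_toReal (p := ENNReal.ofReal q)
              (by simpa using zero_lt_one.trans hq) (by simp),
            ENNReal.toReal_ofReal (zero_lt_one.trans hq).le]
          congr 3
          have := hc.inv_add_inv_eq_one
          have h3 : 1 - 1 / r = q⁻¹ := by rw [one_div]; linarith
          rw [h3, div_eq_mul_inv]
      _ = _ := by rw [mul_comm (pow2 _)]
  calc ‖block φ k f x‖ₑ ≤ ∑ i, ‖block φ k f x i‖ₑ := enorm_le_sum _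
    _ ≤ ∑ _i : Fin 3, _ := Finset.sum_le_sum fun i _ => hcomp i
    _ = _ := by
      rw [Finset.sum_const, Finset.card_univ, Fintype.card_fin, nsmul_eq_mul]
      push_cast
      ring

/-- Interpolation between L^∞ and L^q, from |g|^p ≤ M^{p-q}|g|^q. -/
theorem eLpNorm_le_of_bound {q p : ℝ} (hq : 0 < q) (hqp : q ≤ p) (g : R3 → C3)
    (hg : Continuous g) (M : ℝ≥0∞) (hM : ∀ x, ‖g x‖ₑ ≤ M) :
    eLpNorm g (ENNReal.ofReal p) volume ≤
      M ^ (1 - q / p) * eLpNorm g (ENNReal.ofReal q) volume ^ (q / p) := by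
  have hp : 0 < p := hq.trans_le hqp
  have hqp' : 0 ≤ p - q := sub_nonneg.2 hqp
  rw [eLpNorm_eq_lintegral_rpow_enorm_toReal (by simpa using hp) (by simp),
    eLpNorm_eq_lintegral_rpow_enorm_toReal (by simpa using hq) (by simp),
    ENNReal.toReal_ofReal hp.le, ENNReal.toReal_ofReal hq.le]
  have h1 : ∫⁻ x, ‖g x‖ₑ ^ p ≤ M ^ (p - q) * ∫⁻ x, ‖g x‖ₑ ^ q := by
    have hm := hg.measurable
    rw [← lintegral_const_mul _ (by fun_prop)]
    refine lintegral_mono fun x => ?_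
    calc ‖g x‖ₑ ^ p = ‖g x‖ₑ ^ (p - q) * ‖g x‖ₑ ^ q := by
          rw [← ENNReal.rpow_add_of_nonneg _ _ hqp' hq.le, sub_add_cancel]
      _ ≤ _ := by gcongr; exact hM x
  calc (∫⁻ x, ‖g x‖ₑ ^ p) ^ (1 / p) ≤ (M ^ (p - q) * ∫⁻ x, ‖g x‖ₑ ^ q) ^ (1 / p) := by gcongr
    _ = _ := by
      rw [ENNReal.mul_rpow_of_nonneg _ _ (by positivity), ← ENNReal.rpow_mul, ← ENNReal.rpow_mul]
      congr 2 <;> field_simp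

/-- Bernstein's inequality. -/
theorem exists_eLpNorm_block_le (q p : ℝ) (hq : 1 < q) (hqp : q ≤ p) :
    ∃ C : ℝ≥0, ∀ (k : ℤ) (f : ZDual), eLpNorm (block φ k f) (ENNReal.ofReal p) volume ≤
      C * pow2 (3 * k * (1 / q - 1 / p)) * eLpNorm (block φ k f) (ENNReal.ofReal q) volume := by
  obtain ⟨C, hC⟩ := exists_enorm_block_le φ q hq
  have hq0 : 0 < q := zero_lt_one.trans hq
  have hp : 0 < p := hq0.trans_le hqp
  have hqp' : 0 ≤ 1 - q / p := by
    rw [sub_nonneg, div_le_one hp]; exact hqp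
  refine ⟨C ^ (1 - q / p), fun k f => (eLpNorm_le_of_bound hq0 hqp _
    (continuous_block φ k f) _ (hC k f)).trans_eq ?_⟩
  rw [ENNReal.mul_rpow_of_nonneg _ _ hqp', ENNReal.mul_rpow_of_nonneg _ _ hqp', mul_assoc,
    ← ENNReal.rpow_add_of_nonneg _ _ hqp' (by positivity), sub_add_cancel, ENNReal.rpow_one,
    pow2_rpow, ENNReal.coe_rpow_of_nonneg _ hqp']
  congr 3
  field_simp

end

end RotatingNS

/-! ### The Fourier transform on L² and on L¹ ∩ L² -/

namespace RotatingNS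
open scoped ContDiff

/-- The space `L²(ℝ³)`. -/
abbrev L2 : Type := Lp ℂ 2 (volume : Measure R3)

theorem integral_mul_fourierInv_schwartz (F : L2) (g : 𝓢(R3, ℂ)) :
    ∫ x, F x * (𝓕⁻ g : 𝓢(R3, ℂ)) x = ∫ x, (𝓕⁻ F : L2) x * g x := by
  have h := MeasureTheory.Lp.fourierInv_toTemperedDistribution_eq F
  have h2 := DFunLike.congr_fun h g
  rw [TemperedDistribution.fourierInv_apply, Lp.toTemperedDistribution_apply,
    Lp.toTemperedDistribution_apply] at h2
  simp only [smul_eq_mul] at h2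
  simpa only [mul_comm] using h2

/-- Both sides are continuous in m for the L² norm and agree on the dense class of Schwartz
functions. -/
theorem integral_mul_fourierInv_Lp (F m : L2) :
    ∫ x, F x * (𝓕⁻ m : L2) x = ∫ x, (𝓕⁻ F : L2) x * m x := by
  let B := (ContinuousLinearMap.mul ℂ ℂ).lpPairing (volume : Measure R3) 2 2
  have hB : ∀ f g, B f g = ∫ x, f x * g x := fun f g =>
    ContinuousLinearMap.lpPairing_eq_integral _ _ _
  rw [← hB, ← hB]
  refine DenseRange.induction_on
    (p := fun m : L2 => B F (𝓕⁻ m) = B (𝓕⁻ F) m)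
    (SchwartzMap.denseRange_toLpCLM (p := 2) ENNReal.ofNat_ne_top) m ?_ ?_
  · refine isClosed_eq ((B F).continuous.comp ?_) (B (𝓕⁻ F)).continuous
    exact (FourierTransform.fourierInvCLM ℂ (L2)).continuous
  · intro g
    rw [hB, hB, SchwartzMap.toLpCLM_apply, SchwartzMap.toLp_fourierInv_eq]
    have e1 : ∫ x, F x * ((𝓕⁻ g : 𝓢(R3, ℂ)).toLp 2 volume) x = ∫ x, F x * (𝓕⁻ g : 𝓢(R3, ℂ)) x := by
      refine integral_congr_ae ?_
      filter_upwards [(𝓕⁻ g : 𝓢(R3, ℂ)).coeFn_toLp 2 volume] with x hx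
      rw [hx]
    have e2 : ∫ x, (𝓕⁻ F : L2) x * (g.toLp 2 volume) x
        = ∫ x, (𝓕⁻ F : L2) x * g x := by
      refine integral_congr_ae ?_
      filter_upwards [g.coeFn_toLp 2 volume] with x hx
      rw [hx]
    rw [e1, e2, integral_mul_fourierInv_schwartz]

theorem integral_fourier_mul_eq_flip {f g : R3 → ℂ} (hf : Integrable f) (hg : Integrable g) :
    ∫ x, 𝓕 f x * g x = ∫ x, f x * 𝓕 g x := by
  have := VectorFourier.integral_fourierIntegral_smul_eq_flip (μ := (volume : Measure R3))
    (ν := (volume : Measure R3)) (L := innerₗ R3) Real.continuous_fourierChar continuous_inner hf hg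
  simp only [flip_innerₗ, smul_eq_mul] at this
  exact this

theorem integral_fourierInv_mul_eq_flip {f g : R3 → ℂ} (hf : Integrable f) (hg : Integrable g) :
    ∫ x, 𝓕⁻ f x * g x = ∫ x, f x * 𝓕⁻ g x := by
  have h := integral_fourier_mul_eq_flip hf hg.comp_neg
  rw [← integral_neg_eq_self] at h
  calc ∫ x, 𝓕⁻ f x * g x = ∫ x, 𝓕 f (-x) * g (- -x) := by
        simp only [Real.fourierInv_eq_fourier_neg, neg_neg]
    _ = _ := h
    _ = _ := by simp only [Real.fourierInv_eq_fourier_comp_neg]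

theorem continuous_fourierInv_of_integrable {m : R3 → ℂ} (hm : Integrable m) :
    Continuous (𝓕⁻ m) := by
  have h : Continuous (𝓕 m) :=
    VectorFourier.fourierIntegral_continuous Real.continuous_fourierChar continuous_inner hm
  have : (𝓕⁻ m) = fun x => 𝓕 m (-x) := funext fun x => Real.fourierInv_eq_fourier_neg m x
  rw [this]
  fun_prop

/-- The Fourier integral of a function in `L¹ ∩ L²` agrees with its Fourier transform in `L²`. -/
theorem fourierInv_ae_eq_toLp {m : R3 → ℂ} (hm : Integrable m) (hm2 : MemLp m 2 (volume : Measure R3)) :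
    (𝓕⁻ (hm2.toLp m) : L2) =ᵐ[volume] 𝓕⁻ m := by
  refine ae_eq_of_integral_contDiff_smul_eq ((Lp.memLp _).locallyIntegrable one_le_two)
    (continuous_fourierInv_of_integrable hm).locallyIntegrable fun g hg hgc => ?_
  have hg₁ : HasCompactSupport (Complex.ofRealCLM ∘ g) := hgc.comp_left rfl
  have hg₂ : ContDiff ℝ ∞ (Complex.ofRealCLM ∘ g) := by fun_prop
  let G : 𝓢(R3, ℂ) := hg₁.toSchwartzMap hg₂
  have hG : ∀ x, G x = g x := fun x => rfl
  have h1 := integral_mul_fourierInv_schwartz (hm2.toLp m) G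
  have h2 := integral_fourierInv_mul_eq_flip hm (G.integrable (μ := volume))
  have e : ∫ x, (hm2.toLp m) x * (𝓕⁻ G : 𝓢(R3, ℂ)) x = ∫ x, m x * (𝓕⁻ G : 𝓢(R3, ℂ)) x := by
    refine integral_congr_ae ?_
    filter_upwards [hm2.coeFn_toLp] with x hx
    rw [hx]
  rw [e, SchwartzMap.fourierInv_coe, ← h2] at h1
  have e3 : ∀ (c : ℂ) (x : R3), g x • c = c * G x := fun c x => by
    rw [hG, Complex.real_smul, mul_comm]
  simp_rw [e3]
  exact h1.symm

theorem eLpNorm_fourierInv {m : R3 → ℂ} (hm : Integrable m) (hm2 : MemLp m 2 (volume : Measure R3)) :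
    eLpNorm (𝓕⁻ m) 2 volume = eLpNorm m 2 volume := by
  rw [← eLpNorm_congr_ae (fourierInv_ae_eq_toLp hm hm2), ← eLpNorm_congr_ae hm2.coeFn_toLp,
    ← Lp.enorm_def, ← Lp.enorm_def]
  have h := Lp.norm_fourier_eq (𝓕⁻ (hm2.toLp m) : L2)
  rw [FourierTransform.fourier_fourierInv_eq] at h
  rw [← ofReal_norm, ← ofReal_norm, h]

theorem memLp_fourierInv {m : R3 → ℂ} (hm : Integrable m) (hm2 : MemLp m 2 (volume : Measure R3)) :
    MemLp (𝓕⁻ m) 2 volume :=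
  ⟨(continuous_fourierInv_of_integrable hm).aestronglyMeasurable,
    by rw [eLpNorm_fourierInv hm hm2]; exact hm2.2⟩

theorem eLpNorm_fourier {m : R3 → ℂ} (hm : Integrable m) (hm2 : MemLp m 2 (volume : Measure R3)) :
    eLpNorm (𝓕 m) 2 volume = eLpNorm m 2 volume := by
  rw [← eLpNorm_fourierInv hm hm2]
  have h : (𝓕 m) = (𝓕⁻ m) ∘ fun x => -x := by
    funext x
    simp [Real.fourierInv_eq_fourier_neg]
  rw [h]
  exact eLpNorm_comp_measurePreserving
    (continuous_fourierInv_of_integrable hm).aestronglyMeasurable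
    (Measure.measurePreserving_neg (volume : Measure R3))

/-- The inverse Fourier transform in `L²`. -/
noncomputable def invL2 {F : R3 → ℂ} (hF : MemLp F 2 (volume : Measure R3)) :
    L2 := 𝓕⁻ (hF.toLp F)

theorem eLpNorm_invL2 {F : R3 → ℂ} (hF : MemLp F 2 (volume : Measure R3)) :
    eLpNorm (invL2 hF) 2 volume = eLpNorm F 2 volume := by
  rw [← eLpNorm_congr_ae hF.coeFn_toLp, ← Lp.enorm_def, ← Lp.enorm_def]
  have h := Lp.norm_fourier_eq (𝓕⁻ (hF.toLp F) : L2)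
  rw [FourierTransform.fourier_fourierInv_eq] at h
  rw [← ofReal_norm, ← ofReal_norm, h, invL2]

theorem invL2_add {F F' : R3 → ℂ} (hF : MemLp F 2 (volume : Measure R3))
    (hF' : MemLp F' 2 (volume : Measure R3)) :
    invL2 (hF.add hF') = invL2 hF + invL2 hF' := by
  rw [invL2, MemLp.toLp_add, FourierTransform.fourierInv_add]
  rfl

theorem integral_mul_fourierInv {F m : R3 → ℂ} (hF : MemLp F 2 (volume : Measure R3))
    (hm : Integrable m) (hm2 : MemLp m 2 (volume : Measure R3)) :
    ∫ x, F x * 𝓕⁻ m x = ∫ η, invL2 hF η * m η := by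
  have h := integral_mul_fourierInv_Lp (hF.toLp F) (hm2.toLp m)
  have e1 : ∫ x, F x * 𝓕⁻ m x
      = ∫ x, (hF.toLp F) x * (𝓕⁻ (hm2.toLp m) : L2) x := by
    refine integral_congr_ae ?_
    filter_upwards [hF.coeFn_toLp, fourierInv_ae_eq_toLp hm hm2] with x hx hy
    rw [hx, hy]
  rw [e1, h]
  refine integral_congr_ae ?_
  filter_upwards [hm2.coeFn_toLp] with x hx
  rw [hx]
  rfl

/-- A function in `L²` which annihilates the Schwartz functions with frequencies above `r` has no
frequencies above `r`. -/
theorem invL2_eq_zero_of_annihilates {F : R3 → ℂ} (hF : MemLp F 2 (volume : Measure R3)) (r : ℝ)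
    (h : ∀ ψ : 𝓢(R3, ℂ), (∀ η, 2 * Real.pi * ‖η‖ ≤ r → 𝓕 ψ η = 0) → ∫ x, F x * ψ x = 0) :
    ∀ᵐ η : R3, r < 2 * Real.pi * ‖η‖ → invL2 hF η = 0 := by
  have hU : IsOpen {η : R3 | r < 2 * Real.pi * ‖η‖} :=
    isOpen_lt continuous_const (by fun_prop)
  refine hU.ae_eq_zero_of_integral_contDiff_smul_eq_zero
    (((Lp.memLp _).locallyIntegrable one_le_two).locallyIntegrableOn _) fun g hg hgc hgU => ?_
  have hg₁ : HasCompactSupport (Complex.ofRealCLM ∘ g) := hgc.comp_left rfl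
  have hg₂ : ContDiff ℝ ∞ (Complex.ofRealCLM ∘ g) := by fun_prop
  let G : 𝓢(R3, ℂ) := hg₁.toSchwartzMap hg₂
  have hG : ∀ x, G x = g x := fun x => rfl
  have h1 := integral_mul_fourierInv_schwartz (hF.toLp F) G
  have h2 := h (𝓕⁻ G) fun η hη => by
    rw [FourierTransform.fourier_fourierInv_eq, hG]
    by_contra hne
    have : g η ≠ 0 := fun h0 => hne (by rw [h0]; simp)
    exact absurd (hgU (subset_tsupport g this)) (not_lt.mpr hη)
  have e : ∫ x, (hF.toLp F) x * (𝓕⁻ G : 𝓢(R3, ℂ)) x = ∫ x, F x * (𝓕⁻ G : 𝓢(R3, ℂ)) x := by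
    refine integral_congr_ae ?_
    filter_upwards [hF.coeFn_toLp] with x hx
    rw [hx]
  rw [e, h2] at h1
  have e3 : ∀ (c : ℂ) (x : R3), g x • c = c * G x := fun c x => by
    rw [hG, Complex.real_smul, mul_comm]
  simp_rw [e3]
  exact h1.symm

end RotatingNS

/-! ### Bounds on the symbols and frequency localised multipliers -/

namespace RotatingNS

section Symbol

theorem abs_apply_div_norm_le (ξ : R3) (i : Fin 3) : |ξ i / ‖ξ‖| ≤ 1 := by
  rw [abs_div, abs_norm]
  exact div_le_one_of_le₀ (PiLp.norm_apply_le ξ i) (norm_nonneg _)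

theorem abs_coriolisMatrix_le (ξ : R3) (i j : Fin 3) : |coriolisMatrix ξ i j| ≤ 1 := by
  have h := abs_apply_div_norm_le ξ
  fin_cases i <;> fin_cases j <;> simp [coriolisMatrix, h]

/-- This is where Ω disappears from the estimates: the oscillating factors are bounded by 1. -/
theorem abs_semigroupSymbol_le (ν Ω t : ℝ) (ξ : R3) (i j : Fin 3) :
    |semigroupSymbol ν Ω t ξ i j| ≤ 2 * Real.exp (-ν * ‖ξ‖ ^ 2 * t) := by
  have h1 := abs_coriolisMatrix_le ξ i j
  have h2 : |(1 : Matrix (Fin 3) (Fin 3) ℝ) i j| ≤ 1 := by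
    rw [Matrix.one_apply]
    split_ifs <;> simp
  have h3 := Real.abs_cos_le_one (Ω * (ξ 2 / ‖ξ‖) * t)
  have h4 := Real.abs_sin_le_one (Ω * (ξ 2 / ‖ξ‖) * t)
  have h5 := (Real.exp_pos (-ν * ‖ξ‖ ^ 2 * t)).le
  simp only [semigroupSymbol, Matrix.add_apply, Matrix.smul_apply, smul_eq_mul]
  refine (abs_add_le _ _).trans ?_
  rw [abs_mul, abs_mul, abs_mul, abs_mul, abs_of_nonneg h5]
  calc _ ≤ 1 * Real.exp (-ν * ‖ξ‖ ^ 2 * t) * 1 + 1 * Real.exp (-ν * ‖ξ‖ ^ 2 * t) * 1 := by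
        gcongr
    _ = _ := by ring

theorem abs_helmholtzSymbol_le (ξ : R3) (i j : Fin 3) : |helmholtzSymbol ξ i j| ≤ 2 := by
  have h1 := abs_apply_div_norm_le ξ i
  have h2 := abs_apply_div_norm_le ξ j
  have e : ξ i * ξ j / ‖ξ‖ ^ 2 = (ξ i / ‖ξ‖) * (ξ j / ‖ξ‖) := by
    rw [div_mul_div_comm, sq]
  simp only [helmholtzSymbol, Matrix.of_apply]
  refine (abs_sub _ _).trans ?_
  rw [e, abs_mul]
  have h3 : |(if i = j then (1 : ℝ) else 0)| ≤ 1 := by split_ifs <;> simp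
  have h4 := mul_le_mul h1 h2 (abs_nonneg _) zero_le_one
  linarith

/-- The constant is 3 · 2 · 2: three terms in the matrix product, and entries at most 2 (times the
heat factor) and at most 2. -/
theorem norm_duhamelSymbol_le (ν Ω t : ℝ) (i n m : Fin 3) (ξ : R3) :
    ‖duhamelSymbol ν Ω t i n m ξ‖ ≤ 12 * Real.exp (-ν * ‖ξ‖ ^ 2 * t) * ‖ξ‖ := by
  have h5 := (Real.exp_pos (-ν * ‖ξ‖ ^ 2 * t)).le
  rw [duhamelSymbol, norm_mul, norm_mul, Complex.norm_I, one_mul, Complex.norm_real,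
    Complex.norm_real]
  refine mul_le_mul ?_ (PiLp.norm_apply_le ξ n) (norm_nonneg _) (by positivity)
  rw [Matrix.mul_apply]
  refine (norm_sum_le _ _).trans ?_
  calc ∑ l, ‖semigroupSymbol ν Ω t ξ i l * helmholtzSymbol ξ l m‖
      ≤ ∑ _l : Fin 3, 2 * Real.exp (-ν * ‖ξ‖ ^ 2 * t) * 2 := by
        refine Finset.sum_le_sum fun l _ => ?_
        rw [norm_mul]
        exact mul_le_mul (abs_semigroupSymbol_le ν Ω t ξ i l) (abs_helmholtzSymbol_le ξ l m)
          (norm_nonneg _) (by positivity)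
    _ = _ := by simp; ring

theorem norm_duhamelSymbol_le_of_nonneg {ν : ℝ} (hν : 0 < ν) (Ω : ℝ) {t : ℝ} (ht : 0 ≤ t)
    (i n m : Fin 3) (ξ : R3) : ‖duhamelSymbol ν Ω t i n m ξ‖ ≤ 12 * ‖ξ‖ := by
  refine (norm_duhamelSymbol_le ν Ω t i n m ξ).trans ?_
  have : Real.exp (-ν * ‖ξ‖ ^ 2 * t) ≤ 1 := Real.exp_le_one_iff.2 (by
    have : 0 ≤ ν * ‖ξ‖ ^ 2 * t := by positivity
    linarith)
  have := mul_le_mul_of_nonneg_right this (norm_nonneg ξ)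
  linarith

theorem measurable_coriolisMatrix (i j : Fin 3) : Measurable fun ξ : R3 => coriolisMatrix ξ i j := by
  have h : ∀ l : Fin 3, Measurable fun ξ : R3 => ξ l / ‖ξ‖ := fun l => by fun_prop
  fin_cases i <;> fin_cases j <;> simp [coriolisMatrix, h]

theorem measurable_semigroupSymbol (ν Ω : ℝ) (i j : Fin 3) :
    Measurable fun z : ℝ × R3 => semigroupSymbol ν Ω z.1 z.2 i j := by
  have : Measurable fun z : ℝ × R3 => coriolisMatrix z.2 i j :=
    (measurable_coriolisMatrix i j).comp measurable_snd
  simp only [semigroupSymbol, Matrix.add_apply, Matrix.smul_apply, smul_eq_mul]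
  fun_prop

theorem measurable_helmholtzSymbol (i j : Fin 3) :
    Measurable fun ξ : R3 => helmholtzSymbol ξ i j := by
  simp only [helmholtzSymbol, Matrix.of_apply]
  fun_prop

theorem measurable_duhamelSymbol (ν Ω : ℝ) (i n m : Fin 3) :
    Measurable fun z : ℝ × R3 => duhamelSymbol ν Ω z.1 i n m z.2 := by
  have h1 : ∀ l, Measurable fun z : ℝ × R3 => helmholtzSymbol z.2 l m :=
    fun l => (measurable_helmholtzSymbol l m).comp measurable_snd
  have h2 := measurable_semigroupSymbol ν Ω i
  simp only [duhamelSymbol, Matrix.mul_apply, Fin.sum_univ_three]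
  have h10 := h1 0
  have h11 := h1 1
  have h12 := h1 2
  have h20 := h2 0
  have h21 := h2 1
  have h22 := h2 2
  fun_prop

end Symbol

/-- The Schwartz function `(1 + |η|²) ψ̂(η)`. -/
noncomputable def weightedFourier : 𝓢(R3, ℂ) →L[ℂ] 𝓢(R3, ℂ) :=
  SchwartzMap.smulLeftCLM ℂ (fun η : R3 => ((1 + ‖η‖ ^ 2 : ℝ) : ℂ)) ∘L
    FourierTransform.fourierCLM ℂ 𝓢(R3, ℂ)

theorem norm_weightedFourier (ψ : 𝓢(R3, ℂ)) (η : R3) :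
    ‖weightedFourier ψ η‖ = (1 + ‖η‖ ^ 2) * ‖𝓕 ψ η‖ := by
  have hg : (fun η : R3 => ((1 + ‖η‖ ^ 2 : ℝ) : ℂ)).HasTemperateGrowth := by fun_prop
  have : weightedFourier ψ η = ((1 + ‖η‖ ^ 2 : ℝ) : ℂ) * 𝓕 ψ η := by
    simp only [weightedFourier, ContinuousLinearMap.comp_apply,
      SchwartzMap.smulLeftCLM_apply_apply hg, smul_eq_mul]
    rfl
  rw [this, norm_mul, Complex.norm_real, Real.norm_of_nonneg (by positivity)]

/-- The symbol of `a(-D) ψ`. -/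
noncomputable def dualSymbol (a : R3 → ℂ) (ψ : 𝓢(R3, ℂ)) (η : R3) : ℂ :=
  a (-((2 * Real.pi) • η)) * 𝓕 ψ η

section Multiplier

theorem measurable_dualSymbol {a : R3 → ℂ} (ha : Measurable a) (ψ : 𝓢(R3, ℂ)) :
    Measurable (dualSymbol a ψ) := by
  have h1 := (𝓕 ψ : 𝓢(R3, ℂ)).continuous.measurable
  have h2 : Measurable fun η : R3 => a (-((2 * Real.pi) • η)) := ha.comp (by fun_prop)
  exact h2.mul h1

/-- Symbols singular at the origin do not preserve the Schwartz class. Linear growth is all that is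
used of them: it is absorbed by 1 + |η|², leaving a Schwartz majorant that depends continuously on
ψ. -/
theorem norm_dualSymbol_le {a : R3 → ℂ} {K : ℝ} (hK : ∀ ξ, ‖a ξ‖ ≤ K * ‖ξ‖) (ψ : 𝓢(R3, ℂ))
    (η : R3) : ‖dualSymbol a ψ η‖ ≤ K * (2 * Real.pi) * ‖weightedFourier ψ η‖ := by
  have h1 := hK (-((2 * Real.pi) • η))
  rw [norm_neg, norm_smul, Real.norm_of_nonneg (by positivity : 0 ≤ 2 * Real.pi)] at h1
  rw [dualSymbol, norm_mul, norm_weightedFourier]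
  have hK0 : 0 ≤ K := by
    have h := hK (EuclideanSpace.single 0 1)
    have h1 : ‖(EuclideanSpace.single 0 1 : R3)‖ = 1 := by simp
    rw [h1, mul_one] at h
    exact (norm_nonneg _).trans h
  have h2 : ‖η‖ ≤ 1 + ‖η‖ ^ 2 := by nlinarith [sq_nonneg (‖η‖ - 1), sq_nonneg ‖η‖]
  calc _ ≤ (K * (2 * Real.pi * ‖η‖)) * ‖𝓕 ψ η‖ := by gcongr
    _ ≤ (K * (2 * Real.pi * (1 + ‖η‖ ^ 2))) * ‖𝓕 ψ η‖ := by gcongr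
    _ = _ := by ring

theorem memLp_dualSymbol {a : R3 → ℂ} (ha : Measurable a) {K : ℝ} (hK : ∀ ξ, ‖a ξ‖ ≤ K * ‖ξ‖)
    (ψ : 𝓢(R3, ℂ)) (p : ℝ≥0∞) : MemLp (dualSymbol a ψ) p (volume : Measure R3) :=
  (((weightedFourier ψ).memLp p volume).norm.const_mul (K * (2 * Real.pi))).mono'
    (measurable_dualSymbol ha ψ).aestronglyMeasurable
    (Filter.Eventually.of_forall fun η => norm_dualSymbol_le hK ψ η)

theorem integrable_dualSymbol {a : R3 → ℂ} (ha : Measurable a) {K : ℝ}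
    (hK : ∀ ξ, ‖a ξ‖ ≤ K * ‖ξ‖) (ψ : 𝓢(R3, ℂ)) : Integrable (dualSymbol a ψ) :=
  memLp_one_iff_integrable.1 (memLp_dualSymbol ha hK ψ 1)

theorem transposeMultiplier_eq (a : R3 → ℂ) (ψ : 𝓢(R3, ℂ)) :
    transposeMultiplier a ψ = 𝓕⁻ (dualSymbol a ψ) := rfl

theorem memLp_transposeMultiplier {a : R3 → ℂ} (ha : Measurable a) {K : ℝ}
    (hK : ∀ ξ, ‖a ξ‖ ≤ K * ‖ξ‖) (ψ : 𝓢(R3, ℂ)) :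
    MemLp (transposeMultiplier a ψ) 2 (volume : Measure R3) :=
  memLp_fourierInv (integrable_dualSymbol ha hK ψ) (memLp_dualSymbol ha hK ψ 2)

theorem transposeMultiplier_add {a : R3 → ℂ} (ha : Measurable a) {K : ℝ}
    (hK : ∀ ξ, ‖a ξ‖ ≤ K * ‖ξ‖) (ψ ψ' : 𝓢(R3, ℂ)) (x : R3) :
    transposeMultiplier a (ψ + ψ') x = transposeMultiplier a ψ x + transposeMultiplier a ψ' x := by
  have h : ∀ ψ : 𝓢(R3, ℂ), Integrable fun η : R3 =>
      Real.fourierChar (inner ℝ η x) • dualSymbol a ψ η := fun ψ => by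
    have := (Real.fourierIntegral_convergent_iff (μ := volume) (-x)).2 (integrable_dualSymbol ha hK ψ)
    simpa using this
  simp only [transposeMultiplier_eq, Real.fourierInv_eq]
  rw [← integral_add (h ψ) (h ψ')]
  refine integral_congr_ae (Filter.Eventually.of_forall fun η => ?_)
  simp only [dualSymbol, FourierTransform.fourier_add, ← smul_add, ← mul_add]
  rfl

theorem transposeMultiplier_smul (a : R3 → ℂ) (c : ℂ) (ψ : 𝓢(R3, ℂ)) (x : R3) :
    transposeMultiplier a (c • ψ) x = c * transposeMultiplier a ψ x := by
  simp only [transposeMultiplier_eq, Real.fourierInv_eq]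
  rw [← integral_const_mul]
  refine integral_congr_ae (Filter.Eventually.of_forall fun η => ?_)
  have : (𝓕 (c • ψ) : 𝓢(R3, ℂ)) η = c * 𝓕 ψ η := by
    rw [FourierTransform.fourier_smul]; rfl
  simp only [dualSymbol, this, Circle.smul_def, smul_eq_mul]
  ring

theorem enorm_integral_mul_le_eLpNorm_two {F G : R3 → ℂ} (hF : AEStronglyMeasurable F)
    (hG : AEStronglyMeasurable G) :
    ∫⁻ x, ‖F x * G x‖ₑ ≤ eLpNorm F 2 volume * eLpNorm G 2 volume := by
  have := eLpNorm_smul_le_mul_eLpNorm (p := 2) (q := 2) (r := 1) (μ := volume) hG hF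
  rw [eLpNorm_one_eq_lintegral_enorm] at this
  exact this

/-- The pairing with a function of `L²` in terms of the symbol. -/
theorem integral_mul_transposeMultiplier {F : R3 → ℂ} (hF : MemLp F 2 (volume : Measure R3))
    {a : R3 → ℂ} (ha : Measurable a) {K : ℝ} (hK : ∀ ξ, ‖a ξ‖ ≤ K * ‖ξ‖) (ψ : 𝓢(R3, ℂ)) :
    ∫ y, F y * transposeMultiplier a ψ y = ∫ η, invL2 hF η * dualSymbol a ψ η :=
  integral_mul_fourierInv hF (integrable_dualSymbol ha hK ψ) (memLp_dualSymbol ha hK ψ 2)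

/-- Cauchy-Schwarz and Plancherel. The right side involves ψ only through a norm continuous on the
Schwartz space, which later gives continuity of the Duhamel functional. -/
theorem lintegral_mul_transposeMultiplier_le {F : R3 → ℂ} (hF : AEStronglyMeasurable F)
    {a : R3 → ℂ} (ha : Measurable a) {K : ℝ} (hK : ∀ ξ, ‖a ξ‖ ≤ K * ‖ξ‖) (ψ : 𝓢(R3, ℂ)) :
    ∫⁻ y, ‖F y * transposeMultiplier a ψ y‖ₑ ≤
      eLpNorm F 2 volume * (ENNReal.ofReal (K * (2 * Real.pi)) *
        eLpNorm (weightedFourier ψ) 2 volume) := by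
  refine (enorm_integral_mul_le_eLpNorm_two hF
    (memLp_transposeMultiplier ha hK ψ).aestronglyMeasurable).trans ?_
  gcongr
  rw [transposeMultiplier_eq, eLpNorm_fourierInv (integrable_dualSymbol ha hK ψ)
    (memLp_dualSymbol ha hK ψ 2)]
  refine eLpNorm_le_mul_eLpNorm_of_ae_le_mul
    (Filter.Eventually.of_forall fun η => norm_dualSymbol_le hK ψ η) 2

/-- The point x enters only through a phase, so that the pairing with an L² function is, as a
function of x, a Fourier transform to which Plancherel applies. -/
theorem dualSymbol_blockTestFun (φ : LPCutoff) (a : R3 → ℂ) (k : ℤ) (x η : R3) :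
    dualSymbol a (blockTestFun φ k x) η
      = Real.fourierChar (-inner ℝ η x) • dualSymbol a (blockKernel φ k) η := by
  rw [dualSymbol, dualSymbol, fourier_blockTestFun, fourier_blockKernel, blockSymbol_neg,
    mul_smul_comm, real_inner_comm]

/-- On the annulus 3/4 · 2^k ≤ |ξ| ≤ 8/3 · 2^k the lower end gives the decay rate, 9/16 = (3/4)²,
and the upper end the factor 32 = 12 · 8/3. -/
theorem norm_dualSymbol_blockKernel_le (φ : LPCutoff) {ν : ℝ} (hν : 0 < ν) (Ω : ℝ) {t : ℝ}
    (ht : 0 ≤ t) (i n m : Fin 3) (k : ℤ) (η : R3) :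
    ‖dualSymbol (duhamelSymbol ν Ω t i n m) (blockKernel φ k) η‖ ≤
      32 * SchwartzMap.seminorm ℂ 0 0 φ.toFun *
        (2 ^ k * Real.exp (-(ν * (9 / 16) * (2 ^ k) ^ 2 * t))) := by
  rw [dualSymbol, fourier_blockKernel]
  by_cases h : blockSymbol φ k η = 0
  · rw [h, mul_zero, norm_zero]
    have := apply_nonneg (SchwartzMap.seminorm ℂ 0 0) φ.toFun
    positivity
  have hs := blockSymbol_support φ k η h
  have hn : ‖-((2 * Real.pi) • η)‖ = 2 * Real.pi * ‖η‖ := by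
    rw [norm_neg, norm_smul, Real.norm_of_nonneg (by positivity)]
  have h1 := norm_duhamelSymbol_le ν Ω t i n m (-((2 * Real.pi) • η))
  rw [hn] at h1
  have h2 : ‖blockSymbol φ k η‖ ≤ SchwartzMap.seminorm ℂ 0 0 φ.toFun := by
    rw [blockSymbol_apply]
    exact SchwartzMap.norm_le_seminorm ℂ φ.toFun _
  have h3 : Real.exp (-ν * (2 * Real.pi * ‖η‖) ^ 2 * t)
      ≤ Real.exp (-(ν * (9 / 16) * (2 ^ k) ^ 2 * t)) := by
    apply Real.exp_le_exp.2
    have h4 : (3 / 4 * 2 ^ k) ^ 2 ≤ (2 * Real.pi * ‖η‖) ^ 2 :=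
      pow_le_pow_left₀ (by positivity) hs.1 2
    have h5 := mul_le_mul_of_nonneg_left h4 (by positivity : 0 ≤ ν * t)
    nlinarith
  rw [norm_mul]
  calc _ ≤ (12 * Real.exp (-ν * (2 * Real.pi * ‖η‖) ^ 2 * t) * (2 * Real.pi * ‖η‖)) *
        SchwartzMap.seminorm ℂ 0 0 φ.toFun := by gcongr
    _ ≤ (12 * Real.exp (-(ν * (9 / 16) * (2 ^ k) ^ 2 * t)) * (8 / 3 * 2 ^ k)) *
        SchwartzMap.seminorm ℂ 0 0 φ.toFun := by
        refine mul_le_mul_of_nonneg_right (mul_le_mul ?_ hs.2 (by positivity) (by positivity))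
          (apply_nonneg _ _)
        gcongr
    _ = _ := by ring

/-- The `L²` estimate of a frequency localised multiplier: the low frequency part `Fl` does not
contribute. -/
theorem eLpNorm_integral_transposeMultiplier_le (φ : LPCutoff) {Fl Fh : R3 → ℂ}
    (hFl : MemLp Fl 2 (volume : Measure R3)) (hFh : MemLp Fh 2 (volume : Measure R3))
    (k : ℤ) (hann : ∀ ψ : 𝓢(R3, ℂ), (∀ η, 2 * Real.pi * ‖η‖ ≤ 2 / 3 * 2 ^ k → 𝓕 ψ η = 0) →
      ∫ x, Fl x * ψ x = 0)
    {a : R3 → ℂ} (ha : Measurable a) {K : ℝ} (hK : ∀ ξ, ‖a ξ‖ ≤ K * ‖ξ‖) {M : ℝ}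
    (hM : ∀ η, ‖dualSymbol a (blockKernel φ k) η‖ ≤ M) :
    eLpNorm (fun x => ∫ y, (Fl y + Fh y) * transposeMultiplier a (blockTestFun φ k x) y) 2 volume
      ≤ ENNReal.ofReal M * eLpNorm Fh 2 volume := by
  have hF := hFl.add hFh
  set b := dualSymbol a (blockKernel φ k) with hb
  set G := invL2 hF with hG
  have hbm : AEStronglyMeasurable b (volume : Measure R3) :=
    (measurable_dualSymbol ha _).aestronglyMeasurable
  have e : (fun x => ∫ y, (Fl y + Fh y) * transposeMultiplier a (blockTestFun φ k x) y)
      = 𝓕 (fun η => G η * b η) := by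
    funext x
    have := integral_mul_transposeMultiplier hF ha hK (blockTestFun φ k x)
    simp only [Pi.add_apply] at this
    rw [this, Real.fourier_eq]
    refine integral_congr_ae (Filter.Eventually.of_forall fun η => ?_)
    simp only [dualSymbol_blockTestFun, mul_smul_comm]
    rfl
  have hGm : MemLp G 2 (volume : Measure R3) := Lp.memLp _
  have hlow := invL2_eq_zero_of_annihilates hFl _ hann
  have hbound : ∀ᵐ η : R3, ‖G η * b η‖ ≤ M * ‖invL2 hFh η‖ := by
    have hadd : G =ᵐ[volume] invL2 hFl + invL2 hFh := by
      rw [hG, invL2_add]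
      exact Lp.coeFn_add _ _
    filter_upwards [hadd, hlow] with η h1 h2
    by_cases hs : blockSymbol φ k η = 0
    · have : b η = 0 := by rw [hb, dualSymbol, fourier_blockKernel, hs, mul_zero]
      rw [this, mul_zero, norm_zero]
      exact mul_nonneg ((norm_nonneg _).trans (hM η)) (norm_nonneg _)
    -- Here 2π|η| ≥ 3/4 · 2^k > 2/3 · 2^k, out of reach of the low frequency part.
    · have h3 := (blockSymbol_support φ k η hs).1
      have h4 : (0 : ℝ) < 2 ^ k := by positivity
      rw [h1, Pi.add_apply, h2 (by linarith), zero_add, norm_mul, mul_comm]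
      gcongr
      exact hM η
  have hM' : MemLp (fun η => G η * b η) 2 (volume : Measure R3) :=
    ((Lp.memLp (invL2 hFh)).norm.const_mul M).mono' (hGm.1.mul hbm) hbound
  have hint : Integrable fun η => G η * b η := hGm.integrable_mul (memLp_dualSymbol ha hK _ 2)
  rw [e, eLpNorm_fourier hint hM', ← eLpNorm_invL2 hFh]
  exact eLpNorm_le_mul_eLpNorm_of_ae_le_mul hbound 2

end Multiplier

end RotatingNS

/-! ### Splitting the product into low and high frequencies -/

namespace RotatingNS

/-- If the right side is finite, the series converges absolutely in the Banach space L^p, and its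
sum there is almost everywhere the pointwise one. -/
theorem eLpNorm_tsum_le {X ι E : Type*} [MeasurableSpace X] {μ : Measure X} [Countable ι]
    [NormedAddCommGroup E] [CompleteSpace E] {p : ℝ≥0∞} (hp : 1 ≤ p) {f : ι → X → E}
    (hf : ∀ i, AEStronglyMeasurable (f i) μ) :
    eLpNorm (fun x => ∑' i, f i x) p μ ≤ ∑' i, eLpNorm (f i) p μ := by
  by_cases h : ∑' i, eLpNorm (f i) p μ = ∞
  · rw [h]; exact le_top
  have : Fact (1 ≤ p) := ⟨hp⟩
  have hm : ∀ i, MemLp (f i) p μ := fun i =>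
    ⟨hf i, (ENNReal.le_tsum i).trans_lt (lt_top_iff_ne_top.2 h)⟩
  have hn : ∀ i, ‖(hm i).toLp (f i)‖ₑ = eLpNorm (f i) p μ := fun i => by
    rw [Lp.enorm_def, eLpNorm_congr_ae (hm i).coeFn_toLp]
  have hs : ∑' i, ‖(hm i).toLp (f i)‖ₑ ≠ ∞ := by simpa only [hn] using h
  have h1 := Lp.coeFn_tsum hs
  have h2 : ∀ᵐ x ∂μ, ∀ i, (hm i).toLp (f i) x = f i x :=
    ae_all_iff.2 fun i => (hm i).coeFn_toLp
  have h3 : (fun x => ∑' i, f i x) =ᵐ[μ] (∑' i, (hm i).toLp (f i) : Lp E p μ) := by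
    filter_upwards [h1, h2] with x hx hy
    rw [hx]
    simp only [hy]
  rw [eLpNorm_congr_ae h3, ← Lp.enorm_def]
  refine enorm_tsum_le_tsum_enorm.trans_eq ?_
  simp only [hn]

section

variable (φ : LPCutoff)

/-- The `L⁴` norm of `Δ_k f`. -/
noncomputable def l4 (f : ZDual) (k : ℤ) : ℝ≥0∞ := eLpNorm (block φ k f) 4 volume

/-- The part of `f` with frequencies in the dyadic annuli of index in `S`. -/
noncomputable def freqPart (S : Set ℤ) (f : ZDual) (x : R3) : C3 :=
  ∑' k : ℤ, S.indicator (fun k => block φ k f x) k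

/-- Summability of the blocks, uniformly and in `L⁴`. -/
structure Admissible (f : ZDual) : Prop where
  tsum_l4 : ∑' k, l4 φ f k ≠ ∞
  tsum_sup : ∑' k : ℤ, pow2 (3 * k / 4) * l4 φ f k ≠ ∞

variable {φ} {f g : ZDual}

theorem exists_enorm_block_le_l4 (φ : LPCutoff) : ∃ C : ℝ≥0, ∀ (k : ℤ) (f : ZDual) (x : R3),
    ‖block φ k f x‖ₑ ≤ C * (pow2 (3 * k / 4) * l4 φ f k) := by
  obtain ⟨C, hC⟩ := exists_enorm_block_le φ 4 (by norm_num)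
  refine ⟨C, fun k f x => (hC k f x).trans_eq ?_⟩
  rw [l4, mul_assoc]
  simp

theorem Admissible.l4_ne_top (hf : Admissible φ f) (k : ℤ) : l4 φ f k ≠ ∞ :=
  ENNReal.ne_top_of_tsum_ne_top hf.tsum_l4 k

theorem Admissible.summable_norm (hf : Admissible φ f) (x : R3) :
    Summable fun k : ℤ => ‖block φ k f x‖ := by
  obtain ⟨C, hC⟩ := exists_enorm_block_le_l4 φ
  rw [← tsum_enorm_ne_top_iff_summable_norm]
  refine ne_top_of_le_ne_top ?_ (ENNReal.tsum_le_tsum fun k => hC k f x)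
  rw [ENNReal.tsum_mul_left]
  exact ENNReal.mul_ne_top ENNReal.coe_ne_top hf.tsum_sup

theorem Admissible.summable (hf : Admissible φ f) (x : R3) :
    Summable fun k : ℤ => block φ k f x := (hf.summable_norm x).of_norm

/-- Each block is bounded by Bernstein; this is the hypothesis of the Fubini argument for products
of two blocks. -/
theorem Admissible.exists_bound (hf : Admissible φ f) (k : ℤ) :
    ∃ A : ℝ, ∀ x, ‖block φ k f x‖ ≤ A := by
  obtain ⟨C, hC⟩ := exists_enorm_block_le_l4 φ
  have hfin : C * (pow2 (3 * k / 4) * l4 φ f k) ≠ ∞ :=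
    ENNReal.mul_ne_top ENNReal.coe_ne_top (ENNReal.mul_ne_top (pow2_ne_top _) (hf.l4_ne_top k))
  refine ⟨(C * (pow2 (3 * k / 4) * l4 φ f k)).toReal, fun x => ?_⟩
  rw [← toReal_enorm]
  exact ENNReal.toReal_mono hfin (hC k f x)

theorem realization_eq_freqPart (f : ZDual) : realization φ f = freqPart φ univ f := by
  funext x
  simp [realization, freqPart]

theorem Admissible.freqPart_add_compl (hf : Admissible φ f) (S : Set ℤ) (x : R3) :
    freqPart φ S f x + freqPart φ Sᶜ f x = realization φ f x := by
  rw [freqPart, freqPart, ← ((hf.summable x).indicator S).tsum_add ((hf.summable x).indicator Sᶜ),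
    realization]
  refine tsum_congr fun k => ?_
  exact congrFun (indicator_self_add_compl S fun k => block φ k f x) k

theorem Admissible.measurable_freqPart (hf : Admissible φ f) (S : Set ℤ) :
    Measurable (freqPart φ S f) := by
  have h1 : ∀ s : Finset ℤ, Measurable fun x => ∑ k ∈ s, S.indicator (fun k => block φ k f x) k := by
    intro s
    refine Finset.measurable_sum s fun k _ => ?_
    by_cases hk : k ∈ S
    · simpa [hk] using (continuous_block φ k f).measurable
    · simp [hk]
  refine measurable_of_tendsto_metrizable' Filter.atTop h1 ?_
  rw [tendsto_pi_nhds]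
  exact fun x => ((hf.summable x).indicator S).hasSum

theorem Admissible.eLpNorm_freqPart_le (S : Set ℤ) :
    eLpNorm (freqPart φ S f) 4 volume ≤ ∑' k, S.indicator (l4 φ f) k := by
  refine (eLpNorm_tsum_le (by norm_num) fun k => ?_).trans_eq ?_
  · by_cases hk : k ∈ S
    · simpa [hk] using (continuous_block φ k f).aestronglyMeasurable
    · simpa [hk] using aestronglyMeasurable_const
  · refine tsum_congr fun k => ?_
    by_cases hk : k ∈ S
    · simp only [hk, indicator_of_mem]; rfl
    · simp [hk]

theorem tsum_indicator_le (S : Set ℤ) (f : ZDual) :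
    ∑' k, S.indicator (l4 φ f) k ≤ ∑' k, l4 φ f k :=
  ENNReal.tsum_le_tsum fun _ => indicator_le_self _ _ _

/-- The product of a component of `F` and a component of `G`. -/
noncomputable def compProd (F G : R3 → C3) (n m : Fin 3) (x : R3) : ℂ := F x n * G x m

theorem measurable_compProd {F G : R3 → C3} (hF : Measurable F) (hG : Measurable G) (n m : Fin 3) :
    Measurable (compProd F G n m) := by
  unfold compProd
  fun_prop

instance : ENNReal.HolderTriple 4 4 2 := ⟨by
  have h : (4 : ℝ≥0∞) = 2 * 2 := by norm_num
  rw [h, ENNReal.mul_inv (by simp) (by simp), ← mul_add, ENNReal.inv_two_add_inv_two, mul_one]⟩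

theorem eLpNorm_compProd_le {F G : R3 → C3} (hF : Measurable F) (hG : Measurable G)
    (n m : Fin 3) : eLpNorm (compProd F G n m) 2 volume ≤
      eLpNorm F 4 volume * eLpNorm G 4 volume := by
  have h1 : eLpNorm (fun x => F x n) 4 volume ≤ eLpNorm F 4 volume :=
    eLpNorm_mono fun x => PiLp.norm_apply_le (F x) n
  have h2 : eLpNorm (fun x => G x m) 4 volume ≤ eLpNorm G 4 volume :=
    eLpNorm_mono fun x => PiLp.norm_apply_le (G x) m
  have h3 : AEStronglyMeasurable (fun x => F x n) volume :=
    (by fun_prop : Measurable fun x => F x n).aestronglyMeasurable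
  have h4 : AEStronglyMeasurable (fun x => G x m) volume :=
    (by fun_prop : Measurable fun x => G x m).aestronglyMeasurable
  have h5 := eLpNorm_smul_le_mul_eLpNorm (p := 4) (q := 4) (r := 2) h4 h3
  have e : compProd F G n m = (fun x => F x n) • (fun x => G x m) := rfl
  rw [e]
  exact h5.trans (mul_le_mul' h1 h2)

/-- The bound for the part of the product of `f` and `g` with at least one factor of index at
least `M`. -/
noncomputable def highSum (φ : LPCutoff) (M : ℤ) (f g : ZDual) : ℝ≥0∞ :=
  (∑' j, (Ici M).indicator (l4 φ f) j) * (∑' l, l4 φ g l)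
    + (∑' j, l4 φ f j) * (∑' l, (Ici M).indicator (l4 φ g) l)

theorem Admissible.memLp_compProd (hf : Admissible φ f) (hg : Admissible φ g) (S S' : Set ℤ)
    (n m : Fin 3) :
    MemLp (compProd (freqPart φ S f) (freqPart φ S' g) n m) 2 (volume : Measure R3) := by
  refine ⟨(measurable_compProd (hf.measurable_freqPart S) (hg.measurable_freqPart S') n
    m).aestronglyMeasurable, ?_⟩
  refine (eLpNorm_compProd_le (hf.measurable_freqPart S) (hg.measurable_freqPart S') n
    m).trans_lt ?_
  refine ENNReal.mul_lt_top ?_ ?_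
  · exact ((Admissible.eLpNorm_freqPart_le S).trans (tsum_indicator_le S f)).trans_lt
      hf.tsum_l4.lt_top
  · exact ((Admissible.eLpNorm_freqPart_le S').trans (tsum_indicator_le S' g)).trans_lt
      hg.tsum_l4.lt_top

/-- The high frequency part of the product. -/
noncomputable def highProd (φ : LPCutoff) (M : ℤ) (f g : ZDual) (n m : Fin 3) (x : R3) : ℂ :=
  compProd (freqPart φ (Ici M) f) (freqPart φ univ g) n m x
    + compProd (freqPart φ (Ici M)ᶜ f) (freqPart φ (Ici M) g) n m x

theorem Admissible.memLp_highProd (hf : Admissible φ f) (hg : Admissible φ g) (M : ℤ)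
    (n m : Fin 3) : MemLp (highProd φ M f g n m) 2 (volume : Measure R3) :=
  (hf.memLp_compProd hg _ _ n m).add (hf.memLp_compProd hg _ _ n m)

theorem Admissible.eLpNorm_highProd_le (hf : Admissible φ f) (hg : Admissible φ g) (M : ℤ)
    (n m : Fin 3) : eLpNorm (highProd φ M f g n m) 2 volume ≤ highSum φ M f g := by
  refine (eLpNorm_add_le (hf.memLp_compProd hg _ _ n m).1 (hf.memLp_compProd hg _ _ n m).1
    one_le_two).trans ?_
  rw [highSum]
  gcongr
  · refine (eLpNorm_compProd_le (hf.measurable_freqPart _) (hg.measurable_freqPart _) n m).trans ?_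
    gcongr
    · exact Admissible.eLpNorm_freqPart_le _
    · exact (Admissible.eLpNorm_freqPart_le _).trans (tsum_indicator_le _ g)
  · refine (eLpNorm_compProd_le (hf.measurable_freqPart _) (hg.measurable_freqPart _) n m).trans ?_
    gcongr
    · exact (Admissible.eLpNorm_freqPart_le _).trans (tsum_indicator_le _ f)
    · exact Admissible.eLpNorm_freqPart_le _

/-- With f = f_h + f_l and g = g_h + g_l, the product is f_l g_l + (f_h g + f_l g_h), so that every
term in the bracket carries a high factor. -/
theorem Admissible.realization_mul_eq (hf : Admissible φ f) (hg : Admissible φ g) (M : ℤ)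
    (n m : Fin 3) (x : R3) : realization φ f x n * realization φ g x m =
      compProd (freqPart φ (Ici M)ᶜ f) (freqPart φ (Ici M)ᶜ g) n m x + highProd φ M f g n m x := by
  have h1 := hf.freqPart_add_compl (Ici M) x
  have h2 := hg.freqPart_add_compl (Ici M) x
  rw [highProd, compProd, compProd, compProd, ← realization_eq_freqPart, ← h1, ← h2,
    PiLp.add_apply, PiLp.add_apply]
  ring

/-- The low frequency part of the product has no high frequencies. -/
theorem Admissible.integral_lowProd_mul_eq_zero (hf : Admissible φ f) (hg : Admissible φ g)
    (k : ℤ) (n m : Fin 3) (ψ : 𝓢(R3, ℂ))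
    (hψ : ∀ η, 2 * Real.pi * ‖η‖ ≤ 2 / 3 * 2 ^ k → 𝓕 ψ η = 0) :
    ∫ x, compProd (freqPart φ (Ici (k - 3))ᶜ f) (freqPart φ (Ici (k - 3))ᶜ g) n m x * ψ x = 0 := by
  set S : Set ℤ := (Ici (k - 3))ᶜ with hS
  let P : ℤ × ℤ → R3 → ℂ := fun p x => S.indicator (fun j => block φ j f x) p.1 n
    * S.indicator (fun l => block φ l g x) p.2 m * ψ x
  have happ : ∀ (F : ℤ → C3) (i : Fin 3), Summable (fun k => ‖F k‖) →
      Summable (fun k => ‖S.indicator F k i‖) ∧ (∑' k, S.indicator F k) i = ∑' k, S.indicator F k i := by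
    intro F i hF
    have h1 : Summable fun k => S.indicator F k := hF.of_norm.indicator S
    constructor
    · refine (hF.indicator S).of_nonneg_of_le (fun _ => norm_nonneg _) fun k => ?_
      refine (PiLp.norm_apply_le _ i).trans_eq ?_
      exact norm_indicator_eq_indicator_norm F k
    · exact (EuclideanSpace.proj i : C3 →L[ℂ] ℂ).map_tsum h1
  -- The product is expanded into an absolutely convergent double series, so that the spectral
  -- argument need only be made for pairs of single blocks.
  have hP : ∀ x, compProd (freqPart φ S f) (freqPart φ S g) n m x * ψ x = ∑' p, P p x := by
    intro x
    obtain ⟨h1, h2⟩ := happ _ n (hf.summable_norm x)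
    obtain ⟨h3, h4⟩ := happ _ m (hg.summable_norm x)
    rw [compProd, freqPart, freqPart, h2, h4, tsum_mul_tsum_of_summable_norm h1 h3, ← tsum_mul_right]
  simp_rw [hP]
  have hm : ∀ p, AEStronglyMeasurable (P p) volume := by
    intro p
    have h1 : ∀ (f : ZDual) (j : ℤ) (i : Fin 3),
        Continuous fun x => S.indicator (fun j => block φ j f x) j i := by
      intro f j i
      by_cases hj : j ∈ S
      · simpa [hj] using continuous_block_apply φ j f i
      · simpa [hj] using continuous_const
    exact (((h1 f p.1 n).mul (h1 g p.2 m)).mul ψ.continuous).aestronglyMeasurable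
  have hbd : ∀ p, ∫⁻ x, ‖P p x‖ₑ ≤ (l4 φ f p.1 * l4 φ g p.2) * eLpNorm ψ 2 volume := by
    rintro ⟨j, l⟩
    have hFm : Measurable fun x => S.indicator (fun j => block φ j f x) j := by
      by_cases hj : j ∈ S
      · simpa [hj] using (continuous_block φ j f).measurable
      · simp [hj]
    have hGm : Measurable fun x => S.indicator (fun j => block φ j g x) l := by
      by_cases hj : l ∈ S
      · simpa [hj] using (continuous_block φ l g).measurable
      · simp [hj]
    refine (enorm_integral_mul_le_eLpNorm_two (F := compProd _ _ n m)
      (measurable_compProd hFm hGm n m).aestronglyMeasurable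
      ψ.continuous.aestronglyMeasurable).trans ?_
    gcongr
    refine (eLpNorm_compProd_le hFm hGm n m).trans ?_
    gcongr
    · refine eLpNorm_mono fun x => ?_
      exact norm_indicator_le_norm_self (fun j => block φ j f x) j
    · refine eLpNorm_mono fun x => ?_
      exact norm_indicator_le_norm_self (fun j => block φ j g x) l
  rw [integral_tsum hm]
  · refine (tsum_congr fun p => ?_).trans tsum_zero
    obtain ⟨j, l⟩ := p
    by_cases hj : j ∈ S
    · by_cases hl : l ∈ S
      · obtain ⟨A, hA⟩ := hf.exists_bound j
        obtain ⟨B, hB⟩ := hg.exists_bound l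
        have := integral_mul_block_mul_block_eq_zero φ j l f g n m A B
          (fun x => (PiLp.norm_apply_le _ n).trans (hA x))
          (fun x => (PiLp.norm_apply_le _ m).trans (hB x)) ψ (fun η hη => hψ η (hη.trans ?_))
        · simpa [P, hj, hl] using this
        · simp only [hS, mem_compl_iff, mem_Ici, not_le] at hj hl
          -- With j, l ≤ k - 4 the product reaches at most 8/3 · (2^{k-4} + 2^{k-3}) = 1/2 · 2^k,
          -- below 2/3 · 2^k.
          have h1 : (2 : ℝ) ^ j ≤ 2 ^ (k - 4) := zpow_le_zpow_right₀ one_le_two (by omega)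
          have h2 : (2 : ℝ) ^ (l + 1) ≤ 2 ^ (k - 3) := zpow_le_zpow_right₀ one_le_two (by omega)
          rw [zpow_sub₀ two_ne_zero] at h1 h2
          norm_num at h1 h2
          have : (0 : ℝ) < 2 ^ k := by positivity
          linarith
      · simp [P, hl]
    · simp [P, hj]
  · refine ne_top_of_le_ne_top ?_ (ENNReal.tsum_le_tsum hbd)
    rw [ENNReal.tsum_mul_right, ENNReal.tsum_prod']
    simp only [ENNReal.tsum_mul_left, ENNReal.tsum_mul_right]
    exact ENNReal.mul_ne_top (ENNReal.mul_ne_top hf.tsum_l4 hg.tsum_l4) (ψ.memLp 2 volume).2.ne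

end

end RotatingNS

/-! ### The pairing with test functions at a fixed time -/

namespace RotatingNS

section

variable {φ : LPCutoff} {f g : ZDual} {ν : ℝ}

theorem measurable_duhamelSymbol_right (ν Ω t : ℝ) (i n m : Fin 3) :
    Measurable (duhamelSymbol ν Ω t i n m) :=
  (measurable_duhamelSymbol ν Ω i n m).comp (f := fun ξ : R3 => (t, ξ)) (by fun_prop)

theorem Admissible.measurable_realization (hf : Admissible φ f) :
    Measurable (realization φ f) := by
  rw [realization_eq_freqPart]
  exact hf.measurable_freqPart univ

theorem Admissible.eLpNorm_realization_le :
    eLpNorm (realization φ f) 4 volume ≤ ∑' k, l4 φ f k := by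
  rw [realization_eq_freqPart]
  exact (Admissible.eLpNorm_freqPart_le univ).trans (tsum_indicator_le univ f)

/-- The term of indices `n`, `m` of the pairing density. -/
noncomputable def pairingTerm (ν Ω t : ℝ) (F G : R3 → C3) (i n m : Fin 3) (ψ : 𝓢(R3, ℂ)) (x : R3) :
    ℂ := F x n * G x m * transposeMultiplier (duhamelSymbol ν Ω t i n m) ψ x

theorem pairingDensity_eq (ν Ω t : ℝ) (F G : R3 → C3) (i : Fin 3) (ψ : 𝓢(R3, ℂ)) :
    pairingDensity ν Ω t F G i ψ = fun x => ∑ n, ∑ m, pairingTerm ν Ω t F G i n m ψ x := rfl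

theorem Admissible.lintegral_pairingTerm_le (hν : 0 < ν) (Ω : ℝ) {t : ℝ} (ht : 0 ≤ t)
    (hf : Admissible φ f) (hg : Admissible φ g) (i n m : Fin 3) (ψ : 𝓢(R3, ℂ)) :
    ∫⁻ x, ‖pairingTerm ν Ω t (realization φ f) (realization φ g) i n m ψ x‖ₑ ≤
      ((∑' k, l4 φ f k) * ∑' k, l4 φ g k) * (ENNReal.ofReal (12 * (2 * Real.pi)) *
        eLpNorm (weightedFourier ψ) 2 volume) := by
  have hm := measurable_compProd hf.measurable_realization hg.measurable_realization n m
  refine (lintegral_mul_transposeMultiplier_le (F := compProd _ _ n m) hm.aestronglyMeasurable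
    (measurable_duhamelSymbol_right ν Ω t i n m)
    (norm_duhamelSymbol_le_of_nonneg hν Ω ht i n m) ψ).trans ?_
  gcongr
  refine (eLpNorm_compProd_le hf.measurable_realization hg.measurable_realization n m).trans ?_
  gcongr <;> exact Admissible.eLpNorm_realization_le

theorem Admissible.integrable_pairingTerm (hν : 0 < ν) (Ω : ℝ) {t : ℝ} (ht : 0 ≤ t)
    (hf : Admissible φ f) (hg : Admissible φ g) (i n m : Fin 3) (ψ : 𝓢(R3, ℂ)) :
    Integrable (pairingTerm ν Ω t (realization φ f) (realization φ g) i n m ψ) := by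
  refine ⟨?_, ?_⟩
  · refine AEStronglyMeasurable.mul (measurable_compProd hf.measurable_realization
      hg.measurable_realization n m).aestronglyMeasurable ?_
    exact (memLp_transposeMultiplier (measurable_duhamelSymbol_right ν Ω t i n m)
      (norm_duhamelSymbol_le_of_nonneg hν Ω ht i n m) ψ).1
  · refine (hf.lintegral_pairingTerm_le hν Ω ht hg i n m ψ).trans_lt ?_
    refine ENNReal.mul_lt_top (ENNReal.mul_lt_top hf.tsum_l4.lt_top hg.tsum_l4.lt_top) ?_
    exact ENNReal.mul_lt_top ENNReal.ofReal_lt_top ((weightedFourier ψ).memLp 2 volume).2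

theorem Admissible.integrable_pairingDensity (hν : 0 < ν) (Ω : ℝ) {t : ℝ} (ht : 0 ≤ t)
    (hf : Admissible φ f) (hg : Admissible φ g) (i : Fin 3) (ψ : 𝓢(R3, ℂ)) :
    Integrable (pairingDensity ν Ω t (realization φ f) (realization φ g) i ψ) := by
  rw [pairingDensity_eq]
  exact integrable_finsetSum _ fun n _ => integrable_finsetSum _ fun m _ =>
    hf.integrable_pairingTerm hν Ω ht hg i n m ψ

theorem Admissible.integral_pairingDensity (hν : 0 < ν) (Ω : ℝ) {t : ℝ} (ht : 0 ≤ t)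
    (hf : Admissible φ f) (hg : Admissible φ g) (i : Fin 3) (ψ : 𝓢(R3, ℂ)) :
    ∫ x, pairingDensity ν Ω t (realization φ f) (realization φ g) i ψ x =
      ∑ n, ∑ m, ∫ x, pairingTerm ν Ω t (realization φ f) (realization φ g) i n m ψ x := by
  rw [pairingDensity_eq, integral_finsetSum _ fun n _ => integrable_finsetSum _ fun m _ =>
    hf.integrable_pairingTerm hν Ω ht hg i n m ψ]
  exact Finset.sum_congr rfl fun n _ => integral_finsetSum _ fun m _ =>
    hf.integrable_pairingTerm hν Ω ht hg i n m ψ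

theorem Admissible.enorm_integral_pairingDensity_le (hν : 0 < ν) (Ω : ℝ) {t : ℝ} (ht : 0 ≤ t)
    (hf : Admissible φ f) (hg : Admissible φ g) (i : Fin 3) (ψ : 𝓢(R3, ℂ)) :
    ‖∫ x, pairingDensity ν Ω t (realization φ f) (realization φ g) i ψ x‖ₑ ≤
      9 * (((∑' k, l4 φ f k) * ∑' k, l4 φ g k) * (ENNReal.ofReal (12 * (2 * Real.pi)) *
        eLpNorm (weightedFourier ψ) 2 volume)) := by
  rw [hf.integral_pairingDensity hν Ω ht hg]
  refine (enorm_sum_le _ _).trans ((Finset.sum_le_sum fun n _ => (enorm_sum_le _ _).trans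
    (Finset.sum_le_sum fun m _ => (enorm_integral_le_lintegral_enorm _).trans
      (hf.lintegral_pairingTerm_le hν Ω ht hg i n m ψ))).trans_eq ?_)
  rw [Finset.sum_const, Finset.sum_const, Finset.card_univ, Fintype.card_fin, smul_smul,
    nsmul_eq_mul]
  norm_num

theorem Admissible.integral_pairingDensity_add (hν : 0 < ν) (Ω : ℝ) {t : ℝ} (ht : 0 ≤ t)
    (hf : Admissible φ f) (hg : Admissible φ g) (i : Fin 3) (ψ ψ' : 𝓢(R3, ℂ)) :
    ∫ x, pairingDensity ν Ω t (realization φ f) (realization φ g) i (ψ + ψ') x =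
      (∫ x, pairingDensity ν Ω t (realization φ f) (realization φ g) i ψ x)
      + ∫ x, pairingDensity ν Ω t (realization φ f) (realization φ g) i ψ' x := by
  rw [← integral_add (hf.integrable_pairingDensity hν Ω ht hg i ψ)
    (hf.integrable_pairingDensity hν Ω ht hg i ψ')]
  refine integral_congr_ae (Filter.Eventually.of_forall fun x => ?_)
  simp only [pairingDensity, ← Finset.sum_add_distrib,
    transposeMultiplier_add (measurable_duhamelSymbol_right ν Ω t i _ _)
      (norm_duhamelSymbol_le_of_nonneg hν Ω ht i _ _), mul_add]

theorem integral_pairingDensity_smul (ν Ω t : ℝ) (F G : R3 → C3) (i : Fin 3) (c : ℂ)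
    (ψ : 𝓢(R3, ℂ)) : ∫ x, pairingDensity ν Ω t F G i (c • ψ) x =
      c * ∫ x, pairingDensity ν Ω t F G i ψ x := by
  rw [← integral_const_mul]
  refine integral_congr_ae (Filter.Eventually.of_forall fun x => ?_)
  simp only [pairingDensity, transposeMultiplier_smul, Finset.mul_sum]
  refine Finset.sum_congr rfl fun n _ => Finset.sum_congr rfl fun m _ => ?_
  ring

/-- The fixed time `L²` estimate of `Δ_k 𝒢(t) ℙ ∇·(f ⊗ g)`. -/
theorem Admissible.eLpNorm_pairingDensity_block_le (hν : 0 < ν) (Ω : ℝ) {t : ℝ} (ht : 0 ≤ t)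
    (hf : Admissible φ f) (hg : Admissible φ g) (i : Fin 3) (k : ℤ) :
    eLpNorm (fun x => ∫ y, pairingDensity ν Ω t (realization φ f) (realization φ g) i
        (blockTestFun φ k x) y) 2 volume ≤
      9 * (ENNReal.ofReal (32 * SchwartzMap.seminorm ℂ 0 0 φ.toFun *
        (2 ^ k * Real.exp (-(ν * (9 / 16) * (2 ^ k) ^ 2 * t)))) * highSum φ (k - 3) f g) := by
  set c := ENNReal.ofReal (32 * SchwartzMap.seminorm ℂ 0 0 φ.toFun *
        (2 ^ k * Real.exp (-(ν * (9 / 16) * (2 ^ k) ^ 2 * t)))) with hc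
  have hterm : ∀ n m, eLpNorm (fun x => ∫ y, pairingTerm ν Ω t (realization φ f)
      (realization φ g) i n m (blockTestFun φ k x) y) 2 volume ≤ c * highSum φ (k - 3) f g := by
    intro n m
    have := eLpNorm_integral_transposeMultiplier_le φ (hf.memLp_compProd hg _ _ n m)
      (hf.memLp_highProd hg (k - 3) n m) k (hf.integral_lowProd_mul_eq_zero hg k n m)
      (measurable_duhamelSymbol_right ν Ω t i n m)
      (norm_duhamelSymbol_le_of_nonneg hν Ω ht i n m)
      (norm_dualSymbol_blockKernel_le φ hν Ω ht i n m k)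
    simp only [← hf.realization_mul_eq hg] at this
    refine this.trans ?_
    gcongr
    exact hf.eLpNorm_highProd_le hg (k - 3) n m
  -- The triangle inequality in L² needs measurability in x: each term is the Fourier transform of
  -- an integrable function, hence continuous.
  have hmeas : ∀ n m, AEStronglyMeasurable (fun x => ∫ y, pairingTerm ν Ω t (realization φ f)
      (realization φ g) i n m (blockTestFun φ k x) y) volume := by
    intro n m
    have ha := measurable_duhamelSymbol_right ν Ω t i n m
    have hK := norm_duhamelSymbol_le_of_nonneg hν Ω ht i n m
    have hF : MemLp (compProd (realization φ f) (realization φ g) n m) 2 (volume : Measure R3) := by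
      rw [realization_eq_freqPart, realization_eq_freqPart]
      exact hf.memLp_compProd hg _ _ n m
    have e : (fun x => ∫ y, pairingTerm ν Ω t (realization φ f)
      (realization φ g) i n m (blockTestFun φ k x) y) = 𝓕 (fun η => invL2 hF η *
        dualSymbol (duhamelSymbol ν Ω t i n m) (blockKernel φ k) η) := by
      funext x
      refine (integral_mul_transposeMultiplier hF ha hK (blockTestFun φ k x)).trans ?_
      rw [Real.fourier_eq]
      refine integral_congr_ae (Filter.Eventually.of_forall fun η => ?_)
      simp only [dualSymbol_blockTestFun, mul_smul_comm]
    rw [e]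
    have hint : Integrable fun η => invL2 hF η *
        dualSymbol (duhamelSymbol ν Ω t i n m) (blockKernel φ k) η :=
      (Lp.memLp (invL2 hF)).integrable_mul (memLp_dualSymbol ha hK _ 2)
    exact (VectorFourier.fourierIntegral_continuous Real.continuous_fourierChar continuous_inner
      hint).aestronglyMeasurable
  simp only [hf.integral_pairingDensity hν Ω ht hg]
  have e : (fun x => ∑ n, ∑ m, ∫ y, pairingTerm ν Ω t (realization φ f) (realization φ g) i n m
      (blockTestFun φ k x) y) = ∑ n, ∑ m, fun x => ∫ y, pairingTerm ν Ω t (realization φ f)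
      (realization φ g) i n m (blockTestFun φ k x) y := by
    funext x
    simp only [Finset.sum_apply]
  rw [e]
  refine (eLpNorm_sum_le (fun n _ => Finset.aestronglyMeasurable_sum _ fun m _ => hmeas n m)
    one_le_two).trans ((Finset.sum_le_sum fun n _ => (eLpNorm_sum_le (fun m _ => hmeas n m)
      one_le_two).trans (Finset.sum_le_sum fun m _ => hterm n m)).trans_eq ?_)
  rw [Finset.sum_const, Finset.sum_const, Finset.card_univ, Fintype.card_fin, smul_smul,
    nsmul_eq_mul]
  norm_num

end

/-! ### Joint measurability in time and space -/

section Measurability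

theorem stronglyMeasurable_transposeMultiplier (ν Ω : ℝ) (i n m : Fin 3) (ψ : 𝓢(R3, ℂ)) :
    StronglyMeasurable fun q : ℝ × R3 =>
      transposeMultiplier (duhamelSymbol ν Ω q.1 i n m) ψ q.2 := by
  simp only [transposeMultiplier_eq, Real.fourierInv_eq]
  have hmeas : Measurable fun z : (ℝ × R3) × R3 => Real.fourierChar (inner ℝ z.2 z.1.2) •
      dualSymbol (duhamelSymbol ν Ω z.1.1 i n m) ψ z.2 := by
    have h1 : Measurable fun z : (ℝ × R3) × R3 => (Real.fourierChar (inner ℝ z.2 z.1.2) : ℂ) := by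
      refine Continuous.measurable ?_
      have := Real.continuous_fourierChar
      fun_prop
    have h2 : Measurable fun z : (ℝ × R3) × R3 =>
        duhamelSymbol ν Ω z.1.1 i n m (-((2 * Real.pi) • z.2)) :=
      (measurable_duhamelSymbol ν Ω i n m).comp (f := fun z : (ℝ × R3) × R3 =>
        (z.1.1, -((2 * Real.pi) • z.2))) (by fun_prop)
    have h3 : Measurable fun z : (ℝ × R3) × R3 => 𝓕 ψ z.2 :=
      (𝓕 ψ : 𝓢(R3, ℂ)).continuous.measurable.comp measurable_snd
    simp only [Circle.smul_def, dualSymbol, smul_eq_mul]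
    exact h1.mul (h2.mul h3)
  exact hmeas.stronglyMeasurable.integral_prod_right'

/-- Multipliers commute with translations. The point x becomes part of the argument of a fixed
function, which yields measurability jointly in x and the other variables. -/
theorem transposeMultiplier_blockTestFun (φ : LPCutoff) (a : R3 → ℂ) (k : ℤ) (x y : R3) :
    transposeMultiplier a (blockTestFun φ k x) y
      = transposeMultiplier a (blockKernel φ k) (y - x) := by
  simp only [transposeMultiplier_eq, Real.fourierInv_eq]
  refine integral_congr_ae (Filter.Eventually.of_forall fun η => ?_)
  simp only [dualSymbol_blockTestFun, Circle.smul_def, smul_smul]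
  congr 1
  rw [← Circle.coe_mul, ← AddChar.map_add_eq_mul, inner_sub_right, sub_eq_add_neg]

theorem stronglyMeasurable_integral_pairingDensity (ν Ω t : ℝ) (i : Fin 3) {F G : ℝ × R3 → C3}
    (hF : StronglyMeasurable F) (hG : StronglyMeasurable G) (ψ : 𝓢(R3, ℂ)) :
    StronglyMeasurable fun τ : ℝ => ∫ x, pairingDensity ν Ω (t - τ) (fun x => F (τ, x))
      (fun x => G (τ, x)) i ψ x := by
  refine StronglyMeasurable.integral_prod_right' (f := fun z : ℝ × R3 =>
    pairingDensity ν Ω (t - z.1) (fun x => F (z.1, x)) (fun x => G (z.1, x)) i ψ z.2) ?_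
  refine Measurable.stronglyMeasurable ?_
  simp only [pairingDensity]
  have hF' := hF.measurable
  have hG' := hG.measurable
  refine Finset.measurable_sum _ fun n _ => Finset.measurable_sum _ fun m _ => ?_
  have hk : Measurable fun z : ℝ × R3 =>
      transposeMultiplier (duhamelSymbol ν Ω (t - z.1) i n m) ψ z.2 :=
    (stronglyMeasurable_transposeMultiplier ν Ω i n m ψ).measurable.comp
      (f := fun z : ℝ × R3 => (t - z.1, z.2)) (by fun_prop)
  fun_prop

theorem stronglyMeasurable_integral_pairingDensity_block (φ : LPCutoff) (ν Ω : ℝ) (i : Fin 3)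
    (k : ℤ) {F G : ℝ × R3 → C3} (hF : StronglyMeasurable F) (hG : StronglyMeasurable G) :
    StronglyMeasurable fun z : (ℝ × R3) × ℝ => ∫ y, pairingDensity ν Ω (z.1.1 - z.2)
      (fun x => F (z.2, x)) (fun x => G (z.2, x)) i (blockTestFun φ k z.1.2) y := by
  refine StronglyMeasurable.integral_prod_right' (f := fun q : ((ℝ × R3) × ℝ) × R3 =>
    pairingDensity ν Ω (q.1.1.1 - q.1.2) (fun x => F (q.1.2, x)) (fun x => G (q.1.2, x)) i
      (blockTestFun φ k q.1.1.2) q.2) ?_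
  refine Measurable.stronglyMeasurable ?_
  simp only [pairingDensity, transposeMultiplier_blockTestFun]
  have hF' := hF.measurable
  have hG' := hG.measurable
  refine Finset.measurable_sum _ fun n _ => Finset.measurable_sum _ fun m _ => ?_
  have hk : Measurable fun q : ((ℝ × R3) × ℝ) × R3 =>
      transposeMultiplier (duhamelSymbol ν Ω (q.1.1.1 - q.1.2) i n m) (blockKernel φ k)
        (q.2 - q.1.1.2) :=
    (stronglyMeasurable_transposeMultiplier ν Ω i n m (blockKernel φ k)).measurable.comp
      (f := fun q : ((ℝ × R3) × ℝ) × R3 => (q.1.1.1 - q.1.2, q.2 - q.1.1.2)) (by fun_prop)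
  fun_prop

end Measurability

end RotatingNS

/-! ### Summation over pairs of dyadic indices -/

namespace RotatingNS

/-- The sum `∑_{k ∈ ℤ} 2^{-|k|/4}`. -/
noncomputable def geomSum : ℝ≥0∞ := ∑' k : ℤ, pow2 (-(|(k : ℝ)| / 4))

theorem geomSum_ne_top : geomSum ≠ ∞ := by
  have hr : pow2 (-(1 / 4)) < 1 := ENNReal.rpow_lt_one_of_one_lt_of_neg (by norm_num) (by norm_num)
  have hg : ∑' n : ℕ, pow2 (-(1 / 4)) ^ n ≠ ∞ := by
    rw [ENNReal.tsum_geometric]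
    exact ENNReal.inv_ne_top.2 (tsub_pos_of_lt hr).ne'
  have e : ∀ n : ℕ, pow2 (-((n : ℝ) / 4)) = pow2 (-(1 / 4)) ^ n := by
    intro n
    rw [← ENNReal.rpow_natCast, pow2_rpow]
    congr 1
    ring
  rw [geomSum, tsum_of_nat_of_neg_add_one ENNReal.summable ENNReal.summable]
  refine ENNReal.add_ne_top.2 ⟨?_, ?_⟩
  · convert hg using 3 with n
    rw [← e]
    simp
  · refine ne_top_of_le_ne_top hg (ENNReal.tsum_le_tsum fun n => ?_)
    rw [← e]
    refine pow2_mono ?_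
    push_cast
    rw [abs_neg, abs_of_nonneg (by positivity)]
    linarith

theorem tsum_pow2_sub (M : ℤ) : ∑' k : ℤ, pow2 (-(|(k : ℝ) - M| / 4)) = geomSum := by
  rw [geomSum, ← (Equiv.subRight M).tsum_eq fun k : ℤ => pow2 (-(|(k : ℝ)| / 4))]
  simp

theorem tsum_eq_indicator_add_compl (a : ℤ → ℝ≥0∞) :
    ∑' j, a j = ∑' j, (Ici (0 : ℤ)).indicator a j + ∑' j, (Ici (0 : ℤ))ᶜ.indicator a j := by
  rw [← ENNReal.tsum_add]
  exact tsum_congr fun k => (congrFun (indicator_self_add_compl (Ici (0 : ℤ)) a) k).symm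

/-- Bounds of a family of functions of time, in `L^∞` and in `L¹`. -/
structure DecayBound (μ : Measure ℝ) (A : ℝ≥0∞) (α : ℝ → ℤ → ℝ≥0∞) : Prop where
  measurable : ∀ k, AEMeasurable (fun τ => α τ k) μ
  ae_le : ∀ᵐ τ ∂μ, ∀ k : ℤ, α τ k ≤ A * pow2 (k / 4)
  lintegral_le : ∀ k : ℤ, ∫⁻ τ, α τ k ∂μ ≤ A * pow2 (-(7 * k / 4))

variable {μ : Measure ℝ} {A B : ℝ≥0∞} {α β : ℝ → ℤ → ℝ≥0∞}

theorem DecayBound.lintegral_mul_le_aux (hα : DecayBound μ A α) (hβ : DecayBound μ B β) (j l : ℤ) :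
    ∫⁻ τ, α τ j * β τ l ∂μ ≤ A * B * pow2 (-(7 * j / 4) + l / 4) := by
  calc ∫⁻ τ, α τ j * β τ l ∂μ ≤ ∫⁻ τ, α τ j * (B * pow2 (l / 4)) ∂μ := by
        refine lintegral_mono_ae ?_
        filter_upwards [hβ.ae_le] with τ h
        gcongr
        exact h l
    _ = (∫⁻ τ, α τ j ∂μ) * (B * pow2 (l / 4)) := lintegral_mul_const'' _ (hα.measurable j)
    _ ≤ A * pow2 (-(7 * j / 4)) * (B * pow2 (l / 4)) := by gcongr; exact hα.lintegral_le j
    _ = _ := by rw [pow2_add]; ring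

/-- L¹ in time goes on the larger index. For l ≤ j the exponent is -7j/4 + l/4 = -3j/2 - (j - l)/4;
for l ≥ j it is -7l/4 + j/4 = -3j/2 - 7(l - j)/4, of which only a quarter of l - j is kept. -/
theorem DecayBound.lintegral_mul_le (hα : DecayBound μ A α) (hβ : DecayBound μ B β) (j l : ℤ) :
    ∫⁻ τ, α τ j * β τ l ∂μ ≤ A * B * (pow2 (-(3 * j / 2)) * pow2 (-(|(l : ℝ) - j| / 4))) := by
  rw [← pow2_add]
  rcases le_total l j with h | h
  · have h' : (l : ℝ) ≤ j := by exact_mod_cast h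
    refine (hα.lintegral_mul_le_aux hβ j l).trans ?_
    gcongr
    refine pow2_mono ?_
    rw [abs_of_nonpos (by linarith)]
    linarith
  · have h' : (j : ℝ) ≤ l := by exact_mod_cast h
    simp_rw [mul_comm (α _ j)]
    refine (hβ.lintegral_mul_le_aux hα l j).trans ?_
    rw [mul_comm B A]
    gcongr
    refine pow2_mono ?_
    rw [abs_of_nonneg (by linarith)]
    linarith

/-- The sum over l converges by the off-diagonal gain; the sum over j ≥ M is geometric with ratio
2^{-3/2}, dominated by its first term. -/
theorem DecayBound.lintegral_high_le (hα : DecayBound μ A α) (hβ : DecayBound μ B β) (M : ℤ) :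
    ∫⁻ τ, (∑' j, (Ici M).indicator (α τ) j) * ∑' l, β τ l ∂μ ≤
      A * B * pow2 (-(3 * M / 2)) * geomSum ^ 2 := by
  have hind : ∀ j, AEMeasurable (fun τ => (Ici M).indicator (α τ) j) μ := by
    intro j
    by_cases hj : j ∈ Ici M
    · simpa [hj] using hα.measurable j
    · simp [hj]
  have hterm : ∀ j, ∫⁻ τ, (Ici M).indicator (α τ) j * ∑' l, β τ l ∂μ ≤
      A * B * pow2 (-(3 * M / 2)) * geomSum * pow2 (-(|(j : ℝ) - M| / 4)) := by
    intro j
    by_cases hj : j ∈ Ici M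
    · simp only [hj, indicator_of_mem, ← ENNReal.tsum_mul_left]
      rw [lintegral_tsum fun l => (hα.measurable j).fun_mul (hβ.measurable l)]
      refine (ENNReal.tsum_le_tsum fun l => hα.lintegral_mul_le hβ j l).trans ?_
      rw [ENNReal.tsum_mul_left, ENNReal.tsum_mul_left, tsum_pow2_sub]
      have hj' : (M : ℝ) ≤ j := by exact_mod_cast hj
      have h1 : pow2 (-(3 * j / 2)) ≤ pow2 (-(3 * M / 2)) * pow2 (-(|(j : ℝ) - M| / 4)) := by
        rw [← pow2_add]
        refine pow2_mono ?_
        rw [abs_of_nonneg (by linarith)]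
        linarith
      calc _ ≤ A * B * (pow2 (-(3 * M / 2)) * pow2 (-(|(j : ℝ) - M| / 4)) * geomSum) := by gcongr
        _ = _ := by ring
    · simp [hj]
  simp_rw [← ENNReal.tsum_mul_right]
  rw [lintegral_tsum fun j => (hind j).fun_mul (AEMeasurable.tsum hβ.measurable)]
  refine (ENNReal.tsum_le_tsum hterm).trans_eq ?_
  rw [ENNReal.tsum_mul_left, tsum_pow2_sub]
  ring

theorem DecayBound.ae_low_le (hα : DecayBound μ A α) {c : ℝ} (hc : 0 ≤ c) :
    ∀ᵐ τ ∂μ, ∑' k : ℤ, (Ici (0 : ℤ))ᶜ.indicator (fun k : ℤ => pow2 (c * k) * α τ k) k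
      ≤ A * geomSum := by
  filter_upwards [hα.ae_le] with τ h
  rw [geomSum, ← ENNReal.tsum_mul_left]
  refine ENNReal.tsum_le_tsum fun k => ?_
  by_cases hk : k ∈ (Ici (0 : ℤ))ᶜ
  swap
  · rw [indicator_of_notMem hk]
    exact zero_le
  rw [indicator_of_mem hk]
  have hk' : (k : ℝ) ≤ 0 := by
    simp only [mem_compl_iff, mem_Ici, not_le] at hk
    exact_mod_cast hk.le
  calc pow2 (c * k) * α τ k ≤ pow2 (c * k) * (A * pow2 (k / 4)) := by gcongr; exact h k
    _ = A * pow2 (c * k + k / 4) := by rw [pow2_add]; ring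
    _ ≤ A * pow2 (-(|(k : ℝ)| / 4)) := by
      gcongr
      refine pow2_mono ?_
      rw [abs_of_nonpos hk']
      nlinarith

theorem DecayBound.lintegral_weighted_high_le (hα : DecayBound μ A α) {c : ℝ} (hc : c ≤ 1) :
    ∫⁻ τ, ∑' k : ℤ, (Ici (0 : ℤ)).indicator (fun k : ℤ => pow2 (c * k) * α τ k) k ∂μ
      ≤ A * geomSum := by
  rw [lintegral_tsum]
  · rw [geomSum, ← ENNReal.tsum_mul_left]
    refine ENNReal.tsum_le_tsum fun k => ?_
    by_cases hk : k ∈ Ici (0 : ℤ)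
    · have hk' : (0 : ℝ) ≤ k := by exact_mod_cast hk
      simp only [hk, indicator_of_mem]
      rw [lintegral_const_mul'' _ (hα.measurable k)]
      calc _ ≤ pow2 (c * k) * (A * pow2 (-(7 * k / 4))) := by gcongr; exact hα.lintegral_le k
        _ = A * pow2 (c * k + -(7 * k / 4)) := by rw [pow2_add]; ring
        _ ≤ A * pow2 (-(|(k : ℝ)| / 4)) := by
          gcongr
          refine pow2_mono ?_
          rw [abs_of_nonneg hk']
          nlinarith
    · simp [hk]
  · intro k
    by_cases hk : k ∈ Ici (0 : ℤ)
    · simpa [hk] using (hα.measurable k).const_mul _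
    · simp [hk]

/-- Negative indices are summed with the L^∞ bound 2^{ck + k/4}, nonnegative ones with the L¹ bound
2^{ck - 7k/4}; the range 0 ≤ c ≤ 1 makes both geometric. -/
theorem DecayBound.ae_tsum_ne_top (hα : DecayBound μ A α) (hA : A ≠ ∞) {c : ℝ} (hc : 0 ≤ c)
    (hc1 : c ≤ 1) : ∀ᵐ τ ∂μ, ∑' k : ℤ, pow2 (c * k) * α τ k ≠ ∞ := by
  have hfin : A * geomSum ≠ ∞ := ENNReal.mul_ne_top hA geomSum_ne_top
  have h1 := ae_lt_top' (AEMeasurable.tsum fun k => ?_)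
    (ne_top_of_le_ne_top hfin (hα.lintegral_weighted_high_le hc1))
  · filter_upwards [h1, hα.ae_low_le hc] with τ h2 h3
    rw [tsum_eq_indicator_add_compl]
    exact ENNReal.add_ne_top.2 ⟨h2.ne, ne_top_of_le_ne_top hfin h3⟩
  · by_cases hk : k ∈ Ici (0 : ℤ)
    · simpa [hk] using (hα.measurable k).const_mul _
    · simp [hk]

/-- Writing a = a₁ + a₂ and b = b₁ + b₂ (nonnegative and negative indices), ab = a₁b + a₂b₂ + b₁a₂.
The terms with a high factor are integrable by the previous estimate, and a₂b₂ is bounded.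
Finiteness of the measure serves only for a₂b₂, so the length of the time interval enters no
quantitative bound. -/
theorem DecayBound.lintegral_tsum_mul_tsum_ne_top [IsFiniteMeasure μ] (hα : DecayBound μ A α)
    (hβ : DecayBound μ B β) (hA : A ≠ ∞) (hB : B ≠ ∞) :
    ∫⁻ τ, (∑' j, α τ j) * ∑' l, β τ l ∂μ ≠ ∞ := by
  have hle : ∀ᵐ τ ∂μ, (∑' j, α τ j) * ∑' l, β τ l ≤
      ((∑' j, (Ici (0 : ℤ)).indicator (α τ) j) * ∑' l, β τ l)
      + (A * geomSum * (B * geomSum) + (∑' l, (Ici (0 : ℤ)).indicator (β τ) l) * ∑' j, α τ j) := by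
    filter_upwards [hα.ae_low_le le_rfl, hβ.ae_low_le le_rfl] with τ h1 h2
    simp only [zero_mul, pow2_zero, one_mul] at h1 h2
    set a := ∑' j, α τ j with ha
    set b := ∑' j, β τ j with hb
    set a1 := ∑' j, (Ici (0 : ℤ)).indicator (α τ) j
    set b1 := ∑' j, (Ici (0 : ℤ)).indicator (β τ) j
    set a2 := ∑' j, (Ici (0 : ℤ))ᶜ.indicator (α τ) j
    set b2 := ∑' j, (Ici (0 : ℤ))ᶜ.indicator (β τ) j
    have ha' : a = a1 + a2 := tsum_eq_indicator_add_compl _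
    have hb' : b = b1 + b2 := tsum_eq_indicator_add_compl _
    have ha2 : a2 ≤ a := ha'.symm ▸ le_add_self
    calc a * b = a1 * b + (a2 * b2 + b1 * a2) := by
          conv_lhs => rw [ha', add_mul]
          conv_lhs => enter [2]; rw [hb']
          ring
      _ ≤ _ := by gcongr
  refine ne_top_of_le_ne_top ?_ (lintegral_mono_ae hle)
  have hind : ∀ (γ : ℝ → ℤ → ℝ≥0∞), (∀ k, AEMeasurable (fun τ => γ τ k) μ) →
      AEMeasurable (fun τ => ∑' j, (Ici (0 : ℤ)).indicator (γ τ) j) μ := by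
    refine fun γ hγ => AEMeasurable.tsum fun j => ?_
    by_cases hj : j ∈ Ici (0 : ℤ)
    · simpa [hj] using hγ j
    · simp [hj]
  rw [lintegral_add_left' ((hind α hα.measurable).fun_mul (AEMeasurable.tsum hβ.measurable)),
    lintegral_add_left' aemeasurable_const, lintegral_const]
  have hZ := geomSum_ne_top
  have hZ2 : geomSum ^ 2 ≠ ∞ := ENNReal.pow_ne_top hZ
  refine ENNReal.add_ne_top.2 ⟨ne_top_of_le_ne_top ?_ (hα.lintegral_high_le hβ 0),
    ENNReal.add_ne_top.2 ⟨?_, ne_top_of_le_ne_top ?_ (hβ.lintegral_high_le hα 0)⟩⟩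
  · exact ENNReal.mul_ne_top (ENNReal.mul_ne_top (ENNReal.mul_ne_top hA hB) (pow2_ne_top _)) hZ2
  · exact ENNReal.mul_ne_top (ENNReal.mul_ne_top (ENNReal.mul_ne_top hA hZ)
      (ENNReal.mul_ne_top hB hZ)) (measure_ne_top _ _)
  · exact ENNReal.mul_ne_top (ENNReal.mul_ne_top (ENNReal.mul_ne_top hB hA) (pow2_ne_top _)) hZ2

end RotatingNS

/-! ### From the norm of E_{p,T} to decay in L⁴, and back from L² -/

namespace RotatingNS

section

variable {φ : LPCutoff} {Ω p T : ℝ} {u v w : ℝ → ZDual}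

theorem le_hybridNorm_of_le {k : ℤ} (hk : (2 : ℝ) ^ k ≤ Ω) (r : ℝ≥0∞) (s σ : ℝ) :
    pow2 (k * s) * blockNorm φ T r 2 k u ≤ hybridNorm φ Ω T r s σ p u := by
  rw [← ofReal_two_rpow, hybridNorm]
  exact (le_iSup₂ (f := fun (k : ℤ) (_ : (2 : ℝ) ^ k ≤ Ω) =>
    ENNReal.ofReal ((2 : ℝ) ^ ((k : ℝ) * s)) * blockNorm φ T r 2 k u) k hk).trans le_self_add

theorem le_hybridNorm_of_lt {k : ℤ} (hk : Ω < (2 : ℝ) ^ k) (r : ℝ≥0∞) (s σ : ℝ) :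
    pow2 (k * σ) * blockNorm φ T r (ENNReal.ofReal p) k u ≤ hybridNorm φ Ω T r s σ p u := by
  rw [← ofReal_two_rpow, hybridNorm]
  exact (le_iSup₂ (f := fun (k : ℤ) (_ : Ω < (2 : ℝ) ^ k) =>
    ENNReal.ofReal ((2 : ℝ) ^ ((k : ℝ) * σ)) * blockNorm φ T r (ENNReal.ofReal p) k u) k
      hk).trans le_add_self

/-- Each block is controlled in `L^2` or in `L^p`, with the scaling invariant weights. -/
theorem exists_exponent_le_normE (φ : LPCutoff) (Ω p T : ℝ) (u : ℝ → ZDual) (k : ℤ) :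
    ∃ q : ℝ, (q = 2 ∨ q = p) ∧
      pow2 (k * (3 / q - 1)) * blockNorm φ T ∞ (ENNReal.ofReal q) k u ≤ normE φ Ω p T u ∧
      pow2 (k * (3 / q + 1)) * blockNorm φ T 1 (ENNReal.ofReal q) k u ≤ normE φ Ω p T u := by
  rcases le_or_gt ((2 : ℝ) ^ k) Ω with hk | hk
  -- For q = 2 the weights 3/q - 1 and 3/q + 1 are 1/2 and 5/2, so low and high frequencies obey the
  -- same formula.
  · refine ⟨2, Or.inl rfl, ?_, ?_⟩
    · have := le_hybridNorm_of_le (φ := φ) (T := T) (u := u) (p := p) hk ∞ (1 / 2) (3 / p - 1)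
      norm_num at this ⊢
      exact this.trans le_self_add
    · have := le_hybridNorm_of_le (φ := φ) (T := T) (u := u) (p := p) hk 1 (5 / 2) (3 / p + 1)
      norm_num at this ⊢
      exact this.trans le_add_self
  · exact ⟨p, Or.inr rfl, (le_hybridNorm_of_lt hk ∞ _ _).trans le_self_add,
      (le_hybridNorm_of_lt hk 1 _ _).trans le_add_self⟩

theorem le_pow2_neg_mul {s : ℝ} {X N : ℝ≥0∞} (h : pow2 s * X ≤ N) : X ≤ pow2 (-s) * N := by
  calc X = pow2 (-s) * (pow2 s * X) := by
        rw [← mul_assoc, ← pow2_add, neg_add_cancel, pow2_zero, one_mul]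
    _ ≤ _ := by gcongr

theorem ae_eLpNorm_block_le (φ : LPCutoff) (T : ℝ) (q : ℝ≥0∞) (k : ℤ) (u : ℝ → ZDual) :
    ∀ᵐ τ ∂(volume.restrict (Ioo 0 T)), eLpNorm (block φ k (u τ)) q volume
      ≤ blockNorm φ T ∞ q k u := by
  have := enorm_ae_le_eLpNormEssSup (fun τ : ℝ => eLpNorm (fun x : R3 => block φ k (u τ) x) q volume)
    (volume.restrict (Ioo 0 T))
  simpa only [blockNorm, eLpNorm_exponent_top, enorm_eq_self] using this

theorem blockNorm_one (φ : LPCutoff) (T : ℝ) (q : ℝ≥0∞) (k : ℤ) (u : ℝ → ZDual) :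
    blockNorm φ T 1 q k u = ∫⁻ τ in Ioo 0 T, eLpNorm (block φ k (u τ)) q volume := by
  rw [blockNorm, eLpNorm_one_eq_lintegral_enorm]
  simp only [enorm_eq_self]

theorem aemeasurable_l4 (hu : MemE φ Ω p T u) (k : ℤ) :
    AEMeasurable (fun τ => l4 φ (u τ) k) (volume.restrict (Ioo 0 T)) := by
  simp only [l4, eLpNorm_eq_lintegral_rpow_enorm_toReal (p := 4) (by norm_num) (by norm_num)]
  refine AEMeasurable.pow_const ?_ _
  exact AEMeasurable.lintegral_prod_right' ((hu.measurable k).enorm.pow_const _)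

/-- Bernstein from L^q to L⁴ costs 2^{3k(1/q - 1/4)}, and q cancels against the weights: 3/q - 3/4 -
(3/q - 1) = 1/4 and 3/q - 3/4 - (3/q + 1) = -7/4. Here p ≤ 4 is needed. -/
theorem exists_decayBound (φ : LPCutoff) (hp : p ∈ Icc (2 : ℝ) 4) :
    ∃ C : ℝ≥0, ∀ (Ω T : ℝ) (u : ℝ → ZDual), MemE φ Ω p T u →
      DecayBound (volume.restrict (Ioo 0 T)) (C * normE φ Ω p T u) fun τ => l4 φ (u τ) := by
  obtain ⟨C2, hC2⟩ := exists_eLpNorm_block_le φ 2 4 (by norm_num) (by norm_num)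
  obtain ⟨Cp, hCp⟩ := exists_eLpNorm_block_le φ p 4 (by linarith [hp.1]) hp.2
  have hB : ∀ q : ℝ, (q = 2 ∨ q = p) → ∀ (k : ℤ) (f : ZDual), l4 φ f k ≤
      (max C2 Cp : ℝ≥0) * pow2 (3 * k * (1 / q - 1 / 4))
        * eLpNorm (block φ k f) (ENNReal.ofReal q) volume := by
    have h4 : ENNReal.ofReal 4 = 4 := by simp
    rintro q (rfl | rfl) k f
    · refine (h4 ▸ hC2 k f : l4 φ f k ≤ _).trans ?_
      gcongr
      exact le_max_left _ _
    · refine (h4 ▸ hCp k f : l4 φ f k ≤ _).trans ?_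
      gcongr
      exact le_max_right _ _
  refine ⟨max C2 Cp, fun Ω T u hu => ⟨aemeasurable_l4 hu, ae_all_iff.2 fun k => ?_, fun k => ?_⟩⟩
  · obtain ⟨q, hq, h1, -⟩ := exists_exponent_le_normE φ Ω p T u k
    filter_upwards [ae_eLpNorm_block_le φ T (ENNReal.ofReal q) k u] with τ hτ
    refine (hB q hq k (u τ)).trans ?_
    calc _ ≤ (max C2 Cp : ℝ≥0) * pow2 (3 * k * (1 / q - 1 / 4))
          * (pow2 (-(k * (3 / q - 1))) * normE φ Ω p T u) := by
          gcongr
          exact hτ.trans (le_pow2_neg_mul h1)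
      _ = (max C2 Cp : ℝ≥0) * normE φ Ω p T u
          * (pow2 (3 * k * (1 / q - 1 / 4)) * pow2 (-(k * (3 / q - 1)))) := by ring
      _ = _ := by
          rw [← pow2_add]
          congr 2
          ring
  · obtain ⟨q, hq, -, h1⟩ := exists_exponent_le_normE φ Ω p T u k
    rw [blockNorm_one] at h1
    refine (lintegral_mono fun τ => hB q hq k (u τ)).trans ?_
    rw [lintegral_const_mul' _ _ (ENNReal.mul_ne_top ENNReal.coe_ne_top (pow2_ne_top _))]
    calc _ ≤ (max C2 Cp : ℝ≥0) * pow2 (3 * k * (1 / q - 1 / 4))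
          * (pow2 (-(k * (3 / q + 1))) * normE φ Ω p T u) := by
          gcongr
          exact le_pow2_neg_mul h1
      _ = (max C2 Cp : ℝ≥0) * normE φ Ω p T u
          * (pow2 (3 * k * (1 / q - 1 / 4)) * pow2 (-(k * (3 / q + 1)))) := by ring
      _ = _ := by
          rw [← pow2_add]
          congr 2
          ring

/-- The weight c = 0 gives summability in L⁴, and c = 3/4 is the Bernstein weight from L⁴ to L^∞. -/
theorem DecayBound.ae_admissible {A : ℝ≥0∞} (hA : A ≠ ∞)
    (hu : DecayBound (volume.restrict (Ioo 0 T)) A fun τ => l4 φ (u τ)) :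
    ∀ᵐ τ ∂(volume.restrict (Ioo 0 T)), Admissible φ (u τ) := by
  filter_upwards [hu.ae_tsum_ne_top hA (c := 0) le_rfl zero_le_one,
    hu.ae_tsum_ne_top hA (c := 3 / 4) (by norm_num) (by norm_num)] with τ h1 h2
  refine ⟨by simpa [pow2_zero] using h1, ?_⟩
  convert h2 using 5 with k
  ring

theorem DecayBound.lintegral_highSum_le {A B : ℝ≥0∞} {μ : Measure ℝ}
    (hu : DecayBound μ A fun τ => l4 φ (u τ)) (hv : DecayBound μ B fun τ => l4 φ (v τ)) (M : ℤ) :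
    ∫⁻ τ, highSum φ M (u τ) (v τ) ∂μ ≤ 2 * geomSum ^ 2 * (A * B) * pow2 (-(3 * M / 2)) := by
  simp only [highSum]
  rw [lintegral_add_left']
  · have h1 := hu.lintegral_high_le hv M
    have h2 := hv.lintegral_high_le hu M
    simp_rw [mul_comm (∑' j, l4 φ (u _) j)]
    refine (add_le_add h1 h2).trans_eq ?_
    ring
  · refine AEMeasurable.fun_mul ?_ (AEMeasurable.tsum hv.measurable)
    refine AEMeasurable.tsum fun j => ?_
    by_cases hj : j ∈ Ici M
    · simpa [hj] using hu.measurable j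
    · simp [hj]

/-- The norm of `E_{p,T}` is controlled by its analogue with `p = 2`. -/
theorem exists_normE_le (φ : LPCutoff) (hp : 2 ≤ p) : ∃ C : ℝ≥0, ∀ (Ω T : ℝ) (w : ℝ → ZDual)
    (X : ℝ≥0∞),
    (∀ k : ℤ, ∀ t ∈ Ioo 0 T, eLpNorm (block φ k (w t)) 2 volume ≤ X * pow2 (-(k / 2))) →
    (∀ k : ℤ, ∫⁻ t in Ioo 0 T, eLpNorm (block φ k (w t)) 2 volume ≤ X * pow2 (-(5 * k / 2))) →
    normE φ Ω p T w ≤ C * X := by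
  have h2 : ENNReal.ofReal 2 = 2 := by simp
  obtain ⟨C2, hC2⟩ := exists_eLpNorm_block_le φ 2 2 (by norm_num) le_rfl
  obtain ⟨Cp, hCp⟩ := exists_eLpNorm_block_le φ 2 p (by norm_num) hp
  rw [h2] at hC2 hCp
  have key : ∀ (T : ℝ) (w : ℝ → ZDual) (X : ℝ≥0∞),
      (∀ k : ℤ, ∀ t ∈ Ioo 0 T, eLpNorm (block φ k (w t)) 2 volume ≤ X * pow2 (-(k / 2))) →
      (∀ k : ℤ, ∫⁻ t in Ioo 0 T, eLpNorm (block φ k (w t)) 2 volume ≤ X * pow2 (-(5 * k / 2))) →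
      ∀ (C : ℝ≥0) (q : ℝ), (∀ (k : ℤ) (f : ZDual), eLpNorm (block φ k f) (ENNReal.ofReal q) volume ≤
        C * pow2 (3 * k * (1 / 2 - 1 / q)) * eLpNorm (block φ k f) 2 volume) → ∀ k : ℤ,
      pow2 (k * (3 / q - 1)) * blockNorm φ T ∞ (ENNReal.ofReal q) k w ≤ C * X ∧
      pow2 (k * (3 / q + 1)) * blockNorm φ T 1 (ENNReal.ofReal q) k w ≤ C * X := by
    intro T w X hinf hone C q hC k
    constructor
    · have hb : blockNorm φ T ∞ (ENNReal.ofReal q) k w ≤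
          C * pow2 (3 * k * (1 / 2 - 1 / q)) * (X * pow2 (-(k / 2))) := by
        rw [blockNorm, eLpNorm_exponent_top]
        refine eLpNormEssSup_le_of_ae_enorm_bound ?_
        filter_upwards [ae_restrict_mem measurableSet_Ioo] with t ht
        rw [enorm_eq_self]
        refine (hC k (w t)).trans ?_
        gcongr
        exact hinf k t ht
      calc _ ≤ pow2 (k * (3 / q - 1)) * (C * pow2 (3 * k * (1 / 2 - 1 / q))
            * (X * pow2 (-(k / 2)))) := by gcongr
        _ = C * X * (pow2 (k * (3 / q - 1)) * (pow2 (3 * k * (1 / 2 - 1 / q))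
            * pow2 (-(k / 2)))) := by ring
        -- Scaling invariance: 3/q - 1 + 3(1/2 - 1/q) - 1/2 = 0 for every q.
        _ = C * X * pow2 0 := by
          rw [← pow2_add, ← pow2_add]
          congr 2
          ring
        _ = _ := by rw [pow2_zero, mul_one]
    · have hb : blockNorm φ T 1 (ENNReal.ofReal q) k w ≤
          C * pow2 (3 * k * (1 / 2 - 1 / q)) * (X * pow2 (-(5 * k / 2))) := by
        rw [blockNorm_one]
        refine (lintegral_mono fun t => hC k (w t)).trans ?_
        rw [lintegral_const_mul' _ _ (ENNReal.mul_ne_top ENNReal.coe_ne_top (pow2_ne_top _))]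
        gcongr
        exact hone k
      calc _ ≤ pow2 (k * (3 / q + 1)) * (C * pow2 (3 * k * (1 / 2 - 1 / q))
            * (X * pow2 (-(5 * k / 2)))) := by gcongr
        _ = C * X * (pow2 (k * (3 / q + 1)) * (pow2 (3 * k * (1 / 2 - 1 / q))
            * pow2 (-(5 * k / 2)))) := by ring
        _ = C * X * pow2 0 := by
          rw [← pow2_add, ← pow2_add]
          congr 2
          ring
        _ = _ := by rw [pow2_zero, mul_one]
  refine ⟨2 * C2 + 2 * Cp, fun Ω T w X hinf hone => ?_⟩
  have k2 := key T w X hinf hone C2 2 (by rwa [h2])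
  have kp := key T w X hinf hone Cp p hCp
  rw [h2] at k2
  norm_num at k2
  calc normE φ Ω p T w ≤ (C2 * X + Cp * X) + (C2 * X + Cp * X) := by
        simp only [normE, hybridNorm, ofReal_two_rpow]
        gcongr
        · exact iSup₂_le fun k _ => by norm_num; exact (k2 k).1
        · exact iSup₂_le fun k _ => (kp k).1
        · exact iSup₂_le fun k _ => (k2 k).2
        · exact iSup₂_le fun k _ => (kp k).2
    _ = _ := by
      push_cast
      ring

end

end RotatingNS

/-! ### Minkowski's inequality and construction of the Duhamel term -/

namespace RotatingNS

section Minkowski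

variable {X Y : Type*} [MeasurableSpace X] [MeasurableSpace Y] {μ : Measure X} {ν : Measure Y}
/-- Minkowski's integral inequality in `L²`. -/
theorem lintegral_sq_lintegral_le [SFinite μ] [SFinite ν] {h : X × Y → ℝ≥0∞} (hh : Measurable h) :
    ∫⁻ x, (∫⁻ y, h (x, y) ∂ν) ^ 2 ∂μ ≤ (∫⁻ y, (∫⁻ x, h (x, y) ^ (2 : ℝ) ∂μ) ^ (1 / 2 : ℝ) ∂ν) ^ 2 := by
  set N : Y → ℝ≥0∞ := fun y => (∫⁻ x, h (x, y) ^ (2 : ℝ) ∂μ) ^ (1 / 2 : ℝ) with hN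
  have hNm : Measurable N := by
    have : Measurable fun y => ∫⁻ x, h (x, y) ^ (2 : ℝ) ∂μ :=
      (hh.pow_const (2 : ℝ)).lintegral_prod_left'
    exact this.pow_const _
  have hx : ∀ y, Measurable fun x => h (x, y) := fun y => hh.comp measurable_prodMk_right
  have hy : ∀ x, Measurable fun y => h (x, y) := fun x => hh.comp measurable_prodMk_left
  -- Once the square of the inner integral is written as a double integral over (y, z),
  -- Cauchy-Schwarz in x is all that is left.
  have hCS : ∀ y z, ∫⁻ x, h (x, y) * h (x, z) ∂μ ≤ N y * N z := fun y z =>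
    ENNReal.lintegral_mul_le_Lp_mul_Lq μ Real.HolderConjugate.two_two (hx y).aemeasurable
      (hx z).aemeasurable
  calc ∫⁻ x, (∫⁻ y, h (x, y) ∂ν) ^ 2 ∂μ
      = ∫⁻ x, ∫⁻ y, ∫⁻ z, h (x, y) * h (x, z) ∂ν ∂ν ∂μ := by
        refine lintegral_congr fun x => ?_
        simp_rw [lintegral_const_mul _ (hy x), lintegral_mul_const _ (hy x), sq]
    _ = ∫⁻ y, ∫⁻ x, ∫⁻ z, h (x, y) * h (x, z) ∂ν ∂μ ∂ν := by
        refine lintegral_lintegral_swap (f := fun x y => ∫⁻ z, h (x, y) * h (x, z) ∂ν) ?_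
        refine Measurable.aemeasurable ?_
        refine Measurable.lintegral_prod_right' (f := fun q : (X × Y) × Y =>
          h q.1 * h (q.1.1, q.2)) ?_
        exact (hh.comp measurable_fst).mul (hh.comp (f := fun q : (X × Y) × Y => (q.1.1, q.2))
          (by fun_prop))
    _ = ∫⁻ y, ∫⁻ z, ∫⁻ x, h (x, y) * h (x, z) ∂μ ∂ν ∂ν := by
        refine lintegral_congr fun y => ?_
        refine lintegral_lintegral_swap (f := fun x z => h (x, y) * h (x, z)) ?_
        exact (((hx y).comp measurable_fst).mul hh).aemeasurable
    _ ≤ ∫⁻ y, ∫⁻ z, N y * N z ∂ν ∂ν :=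
        lintegral_mono fun y => lintegral_mono fun z => hCS y z
    _ = _ := by simp_rw [lintegral_const_mul _ hNm, lintegral_mul_const _ hNm, sq]

theorem eLpNorm_two_eq {E : Type*} [NormedAddCommGroup E] (f : X → E) :
    eLpNorm f 2 μ = (∫⁻ x, ‖f x‖ₑ ^ (2 : ℝ) ∂μ) ^ (1 / 2 : ℝ) := by
  rw [eLpNorm_eq_lintegral_rpow_enorm_toReal (by norm_num) (by norm_num)]
  simp

theorem eLpNorm_two_integral_le [SFinite μ] [SFinite ν] {H : X × Y → ℂ} (hH : StronglyMeasurable H) :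
    eLpNorm (fun x => ∫ y, H (x, y) ∂ν) 2 μ ≤ ∫⁻ y, eLpNorm (fun x => H (x, y)) 2 μ ∂ν := by
  simp only [eLpNorm_two_eq]
  have h := lintegral_sq_lintegral_le (μ := μ) (ν := ν) hH.enorm
  calc (∫⁻ x, ‖∫ y, H (x, y) ∂ν‖ₑ ^ (2 : ℝ) ∂μ) ^ (1 / 2 : ℝ)
      ≤ (∫⁻ x, (∫⁻ y, ‖H (x, y)‖ₑ ∂ν) ^ 2 ∂μ) ^ (1 / 2 : ℝ) := by
        simp_rw [← ENNReal.rpow_two]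
        gcongr with x
        exact enorm_integral_le_lintegral_enorm fun y => H (x, y)
    _ ≤ _ := by
        refine (ENNReal.rpow_le_rpow h (by norm_num)).trans_eq ?_
        rw [← ENNReal.rpow_natCast, ← ENNReal.rpow_mul]
        norm_num

end Minkowski

variable {φ : LPCutoff} {Ω p T : ℝ} {u v w : ℝ → ZDual}

/-- Only the individual blocks are assumed measurable, and only up to null sets. A jointly
measurable representative of their sum allows Fubini in all the variables; it may replace the
realization because the pairings are integrals over x. -/
theorem MemE.exists_stronglyMeasurable_realization (hu : MemE φ Ω p T u)
    (ha : ∀ᵐ τ ∂(volume.restrict (Ioo 0 T)), Admissible φ (u τ)) :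
    ∃ U : ℝ × R3 → C3, StronglyMeasurable U ∧
      ∀ᵐ τ ∂(volume.restrict (Ioo 0 T)), ∀ᵐ x, realization φ (u τ) x = U (τ, x) := by
  have hm : AEStronglyMeasurable (fun z : ℝ × R3 => realization φ (u z.1) z.2)
      ((volume.restrict (Ioo 0 T)).prod volume) := by
    refine aestronglyMeasurable_of_tendsto_ae (Filter.atTop : Filter (Finset ℤ))
      (f := fun s (z : ℝ × R3) => ∑ k ∈ s, block φ k (u z.1) z.2)
      (fun s => Finset.aestronglyMeasurable_fun_sum s fun k _ => hu.measurable k) ?_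
    filter_upwards [Measure.quasiMeasurePreserving_fst.ae ha] with z hz
    exact (hz.summable z.2).hasSum
  exact ⟨hm.mk _, hm.stronglyMeasurable_mk, Measure.ae_ae_of_ae_prod hm.ae_eq_mk⟩

/-- The properties of `u` and `v` which give a meaning to the Duhamel integral. -/
structure DuhamelAdmissible (φ : LPCutoff) (T : ℝ) (u v : ℝ → ZDual) : Prop where
  left : ∀ᵐ τ ∂(volume.restrict (Ioo 0 T)), Admissible φ (u τ)
  right : ∀ᵐ τ ∂(volume.restrict (Ioo 0 T)), Admissible φ (v τ)
  exists_left : ∃ U : ℝ × R3 → C3, StronglyMeasurable U ∧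
    ∀ᵐ τ ∂(volume.restrict (Ioo 0 T)), ∀ᵐ x, realization φ (u τ) x = U (τ, x)
  exists_right : ∃ V : ℝ × R3 → C3, StronglyMeasurable V ∧
    ∀ᵐ τ ∂(volume.restrict (Ioo 0 T)), ∀ᵐ x, realization φ (v τ) x = V (τ, x)
  lintegral_ne_top : ∫⁻ τ in Ioo 0 T, (∑' k, l4 φ (u τ) k) * ∑' k, l4 φ (v τ) k ≠ ∞

/-- The pairing of the integrand of the Duhamel term with a test function. -/
noncomputable def timePairing (φ : LPCutoff) (ν Ω : ℝ) (u v : ℝ → ZDual) (t : ℝ) (i : Fin 3)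
    (ψ : 𝓢(R3, ℂ)) (τ : ℝ) : ℂ :=
  ∫ x, pairingDensity ν Ω (t - τ) (realization φ (u τ)) (realization φ (v τ)) i ψ x

theorem integral_pairingDensity_congr {F F' G G' : R3 → C3} (hF : ∀ᵐ x, F x = F' x)
    (hG : ∀ᵐ x, G x = G' x) (ν Ω t : ℝ) (i : Fin 3) (ψ : 𝓢(R3, ℂ)) :
    ∫ x, pairingDensity ν Ω t F G i ψ x = ∫ x, pairingDensity ν Ω t F' G' i ψ x := by
  refine integral_congr_ae ?_
  filter_upwards [hF, hG] with x h1 h2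
  simp only [pairingDensity, h1, h2]

section

variable {ν t : ℝ}

theorem ae_restrict_Ioo_of_le {P : ℝ → Prop} (ht : t ≤ T)
    (hP : ∀ᵐ τ ∂(volume.restrict (Ioo 0 T)), P τ) :
    ∀ᵐ τ ∂(volume.restrict (Ioo 0 t)), τ < t ∧ P τ := by
  filter_upwards [ae_restrict_mem measurableSet_Ioo,
    ae_mono (Measure.restrict_mono (Ioo_subset_Ioo_right ht) le_rfl) hP] with τ h1 h2
  exact ⟨h1.2, h2⟩

theorem DuhamelAdmissible.aestronglyMeasurable_timePairing (h : DuhamelAdmissible φ T u v)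
    (ht : t ≤ T) (ν Ω : ℝ) (i : Fin 3) (ψ : 𝓢(R3, ℂ)) :
    AEStronglyMeasurable (timePairing φ ν Ω u v t i ψ) (volume.restrict (Ioo 0 t)) := by
  obtain ⟨U, hU, hU'⟩ := h.exists_left
  obtain ⟨V, hV, hV'⟩ := h.exists_right
  refine (stronglyMeasurable_integral_pairingDensity ν Ω t i hU hV
    ψ).aestronglyMeasurable.congr ?_
  filter_upwards [ae_restrict_Ioo_of_le ht hU', ae_restrict_Ioo_of_le ht hV'] with τ h1 h2
  exact (integral_pairingDensity_congr h1.2 h2.2 ν Ω (t - τ) i ψ).symm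

theorem DuhamelAdmissible.lintegral_enorm_timePairing_le (h : DuhamelAdmissible φ T u v)
    (hν : 0 < ν) (ht : t ≤ T) (Ω : ℝ) (i : Fin 3) (ψ : 𝓢(R3, ℂ)) :
    ∫⁻ τ in Ioo 0 t, ‖timePairing φ ν Ω u v t i ψ τ‖ₑ ≤
      9 * (ENNReal.ofReal (12 * (2 * Real.pi)) *
        ∫⁻ τ in Ioo 0 T, (∑' k, l4 φ (u τ) k) * ∑' k, l4 φ (v τ) k)
        * eLpNorm (weightedFourier ψ) 2 volume := by
  set K := eLpNorm (weightedFourier ψ) 2 volume with hK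
  have hKtop : K ≠ ∞ := ((weightedFourier ψ).memLp 2 volume).2.ne
  calc ∫⁻ τ in Ioo 0 t, ‖timePairing φ ν Ω u v t i ψ τ‖ₑ
      ≤ ∫⁻ τ in Ioo 0 t, (9 * (ENNReal.ofReal (12 * (2 * Real.pi)) * K)) *
          ((∑' k, l4 φ (u τ) k) * ∑' k, l4 φ (v τ) k) := by
        refine lintegral_mono_ae ?_
        filter_upwards [ae_restrict_Ioo_of_le ht h.left, ae_restrict_Ioo_of_le ht h.right]
          with τ h1 h2
        refine (h1.2.enorm_integral_pairingDensity_le hν Ω (sub_nonneg.2 h1.1.le) h2.2 i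
          ψ).trans_eq ?_
        ring
    _ = (9 * (ENNReal.ofReal (12 * (2 * Real.pi)) * K)) *
          ∫⁻ τ in Ioo 0 t, (∑' k, l4 φ (u τ) k) * ∑' k, l4 φ (v τ) k := by
        refine lintegral_const_mul' _ _ ?_
        exact ENNReal.mul_ne_top (by norm_num) (ENNReal.mul_ne_top ENNReal.ofReal_ne_top hKtop)
    _ ≤ (9 * (ENNReal.ofReal (12 * (2 * Real.pi)) * K)) *
          ∫⁻ τ in Ioo 0 T, (∑' k, l4 φ (u τ) k) * ∑' k, l4 φ (v τ) k := by
        gcongr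
    _ = _ := by ring

theorem DuhamelAdmissible.integrable_timePairing (h : DuhamelAdmissible φ T u v)
    (hν : 0 < ν) (ht : t ≤ T) (Ω : ℝ) (i : Fin 3) (ψ : 𝓢(R3, ℂ)) :
    Integrable (timePairing φ ν Ω u v t i ψ) (volume.restrict (Ioo 0 t)) := by
  refine ⟨h.aestronglyMeasurable_timePairing ht ν Ω i ψ,
    (h.lintegral_enorm_timePairing_le hν ht Ω i ψ).trans_lt ?_⟩
  exact ENNReal.mul_lt_top (ENNReal.mul_lt_top (by norm_num) (ENNReal.mul_lt_top
    ENNReal.ofReal_lt_top h.lintegral_ne_top.lt_top)) ((weightedFourier ψ).memLp 2 volume).2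

/-- The Duhamel term, as a functional on Schwartz functions. -/
noncomputable def duhamelFunctional (h : DuhamelAdmissible φ T u v) (hν : 0 < ν) (ht : t ≤ T)
    (Ω : ℝ) (i : Fin 3) : 𝓢(R3, ℂ) →ₗ[ℂ] ℂ where
  toFun ψ := ∫ τ in Ioo 0 t, timePairing φ ν Ω u v t i ψ τ
  map_add' ψ ψ' := by
    rw [← integral_add (h.integrable_timePairing hν ht Ω i ψ)
      (h.integrable_timePairing hν ht Ω i ψ')]
    refine integral_congr_ae ?_
    filter_upwards [ae_restrict_Ioo_of_le ht h.left, ae_restrict_Ioo_of_le ht h.right]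
      with τ h1 h2
    exact h1.2.integral_pairingDensity_add hν Ω (sub_nonneg.2 h1.1.le) h2.2 i ψ ψ'
  map_smul' c ψ := by
    simp only [timePairing, integral_pairingDensity_smul, RingHom.id_apply, smul_eq_mul]
    exact integral_const_mul _ _

theorem exists_norm_duhamelFunctional_le (h : DuhamelAdmissible φ T u v) (hν : 0 < ν)
    (ht : t ≤ T) (Ω : ℝ) (i : Fin 3) : ∃ C : ℝ, ∀ ψ : 𝓢(R3, ℂ),
      ‖duhamelFunctional h hν ht Ω i ψ‖ ≤ C * ‖(weightedFourier ψ).toLp 2 volume‖ := by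
  set D := 9 * (ENNReal.ofReal (12 * (2 * Real.pi)) *
        ∫⁻ τ in Ioo 0 T, (∑' k, l4 φ (u τ) k) * ∑' k, l4 φ (v τ) k) with hD
  have hDtop : D ≠ ∞ := ENNReal.mul_ne_top (by norm_num)
    (ENNReal.mul_ne_top ENNReal.ofReal_ne_top h.lintegral_ne_top)
  refine ⟨D.toReal, fun ψ => ?_⟩
  rw [SchwartzMap.norm_toLp, ← ENNReal.toReal_mul, ← toReal_enorm]
  refine ENNReal.toReal_mono (ENNReal.mul_ne_top hDtop ((weightedFourier ψ).memLp 2 volume).2.ne) ?_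
  exact (enorm_integral_le_lintegral_enorm _).trans
    (h.lintegral_enorm_timePairing_le hν ht Ω i ψ)

theorem continuous_duhamelFunctional (h : DuhamelAdmissible φ T u v) (hν : 0 < ν)
    (ht : t ≤ T) (Ω : ℝ) (i : Fin 3) : Continuous (duhamelFunctional h hν ht Ω i) := by
  obtain ⟨C, hC⟩ := exists_norm_duhamelFunctional_le h hν ht Ω i
  refine continuous_of_continuousAt_zero (duhamelFunctional h hν ht Ω i) ?_
  have hc : Continuous fun ψ : 𝓢(R3, ℂ) => C * ‖(weightedFourier ψ).toLp 2 volume‖ :=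
    continuous_const.mul ((SchwartzMap.toLpCLM ℂ ℂ 2 volume).continuous.comp
      weightedFourier.continuous).norm
  rw [ContinuousAt, map_zero]
  refine squeeze_zero_norm hC ?_
  have := hc.tendsto 0
  rwa [map_zero, ← SchwartzMap.toLpCLM_apply (𝕜 := ℂ), map_zero, norm_zero, mul_zero] at this

theorem DuhamelAdmissible.exists_isDuhamelTerm (h : DuhamelAdmissible φ T u v) (hν : 0 < ν)
    (Ω : ℝ) : ∃ w : ℝ → ZDual, IsDuhamelTerm φ ν Ω T u v w := by
  classical
  -- The value 0 beyond T is immaterial: only times in (0, T) are tested.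
  refine ⟨fun t => if ht : t ≤ T then
      ((EuclideanSpace.equiv (Fin 3) ℂ).symm : (Fin 3 → ℂ) →L[ℂ] C3) ∘L
        ContinuousLinearMap.pi fun i => (⟨duhamelFunctional h hν ht Ω i,
          continuous_duhamelFunctional h hν ht Ω i⟩ : 𝓢(R3, ℂ) →L[ℂ] ℂ) ∘L ZSpace.subtypeL
    else 0, ?_, ?_, ?_, ?_, ?_⟩
  · filter_upwards [h.left] with τ hτ using hτ.summable
  · filter_upwards [h.right] with τ hτ using hτ.summable
  · intro t ht ψ _ _ i
    filter_upwards [ae_restrict_Ioo_of_le ht.2.le h.left, ae_restrict_Ioo_of_le ht.2.le h.right]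
      with τ h1 h2
    exact h1.2.integrable_pairingDensity hν Ω (sub_nonneg.2 h1.1.le) h2.2 i ψ.1
  · intro t ht ψ _ _ i
    exact h.integrable_timePairing hν ht.2.le Ω i ψ.1
  · intro t ht ψ _ _ i
    rw [dif_pos ht.2.le]
    rfl

end

end RotatingNS

/-! ### Estimates of the blocks of the Duhamel term -/

namespace RotatingNS

section

variable {φ : LPCutoff} {ν Ω p T : ℝ} {u v w : ℝ → ZDual}

theorem fourier_blockTestFun_ne_zero {k : ℤ} {x η : R3} (h : (𝓕 (blockTestFun φ k x)) η ≠ 0) :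
    3 / 4 * 2 ^ k ≤ 2 * Real.pi * ‖η‖ ∧ 2 * Real.pi * ‖η‖ ≤ 8 / 3 * 2 ^ k := by
  rw [fourier_blockTestFun] at h
  have := blockSymbol_support φ k (-η) fun h0 => h (by rw [h0, smul_zero])
  rwa [norm_neg] at this

theorem hasCompactSupport_fourier_blockTestFun (φ : LPCutoff) (k : ℤ) (x : R3) :
    HasCompactSupport (𝓕 (blockTestFun φ k x) : 𝓢(R3, ℂ)) := by
  refine HasCompactSupport.of_support_subset_isCompact
    (isCompact_closedBall (0 : R3) (8 / 3 * 2 ^ k)) fun η hη => ?_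
  have h1 := (fourier_blockTestFun_ne_zero hη).2
  rw [mem_closedBall_zero_iff]
  nlinarith [Real.pi_gt_three, norm_nonneg η]

theorem zero_notMem_tsupport_fourier_blockTestFun (φ : LPCutoff) (k : ℤ) (x : R3) :
    (0 : R3) ∉ tsupport (𝓕 (blockTestFun φ k x) : 𝓢(R3, ℂ)) := by
  have hc : IsClosed {η : R3 | 3 / 4 * 2 ^ k ≤ 2 * Real.pi * ‖η‖} :=
    isClosed_le continuous_const (by fun_prop)
  intro h0
  have h1 : 3 / 4 * (2 : ℝ) ^ k ≤ 2 * Real.pi * ‖(0 : R3)‖ :=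
    closure_minimal (fun η hη => (fourier_blockTestFun_ne_zero hη).1) hc h0
  rw [norm_zero, mul_zero] at h1
  have : (0 : ℝ) < 2 ^ k := by positivity
  linarith

/-- The kernels of the blocks have their spectrum in an annulus, so they are admissible test
functions. Hence the defining identity determines every block of w, and the estimates hold for any
such w. -/
theorem IsDuhamelTerm.block_apply (hw : IsDuhamelTerm φ ν Ω T u v w) {t : ℝ} (ht : t ∈ Ioo 0 T)
    (k : ℤ) (x : R3) (i : Fin 3) : block φ k (w t) x i =
      ∫ τ in Ioo 0 t, timePairing φ ν Ω u v t i (blockTestFun φ k x) τ :=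
  hw.eq_integral t ht (blockTest φ k x) (hasCompactSupport_fourier_blockTestFun φ k x)
    (zero_notMem_tsupport_fourier_blockTestFun φ k x) i

/-- The decay of the heat kernel at frequency `2^k`, for positive times. -/
noncomputable def heatDecay (ν : ℝ) (k : ℤ) (s : ℝ) : ℝ≥0∞ :=
  (Ioi 0).indicator (fun s => ENNReal.ofReal (Real.exp (-(ν * (9 / 16) * (2 ^ k) ^ 2 * s)))) s

theorem measurable_heatDecay (ν : ℝ) (k : ℤ) : Measurable (heatDecay ν k) :=
  Measurable.indicator (by fun_prop) measurableSet_Ioi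

theorem heatDecay_le_one (hν : 0 < ν) (k : ℤ) (s : ℝ) : heatDecay ν k s ≤ 1 := by
  refine indicator_apply_le' (fun hs => ?_) fun _ => zero_le
  rw [ENNReal.ofReal_le_one, Real.exp_le_one_iff, neg_nonpos]
  have : (0 : ℝ) ≤ s := (mem_Ioi.1 hs).le
  positivity

theorem lintegral_heatDecay (hν : 0 < ν) (k : ℤ) (τ : ℝ) :
    ∫⁻ t, heatDecay ν k (t - τ) = ENNReal.ofReal (16 / (9 * ν)) * pow2 (-(2 * k)) := by
  rw [lintegral_sub_right_eq_self (heatDecay ν k)]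
  unfold heatDecay
  rw [lintegral_indicator measurableSet_Ioi]
  have hb : 0 < ν * (9 / 16) * ((2 : ℝ) ^ k) ^ 2 := by positivity
  have e : ∀ s : ℝ, -(ν * (9 / 16) * ((2 : ℝ) ^ k) ^ 2 * s)
      = -(ν * (9 / 16) * ((2 : ℝ) ^ k) ^ 2) * s := fun s => by ring
  simp_rw [e]
  rw [← ofReal_integral_eq_lintegral_ofReal (exp_neg_integrableOn_Ioi 0 hb)
    (Filter.Eventually.of_forall fun _ => (Real.exp_pos _).le),
    integral_exp_mul_Ioi (neg_lt_zero.2 hb), mul_zero, Real.exp_zero, ← ofReal_two_rpow,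
    ← ENNReal.ofReal_mul (by positivity)]
  congr 1
  rw [Real.rpow_neg two_pos.le, mul_comm (2 : ℝ) (k : ℝ), Real.rpow_mul two_pos.le,
    Real.rpow_intCast, Real.rpow_two]
  field_simp

/-- The constant of the fixed time estimate. -/
noncomputable def blockConst (φ : LPCutoff) : ℝ≥0∞ :=
  9 * ENNReal.ofReal (32 * SchwartzMap.seminorm ℂ 0 0 φ.toFun)

/-- Extension by zero to τ ≥ t turns the integral over (0, t) into one over the fixed interval (0,
T), with a jointly measurable integrand. Minkowski's inequality and Fubini then apply without moving
end points. -/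
theorem DuhamelAdmissible.exists_kernel (h : DuhamelAdmissible φ T u v) (hν : 0 < ν)
    (hw : IsDuhamelTerm φ ν Ω T u v w) (k : ℤ) (i : Fin 3) :
    ∃ K : (ℝ × R3) × ℝ → ℂ, StronglyMeasurable K ∧
      (∀ t ∈ Ioo 0 T, ∀ x, block φ k (w t) x i = ∫ τ in Ioo 0 T, K ((t, x), τ)) ∧
      ∀ t, ∀ᵐ τ ∂(volume.restrict (Ioo 0 T)), eLpNorm (fun x => K ((t, x), τ)) 2 volume ≤
        blockConst φ * pow2 k * (heatDecay ν k (t - τ) * highSum φ (k - 3) (u τ) (v τ)) := by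
  obtain ⟨U, hU, hU'⟩ := h.exists_left
  obtain ⟨V, hV, hV'⟩ := h.exists_right
  set S : Set ((ℝ × R3) × ℝ) := {z | z.2 < z.1.1} with hS
  have hSm : MeasurableSet S := measurableSet_lt (by fun_prop) (by fun_prop)
  refine ⟨S.indicator fun z => ∫ y, pairingDensity ν Ω (z.1.1 - z.2) (fun x => U (z.2, x))
      (fun x => V (z.2, x)) i (blockTestFun φ k z.1.2) y,
    (stronglyMeasurable_integral_pairingDensity_block φ ν Ω i k hU hV).indicator hSm,
    fun t ht x => ?_, fun t => ?_⟩
  · have hst : Ioo 0 T ∩ Iio t = Ioo 0 t := by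
      rw [Ioo_inter_Iio, min_eq_right ht.2.le]
    rw [hw.block_apply ht, ← hst, ← setIntegral_indicator measurableSet_Iio]
    refine integral_congr_ae ?_
    filter_upwards [hU', hV'] with τ h1 h2
    by_cases hτ : τ < t
    · rw [indicator_of_mem (mem_Iio.2 hτ), indicator_of_mem (show ((t, x), τ) ∈ S from hτ)]
      exact integral_pairingDensity_congr h1 h2 ν Ω (t - τ) i _
    · rw [indicator_of_notMem (by simpa using hτ),
        indicator_of_notMem (show ((t, x), τ) ∉ S from hτ)]
  · filter_upwards [hU', hV', h.left, h.right] with τ h1 h2 h3 h4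
    by_cases hτ : τ < t
    · have e : (fun x => S.indicator (fun z : (ℝ × R3) × ℝ => ∫ y, pairingDensity ν Ω (z.1.1 - z.2)
          (fun x => U (z.2, x)) (fun x => V (z.2, x)) i (blockTestFun φ k z.1.2) y) ((t, x), τ))
          = fun x => ∫ y, pairingDensity ν Ω (t - τ) (realization φ (u τ)) (realization φ (v τ)) i
            (blockTestFun φ k x) y := by
        funext x
        rw [indicator_of_mem (show ((t, x), τ) ∈ S from hτ)]
        exact (integral_pairingDensity_congr h1 h2 ν Ω (t - τ) i _).symm
      rw [e]
      refine (h3.eLpNorm_pairingDensity_block_le hν Ω (sub_nonneg.2 hτ.le) h4 i k).trans_eq ?_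
      rw [heatDecay, indicator_of_mem (mem_Ioi.2 (sub_pos.2 hτ)), blockConst,
        ENNReal.ofReal_mul (p := 32 * SchwartzMap.seminorm ℂ 0 0 φ.toFun) (by positivity),
        ENNReal.ofReal_mul (p := (2 : ℝ) ^ k) (by positivity), ofReal_two_zpow]
      ring
    · have e : (fun x => S.indicator (fun z : (ℝ × R3) × ℝ => ∫ y, pairingDensity ν Ω (z.1.1 - z.2)
          (fun x => U (z.2, x)) (fun x => V (z.2, x)) i (blockTestFun φ k z.1.2) y) ((t, x), τ))
          = 0 := by
        funext x
        exact indicator_of_notMem (show ((t, x), τ) ∉ S from hτ) _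
      rw [e, eLpNorm_zero]
      exact zero_le

theorem eLpNorm_le_sum_apply {f : R3 → C3} (hf : Continuous f) :
    eLpNorm f 2 volume ≤ ∑ i, eLpNorm (fun x => f x i) 2 volume := by
  calc eLpNorm f 2 volume ≤ eLpNorm (∑ i, fun x => ‖f x i‖) 2 volume := by
        refine eLpNorm_mono_real fun x => ?_
        rw [Finset.sum_apply]
        exact norm_le_sum (f x)
    _ ≤ ∑ i, eLpNorm (fun x => ‖f x i‖) 2 volume := by
        refine eLpNorm_sum_le (fun i _ => ?_) one_le_two
        exact (by fun_prop : Continuous fun x => ‖f x i‖).aestronglyMeasurable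
    _ = _ := Finset.sum_congr rfl fun i _ => eLpNorm_norm _

theorem DuhamelAdmissible.eLpNorm_block_le (h : DuhamelAdmissible φ T u v) (hν : 0 < ν)
    (hw : IsDuhamelTerm φ ν Ω T u v w) (k : ℤ) {t : ℝ} (ht : t ∈ Ioo 0 T) :
    eLpNorm (block φ k (w t)) 2 volume ≤ ∑ _i : Fin 3, ∫⁻ τ in Ioo 0 T,
      blockConst φ * pow2 k * (heatDecay ν k (t - τ) * highSum φ (k - 3) (u τ) (v τ)) := by
  refine (eLpNorm_le_sum_apply (continuous_block φ k (w t))).trans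
    (Finset.sum_le_sum fun i _ => ?_)
  obtain ⟨K, hK, hK1, hK2⟩ := h.exists_kernel hν hw k i
  simp only [hK1 t ht]
  refine (eLpNorm_two_integral_le (H := fun z : R3 × ℝ => K ((t, z.1), z.2)) ?_).trans
    (lintegral_mono_ae (hK2 t))
  exact hK.comp_measurable (f := K) (g := fun z : R3 × ℝ => ((t, z.1), z.2)) (by fun_prop)

theorem DuhamelAdmissible.aestronglyMeasurable_block (h : DuhamelAdmissible φ T u v) (hν : 0 < ν)
    (hw : IsDuhamelTerm φ ν Ω T u v w) (k : ℤ) :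
    AEStronglyMeasurable (fun z : ℝ × R3 => block φ k (w z.1) z.2)
      ((volume.restrict (Ioo 0 T)).prod volume) := by
  choose K hK hK1 _ using h.exists_kernel hν hw k
  have hm : Measurable fun z : ℝ × R3 =>
      (EuclideanSpace.equiv (Fin 3) ℂ).symm fun i => ∫ τ in Ioo 0 T, K i (z, τ) := by
    refine (EuclideanSpace.equiv (Fin 3) ℂ).symm.continuous.measurable.comp
      (measurable_pi_lambda _ fun i => ?_)
    exact (hK i).integral_prod_right'.measurable
  refine hm.aestronglyMeasurable.congr ?_
  filter_upwards [Measure.quasiMeasurePreserving_fst.ae (ae_restrict_mem measurableSet_Ioo)]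
    with z hz
  ext i
  exact (hK1 i z.1 hz z.2).symm

theorem DecayBound.aemeasurable_highSum {A B : ℝ≥0∞} {μ : Measure ℝ}
    (hu : DecayBound μ A fun τ => l4 φ (u τ)) (hv : DecayBound μ B fun τ => l4 φ (v τ)) (M : ℤ) :
    AEMeasurable (fun τ => highSum φ M (u τ) (v τ)) μ := by
  have hind : ∀ {A : ℝ≥0∞} {u : ℝ → ZDual}, DecayBound μ A (fun τ => l4 φ (u τ)) →
      AEMeasurable (fun τ => ∑' j, (Ici M).indicator (l4 φ (u τ)) j) μ := by
    refine fun hu => AEMeasurable.tsum fun j => ?_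
    by_cases hj : j ∈ Ici M
    · simpa [hj] using hu.measurable j
    · simp [hj]
  exact ((hind hu).mul (AEMeasurable.tsum hv.measurable)).add
    ((AEMeasurable.tsum hu.measurable).mul (hind hv))

theorem DuhamelAdmissible.of_decayBound {A B : ℝ≥0∞} (hA : A ≠ ∞) (hB : B ≠ ∞)
    (hu : MemE φ Ω p T u) (hv : MemE φ Ω p T v)
    (hu' : DecayBound (volume.restrict (Ioo 0 T)) A fun τ => l4 φ (u τ))
    (hv' : DecayBound (volume.restrict (Ioo 0 T)) B fun τ => l4 φ (v τ)) :
    DuhamelAdmissible φ T u v where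
  left := hu'.ae_admissible hA
  right := hv'.ae_admissible hB
  exists_left := hu.exists_stronglyMeasurable_realization (hu'.ae_admissible hA)
  exists_right := hv.exists_stronglyMeasurable_realization (hv'.ae_admissible hB)
  lintegral_ne_top := hu'.lintegral_tsum_mul_tsum_ne_top hv' hA hB

/-- The constant of the estimates of the blocks of the Duhamel term. -/
noncomputable def duhamelConst (φ : LPCutoff) (ν : ℝ) : ℝ≥0∞ :=
  6 * blockConst φ * geomSum ^ 2 * pow2 (9 / 2) * (1 + ENNReal.ofReal (16 / (9 * ν)))

theorem duhamelConst_ne_top (φ : LPCutoff) (ν : ℝ) : duhamelConst φ ν ≠ ∞ := by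
  refine ENNReal.mul_ne_top (ENNReal.mul_ne_top (ENNReal.mul_ne_top (ENNReal.mul_ne_top
    (by norm_num) (ENNReal.mul_ne_top (by norm_num) ENNReal.ofReal_ne_top))
    (ENNReal.pow_ne_top geomSum_ne_top)) (pow2_ne_top _)) ?_
  exact ENNReal.add_ne_top.2 ⟨ENNReal.one_ne_top, ENNReal.ofReal_ne_top⟩

theorem blockConst_mul_pow2_ne_top (φ : LPCutoff) (k : ℤ) : blockConst φ * pow2 k ≠ ∞ :=
  ENNReal.mul_ne_top (ENNReal.mul_ne_top (by norm_num) ENNReal.ofReal_ne_top) (pow2_ne_top _)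

/-- The shift by 3 in the index costs 2^{9/2}: k - 3(k - 3)/2 = 9/2 - k/2. The factor 3 counts the
components of the vector field. -/
theorem pow2_mul_lintegral_highSum_le {A B : ℝ≥0∞} {μ : Measure ℝ}
    (hu : DecayBound μ A fun τ => l4 φ (u τ)) (hv : DecayBound μ B fun τ => l4 φ (v τ)) (k : ℤ) :
    3 * (blockConst φ * pow2 k * ∫⁻ τ, highSum φ (k - 3) (u τ) (v τ) ∂μ) ≤
      6 * blockConst φ * geomSum ^ 2 * pow2 (9 / 2) * (A * B) * pow2 (-(k / 2)) := by
  calc _ ≤ 3 * (blockConst φ * pow2 k *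
        (2 * geomSum ^ 2 * (A * B) * pow2 (-(3 * (k - 3 : ℤ) / 2)))) := by
        gcongr
        exact hu.lintegral_highSum_le hv (k - 3)
    _ = 6 * blockConst φ * geomSum ^ 2 * (A * B) * (pow2 k * pow2 (-(3 * (k - 3 : ℤ) / 2))) := by
        ring
    _ = 6 * blockConst φ * geomSum ^ 2 * (A * B) * (pow2 (9 / 2) * pow2 (-(k / 2))) := by
        rw [← pow2_add, ← pow2_add]
        congr 2
        push_cast
        ring
    _ = _ := by ring

theorem IsDuhamelTerm.eLpNorm_block_le {A B : ℝ≥0∞} (h : DuhamelAdmissible φ T u v)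
    (hu : DecayBound (volume.restrict (Ioo 0 T)) A fun τ => l4 φ (u τ))
    (hv : DecayBound (volume.restrict (Ioo 0 T)) B fun τ => l4 φ (v τ))
    (hν : 0 < ν) (hw : IsDuhamelTerm φ ν Ω T u v w) (k : ℤ) (t : ℝ) (ht : t ∈ Ioo 0 T) :
    eLpNorm (block φ k (w t)) 2 volume ≤ duhamelConst φ ν * (A * B) * pow2 (-(k / 2)) := by
  refine (h.eLpNorm_block_le hν hw k ht).trans ?_
  rw [Finset.sum_const, Finset.card_univ, Fintype.card_fin, nsmul_eq_mul]
  calc _ ≤ 3 * (blockConst φ * pow2 k * ∫⁻ τ in Ioo 0 T, highSum φ (k - 3) (u τ) (v τ)) := by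
        rw [lintegral_const_mul' _ _ (blockConst_mul_pow2_ne_top φ k)]
        push_cast
        gcongr with τ
        exact mul_le_of_le_one_left zero_le (heatDecay_le_one hν k _)
    _ ≤ _ := pow2_mul_lintegral_highSum_le hu hv k
    _ ≤ 6 * blockConst φ * geomSum ^ 2 * pow2 (9 / 2) * (1 + ENNReal.ofReal (16 / (9 * ν)))
        * (A * B) * pow2 (-(k / 2)) := by
        refine mul_le_mul' (mul_le_mul' ?_ le_rfl) le_rfl
        exact le_mul_of_one_le_right zero_le le_self_add

/-- Exchanging the time integrals leaves the integral of the heat factor, of order 1/(ν4^k); this is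
the gain of 2^{-2k} over the uniform bound. -/
theorem IsDuhamelTerm.lintegral_eLpNorm_block_le {A B : ℝ≥0∞} (h : DuhamelAdmissible φ T u v)
    (hu : DecayBound (volume.restrict (Ioo 0 T)) A fun τ => l4 φ (u τ))
    (hv : DecayBound (volume.restrict (Ioo 0 T)) B fun τ => l4 φ (v τ))
    (hν : 0 < ν) (hw : IsDuhamelTerm φ ν Ω T u v w) (k : ℤ) :
    ∫⁻ t in Ioo 0 T, eLpNorm (block φ k (w t)) 2 volume ≤
      duhamelConst φ ν * (A * B) * pow2 (-(5 * k / 2)) := by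
  have hH := hu.aemeasurable_highSum hv (k - 3)
  set H : ℝ → ℝ≥0∞ := fun τ => highSum φ (k - 3) (u τ) (v τ) with hHdef
  set E := ENNReal.ofReal (16 / (9 * ν)) with hE
  have hmd : Measurable fun z : ℝ × ℝ => heatDecay ν k (z.1 - z.2) :=
    (measurable_heatDecay ν k).comp (by fun_prop)
  have hswap : ∫⁻ t in Ioo 0 T, ∫⁻ τ in Ioo 0 T, heatDecay ν k (t - τ) * H τ ≤
      E * pow2 (-(2 * k)) * ∫⁻ τ in Ioo 0 T, H τ := by
    rw [lintegral_lintegral_swap (f := fun t τ => heatDecay ν k (t - τ) * H τ)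
      (hmd.aemeasurable.mul hH.comp_snd), ← lintegral_const_mul' _ _
      (ENNReal.mul_ne_top ENNReal.ofReal_ne_top (pow2_ne_top _))]
    refine lintegral_mono fun τ => ?_
    have hm : Measurable fun t => heatDecay ν k (t - τ) :=
      (measurable_heatDecay ν k).comp (measurable_id.sub_const τ)
    rw [lintegral_mul_const _ hm]
    gcongr
    exact (setLIntegral_le_lintegral _ _).trans_eq (lintegral_heatDecay hν k τ)
  calc ∫⁻ t in Ioo 0 T, eLpNorm (block φ k (w t)) 2 volume
      ≤ ∫⁻ t in Ioo 0 T, 3 * (blockConst φ * pow2 k) *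
          ∫⁻ τ in Ioo 0 T, heatDecay ν k (t - τ) * H τ := by
        refine setLIntegral_mono' measurableSet_Ioo fun t ht => ?_
        refine (h.eLpNorm_block_le hν hw k ht).trans_eq ?_
        rw [Finset.sum_const, Finset.card_univ, Fintype.card_fin, nsmul_eq_mul,
          lintegral_const_mul' _ _ (blockConst_mul_pow2_ne_top φ k)]
        push_cast
        ring
    _ = 3 * (blockConst φ * pow2 k) *
          ∫⁻ t in Ioo 0 T, ∫⁻ τ in Ioo 0 T, heatDecay ν k (t - τ) * H τ :=
        lintegral_const_mul' _ _ (ENNReal.mul_ne_top (by norm_num)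
          (blockConst_mul_pow2_ne_top φ k))
    _ ≤ 3 * (blockConst φ * pow2 k) * (E * pow2 (-(2 * k)) * ∫⁻ τ in Ioo 0 T, H τ) := by
        gcongr
    _ = E * pow2 (-(2 * k)) * (3 * (blockConst φ * pow2 k * ∫⁻ τ in Ioo 0 T, H τ)) := by ring
    _ ≤ E * pow2 (-(2 * k)) * (6 * blockConst φ * geomSum ^ 2 * pow2 (9 / 2) * (A * B)
          * pow2 (-(k / 2))) := mul_le_mul' le_rfl (pow2_mul_lintegral_highSum_le hu hv k)
    _ = 6 * blockConst φ * geomSum ^ 2 * pow2 (9 / 2) * E * (A * B)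
          * (pow2 (-(2 * k)) * pow2 (-(k / 2))) := by ring
    _ = 6 * blockConst φ * geomSum ^ 2 * pow2 (9 / 2) * E * (A * B) * pow2 (-(5 * k / 2)) := by
        rw [← pow2_add]
        congr 2
        ring
    _ ≤ 6 * blockConst φ * geomSum ^ 2 * pow2 (9 / 2) * (1 + E) * (A * B)
          * pow2 (-(5 * k / 2)) := by
        gcongr
        exact le_add_self

end

end RotatingNS

theorem mainTheorem3 (φ : RotatingNS.LPCutoff) (ν : ℝ) (hν : 0 < ν) (p : ℝ)
    (hp : p ∈ Set.Icc (2 : ℝ) 4) :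
    ∃ C : ℝ≥0, ∀ (Ω T : ℝ), 0 < T → ∀ u v : ℝ → RotatingNS.ZDual,
      RotatingNS.MemE φ Ω p T u → RotatingNS.MemE φ Ω p T v →
        (∃ w : ℝ → RotatingNS.ZDual, RotatingNS.IsDuhamelTerm φ ν Ω T u v w) ∧
        ∀ w : ℝ → RotatingNS.ZDual, RotatingNS.IsDuhamelTerm φ ν Ω T u v w →
          RotatingNS.MemE φ Ω p T w ∧
          RotatingNS.normE φ Ω p T w
            ≤ C * RotatingNS.normE φ Ω p T u * RotatingNS.normE φ Ω p T v := by
  obtain ⟨C₁, hC₁⟩ := RotatingNS.exists_decayBound φ hp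
  obtain ⟨C₂, hC₂⟩ := RotatingNS.exists_normE_le φ hp.1
  -- `C₁` enters once for each factor u, v; `C₂` is the cost of returning from L² to L^p. All three
  -- constants are fixed before Ω and T.
  refine ⟨C₂ * (RotatingNS.duhamelConst φ ν).toNNReal * C₁ ^ 2, fun Ω T _ u v hu hv => ?_⟩
  have hu' := hC₁ Ω T u hu
  have hv' := hC₁ Ω T v hv
  have h := RotatingNS.DuhamelAdmissible.of_decayBound
    (ENNReal.mul_ne_top ENNReal.coe_ne_top hu.norm_lt_top.ne)
    (ENNReal.mul_ne_top ENNReal.coe_ne_top hv.norm_lt_top.ne) hu hv hu' hv'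
  refine ⟨h.exists_isDuhamelTerm hν Ω, fun w hw => ?_⟩
  have hle : RotatingNS.normE φ Ω p T w ≤ (C₂ * (RotatingNS.duhamelConst φ ν).toNNReal * C₁ ^ 2 :
      ℝ≥0) * RotatingNS.normE φ Ω p T u * RotatingNS.normE φ Ω p T v := by
    refine (hC₂ Ω T w _ (hw.eLpNorm_block_le h hu' hv' hν)
      (hw.lintegral_eLpNorm_block_le h hu' hv' hν)).trans_eq ?_
    push_cast
    rw [ENNReal.coe_toNNReal (RotatingNS.duhamelConst_ne_top φ ν)]
    ring
  refine ⟨⟨h.aestronglyMeasurable_block hν hw, hle.trans_lt ?_⟩, hle⟩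
  exact ENNReal.mul_lt_top (ENNReal.mul_lt_top ENNReal.coe_lt_top hu.norm_lt_top) hv.norm_lt_top
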